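/- Diagrams are read from top to bottom. They are the morphisms of the free compact closed PROP (strict symmetric monoidal category with objects $\mathbb N$, symmetry $\sigma$, self-dual compact structure with cap $C_a:0\to2$ and cup $C_u:2\to0$) on given generators. Write $f;g$ for "first $f$, then $g$". **ZX-calculus.** The generators are the green spiders $Z^{n,m}_a:n\to m$ ($a\in\mathbb C$), the Hadamard node $H:1\to1$, the triangle $T:1\to1$ and its inverse $T^{-1}:1\to1$, interpreted as $|0\rangle^{\otimes m}\langle0|^{\otimes n}+a|1\rangle^{\otimes m}\langle1|^{\otimes n}$, $\frac1{\sqrt2}\begin{pmatrix}1&1\\1&-1\end{pmatrix}$, $\begin{pmatrix}1&1\\0&1\end{pmatrix}$, $\begin{pmatrix}1&-1\\0&1\end{pmatrix}$. Put $X^{n,m}_a=H^{\otimes n};Z^{n,m}_a;H^{\otimes m}$ (red spider) and let $T^{\downarrow}$ be $T$ turned upside down by cap and cup. An omitted parameter is $1$. Let $r=X^{0,1};Z^{1,0}$ (the scalar $\sqrt2$), $s_c=X^{0,1}_{-1};Z^{1,0}_{c/\sqrt2}$ (the scalar $c$), $W=Z^{1,2};(T\otimes1);(Z^{1,2}\otimes1);(1\otimes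 X^{2,1})$ and $\wedge=(T\otimes T);Z^{2,1};T^{-1}$ (the AND gate). The algebraic ZX rules are, for all $a,b\in\mathbb C$: - (S1) two green spiders with parameters $a,b$ joined by one or more wires fuse to one with parameter $ab$; the inputs of a green spider are interchangeable, and so are its outputs; - (S2) $Z^{1,1}=X^{1,1}=1$; (S3) $Z^{0,2}=X^{0,2}=C_a$; (Ept) $s_1$ is the empty diagram; - (B1) $(X^{0,1};Z^{1,2})\otimes r=X^{0,1}\otimes X^{0,1}$; (B2) $X^{2,1};Z^{1,2}=\big((Z^{1,2}\otimes Z^{1,2});(1\otimes\sigma\otimes1);(X^{2,1}\otimes X^{2,1})\big)\otimes r$; - (EU) $H=(Z^{1,1}_{\pm i};X^{1,1}_{\pm i};Z^{1,1}_{\pm i})\otimes s_{e^{\mp i\pi/4}}$, for both choices of the sign; - (Brk) $(1\otimes X^{1,1}_{-1});\wedge=\big((Z^{1,2}\otimes1);(1\otimes\wedge);X^{2,1}\big)\otimes r$; - (Bas0) $X^{0,1};T=X^{0,1}$; (Bas1) $X^{0,1}_{-1};T=Z^{0,1}\otimes r$; (Suc) $T;Z^{1,0}_a=Z^{1,0}_{a+1}$;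 (Inv) $T;T^{-1}=T^{-1};T=1$; (Zero) $Z^{0,1}_0\otimes r=X^{0,1}$; - (Pcy) $Z^{1,1}_a;W=W;(Z^{1,1}_a\otimes Z^{1,1}_a)$; (Sym) $W;\sigma=W$; (Aso) $W;(W\otimes1)=W;(1\otimes W)$. **ZH-calculus.** The generators are the white spiders $n\to m$, interpreted as $|0\rangle^{\otimes m}\langle0|^{\otimes n}+|1\rangle^{\otimes m}\langle1|^{\otimes n}$, and the H-boxes $H^{n,m}_a$ ($a\in\mathbb C$), interpreted as $\sum a^{i_1\cdots i_mj_1\cdots j_n}|i_1\cdots i_m\rangle\langle j_1\cdots j_n|$. An H-box without label has $a=-1$, and $H^{0,0}_c$ is the scalar $c$. The grey spider is $\frac12$ times the white spider with an unlabelled H-box on each leg. The negation is $\frac12$ times: an unlabelled H-box, a white spider carrying a further unlabelled H-box with one leg, an unlabelled H-box. The $n$-ary AND gate is $\frac12$ times: $H^{n,1}_{-1}$ followed by an unlabelled H-box. The ZH rules are, for all $n,m\in\mathbb N$ and $a,b\in\mathbb C$: - (ZS1) white spiders joined by one or more wires fuse; (ZS2) the white spider $1\to1$ is the wire; - (HS1)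 $H^{n,1}_{-1};H^{1,1}_{-1};H^{1,m}_a=2\,H^{n,m}_a$; (HS2) $H^{1,1}_{-1};H^{1,1}_{-1}$ is twice the wire; - (BA1), (BA2) a grey spider $n\to1$, respectively an $n$-ary AND gate, followed by a white spider $1\to m$ equals the complete bipartite diagram with $n$ white spiders $1\to m$ on top and $m$ grey spiders $n\to1$, respectively $m$ $n$-ary AND gates, below; - (M) the white spider $2\to1$ on $H^{0,1}_a\otimes H^{0,1}_b$ is $H^{0,1}_{ab}$; (U) $H^{0,1}_1$ is the white spider $0\to1$; - (A) two H-boxes $a$ and $b$, each with two legs, share a white spider with an output $x$ and a white spider $y$ without output, where the wire from $y$ to the second box carries a negation; this equals $2H^{0,1}_{(a+b)/2}$; - (I) $H^{0,1}_a$ on a wire $x$, beside a white spider $0\to1$ on a wire $y$, equals two H-boxes $a$, each with two legs, both joined to a white spider on $x$ and to a white spider on $y$, with a negation on the wire from $y$ to the second box; - (O) let two unlabelled H-boxes with three legs be joined to inputs $z_1$ and $z_2$ respectively, to a common white spider on an input $x$ (with a negation on the wire from $x$ to the second box), and to a white spider $0\to2$; twice this diagram equals the diagram in which the white spider $0\to2$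 is replaced by two white spiders $0\to1$. **Translation.** $\llbracket\cdot\rrbracket_{HX}$ maps ZH-diagrams to ZX-diagrams. It preserves wires, symmetries, caps, cups and both compositions, sends the white spider to $Z^{n,m}_1$, and sends the H-box to $$\llbracket H^{n,m}_a\rrbracket_{HX}=T^{\otimes n};Z^{n,m+1}_1;\big((T^{\downarrow})^{\otimes m}\otimes(T^{-1};Z^{1,0}_a)\big).$$ **Theorem.** The translation preserves the semantics: $\llbracket D\rrbracket_{HX}$ and $D$ have the same standard interpretation, for every ZH-diagram $D$. Moreover, for each instance $D=E$ of a ZH rule (ZS1), (ZS2), (HS1), (HS2), (BA1), (BA2), (M), (U), (A), (I), (O), the equality $\llbracket D\rrbracket_{HX}=\llbracket E\rrbracket_{HX}$ is derivable: it lies in the smallest congruence on ZX-diagrams that contains the algebraic ZX rules and the axioms of compact closed PROPs. -/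

import Mathlib

/-! ### Diagrams: the free compact closed PROP on a family of generators -/

/-- String diagrams with `n` inputs and `m` outputs, built from generators `G`, identities,
symmetries, the compact structure, sequential composition (top to bottom) and juxtaposition. -/
inductive Diag (G : ℕ → ℕ → Type) : ℕ → ℕ → Type
  | gen {n m : ℕ} (g : G n m) : Diag G n m
  | wires (n : ℕ) : Diag G n n
  | swap (n m : ℕ) : Diag G (n + m) (m + n)
  | cap : Diag G 0 2
  | cup : Diag G 2 0
  | comp {n m k : ℕ} (f : Diag G n m) (g : Diag G m k) : Diag G n k
  | tens {n m n' m' : ℕ} (f : Diag G n m) (g : Diag G n' m') : Diag G (n + n') (m + m')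

/-- `f ⨟ g` is `g ∘ f`: first `f`, then `g`. (The ascriptions `( … :)` only make Lean compute the
numbers of wires of the parts before it compares them.) -/
notation:60 f:60 " ⨟ " g:61 => (Diag.comp (f :) (g :) :)

notation:70 f:70 " ⊠ " g:71 => (Diag.tens (f :) (g :) :)

namespace Diag

variable {G : ℕ → ℕ → Type}

/-- Transport along equalities of the numbers of wires (such as associativity of `+`). -/
def cast {n m n' m' : ℕ} (hn : n = n') (hm : m = m') (D : Diag G n m) : Diag G n' m' :=
  hn ▸ hm ▸ D

/-- `k` parallel copies of a `1 → 1` diagram. -/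
def pow (f : Diag G 1 1) : (k : ℕ) → Diag G k k
  | 0 => wires 0
  | k + 1 => pow f k ⊠ f

/-- `k` parallel copies of a `1 → m` diagram. -/
def fanOut {m : ℕ} (f : Diag G 1 m) : (k : ℕ) → Diag G k (m * k)
  | 0 => wires 0
  | k + 1 => fanOut f k ⊠ f

/-- `k` parallel copies of an `n → 1` diagram. -/
def fanIn {n : ℕ} (f : Diag G n 1) : (k : ℕ) → Diag G (n * k) k
  | 0 => wires 0
  | k + 1 => fanIn f k ⊠ f

/-- `m` groups of `n` wires followed by `m` single wires: append the `j`-th single wire to the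
`j`-th group. -/
def interleave (n : ℕ) : (m : ℕ) → Diag G (n * m + m) ((n + 1) * m)
  | 0 => wires 0
  | m + 1 =>
      cast (show n * m + (n + m) + 1 = n * m + n + (m + 1) by omega)
          (show n * m + (m + n) + 1 = n * m + m + (n + 1) by omega)
          (wires (n * m) ⊠ swap n m ⊠ wires 1) ⨟
        (interleave n m ⊠ wires (n + 1))

/-- The permutation from `n` groups of `m` wires to `m` groups of `n` wires that sends the `j`-th
wire of the `i`-th group to the `i`-th wire of the `j`-th group. -/
def shuffle (m : ℕ) : (n : ℕ) → Diag G (m * n) (n * m)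
  | 0 => cast rfl (Nat.zero_mul m).symm (wires 0)
  | n + 1 => (shuffle m n ⊠ wires m) ⨟ interleave n m

/-- Equality of diagrams derivable from the equations `R`: the congruence generated by `R` and by
the axioms of a compact closed PROP (a strict symmetric monoidal category with objects `ℕ`, and a
self-dual compact structure). It relates only diagrams with the same numbers of wires; these
numbers may be presented differently, such as `(a + b) + c` and `a + (b + c)`. -/
inductive Derives (R : ∀ {n m : ℕ}, Diag G n m → Diag G n m → Prop) :
    ∀ {n m n' m' : ℕ}, Diag G n m → Diag G n' m' → Prop
  | rule {n m : ℕ} {D E : Diag G n m} : R D E → Derives R D E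
  | refl {n m : ℕ} (D : Diag G n m) : Derives R D D
  | symm {n m n' m' : ℕ} {D : Diag G n m} {E : Diag G n' m'} : Derives R D E → Derives R E D
  | trans {n m n' m' n'' m'' : ℕ} {D : Diag G n m} {E : Diag G n' m'} {F : Diag G n'' m''} :
      Derives R D E → Derives R E F → Derives R D F
  | comp_congr {n m k n' m' k' : ℕ} {D : Diag G n m} {E : Diag G m k}
      {D' : Diag G n' m'} {E' : Diag G m' k'} :
      Derives R D D' → Derives R E E' → Derives R (D ⨟ E) (D' ⨟ E')
  | tens_congr {a b c d a' b' c' d' : ℕ} {D : Diag G a b} {E : Diag G c d}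
      {D' : Diag G a' b'} {E' : Diag G c' d'} :
      Derives R D D' → Derives R E E' → Derives R (D ⊠ E) (D' ⊠ E')
  | id_comp {n m : ℕ} (D : Diag G n m) : Derives R (wires n ⨟ D) D
  | comp_id {n m : ℕ} (D : Diag G n m) : Derives R (D ⨟ wires m) D
  | comp_assoc {n m k l : ℕ} (D : Diag G n m) (E : Diag G m k) (F : Diag G k l) :
      Derives R (D ⨟ E ⨟ F) (D ⨟ (E ⨟ F))
  | tens_id (n m : ℕ) : Derives R (wires n ⊠ wires m) (wires (n + m))
  | interchange {a b c a' b' c' : ℕ} (D : Diag G a b) (E : Diag G b c)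
      (D' : Diag G a' b') (E' : Diag G b' c') :
      Derives R ((D ⊠ D') ⨟ (E ⊠ E')) ((D ⨟ E) ⊠ (D' ⨟ E'))
  | tens_assoc {a b c d e f : ℕ} (D : Diag G a b) (E : Diag G c d) (F : Diag G e f) :
      Derives R (D ⊠ E ⊠ F) (D ⊠ (E ⊠ F))
  | id_tens {n m : ℕ} (D : Diag G n m) : Derives R (wires 0 ⊠ D) D
  | tens_id_zero {n m : ℕ} (D : Diag G n m) : Derives R (D ⊠ wires 0) D
  | swap_natural {a b c d : ℕ} (D : Diag G a b) (E : Diag G c d) :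
      Derives R ((D ⊠ E) ⨟ swap b d) (swap a c ⨟ (E ⊠ D))
  | swap_swap (n m : ℕ) : Derives R (swap n m ⨟ swap m n) (wires (n + m))
  | swap_add (n m k : ℕ) :
      Derives R (swap n (m + k))
        (cast rfl (Nat.add_assoc m n k) (swap n m ⊠ wires k) ⨟ (wires m ⊠ swap n k))
  | snake_left : Derives R ((cap ⊠ wires 1) ⨟ (wires 1 ⊠ cup)) (wires 1)
  | snake_right : Derives R ((wires 1 ⊠ cap) ⨟ (cup ⊠ wires 1)) (wires 1)
  | cap_swap : Derives R (cap ⨟ swap 1 1) cap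
  | swap_cup : Derives R (swap 1 1 ⨟ cup) cup

/-- Computational basis labels of `n` qubits. -/
abbrev Bits (n : ℕ) : Type := Fin n → Fin 2

/-- The matrix interpretation of diagrams, from an interpretation `I` of the generators. The entry
at `y`, `x` is the amplitude of the output `y` on the input `x`. -/
noncomputable def sem (I : ∀ {n m : ℕ}, G n m → Matrix (Bits m) (Bits n) ℂ) :
    {n m : ℕ} → Diag G n m → Matrix (Bits m) (Bits n) ℂ
  | _, _, gen g => I g
  | _, _, wires _ => 1
  | _, _, swap n m => fun y x =>
      if (∀ i : Fin m, y (Fin.castAdd n i) = x (Fin.natAdd n i)) ∧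
        (∀ i : Fin n, y (Fin.natAdd m i) = x (Fin.castAdd m i)) then 1 else 0
  | _, _, cap => fun y _ => if y 0 = y 1 then 1 else 0
  | _, _, cup => fun _ x => if x 0 = x 1 then 1 else 0
  | _, _, comp f g => sem I g * sem I f
  | _, _, tens (n := n) (m := m) (n' := n') (m' := m') f g => fun y x =>
      sem I f (fun i => y (Fin.castAdd m' i)) (fun i => x (Fin.castAdd n' i)) *
        sem I g (fun i => y (Fin.natAdd m i)) (fun i => x (Fin.natAdd n i))

end Diag

/-! ### The algebraic ZX-calculus -/

/-- Generators of ZX-diagrams: the green spider with parameter `a`, the Hadamard node, the triangle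
and its inverse. -/
inductive ZXGen : ℕ → ℕ → Type
  | Z (n m : ℕ) (a : ℂ) : ZXGen n m
  | H : ZXGen 1 1
  | T : ZXGen 1 1
  | Tinv : ZXGen 1 1

abbrev ZXDiag (n m : ℕ) : Type := Diag ZXGen n m

namespace ZX

open Diag

/-- The standard interpretation of the ZX generators. -/
noncomputable def genSem : {n m : ℕ} → ZXGen n m → Matrix (Bits m) (Bits n) ℂ
  | _, _, .Z _ _ a => fun y x =>
      (if (∀ i, y i = 0) ∧ (∀ j, x j = 0) then 1 else 0) +
        a * (if (∀ i, y i = 1) ∧ (∀ j, x j = 1) then 1 else 0)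
  | _, _, .H => fun y x => ((Real.sqrt 2 : ℝ) : ℂ)⁻¹ * !![1, 1; 1, -1] (y 0) (x 0)
  | _, _, .T => fun y x => !![1, 1; 0, 1] (y 0) (x 0)
  | _, _, .Tinv => fun y x => !![1, -1; 0, 1] (y 0) (x 0)

/-- The standard interpretation of ZX-diagrams. -/
noncomputable def sem {n m : ℕ} (D : ZXDiag n m) : Matrix (Bits m) (Bits n) ℂ :=
  Diag.sem genSem D

/-- Green spider with parameter `a`; the phase `α` is the parameter `e ^ (i α)`, and a spider
without label has parameter `1`. -/
def Z (n m : ℕ) (a : ℂ) : ZXDiag n m := gen (.Z n m a)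

def H : ZXDiag 1 1 := gen .H

def T : ZXDiag 1 1 := gen .T

def Tinv : ZXDiag 1 1 := gen .Tinv

/-- Red spider: the green spider with a Hadamard node on each leg. -/
def X (n m : ℕ) (a : ℂ) : ZXDiag n m := pow H n ⨟ Z n m a ⨟ pow H m

/-- The triangle turned upside down, by bending its wires. -/
def Tdown : ZXDiag 1 1 := (cap ⊠ wires 1) ⨟ (wires 1 ⊠ T ⊠ wires 1) ⨟ (wires 1 ⊠ cup)

/-- A red node on a green node, the scalar `√2`. -/
def sqrtTwo : ZXDiag 0 0 := X 0 1 1 ⨟ Z 1 0 1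

/-- A red `π` node on a green box with parameter `c / √2`, the scalar `c`. -/
noncomputable def scalar (c : ℂ) : ZXDiag 0 0 :=
  X 0 1 (-1) ⨟ Z 1 0 (c / ((Real.sqrt 2 : ℝ) : ℂ))

/-- The W diagram, `√2 W = |00⟩⟨0| + (|01⟩ + |10⟩)⟨1|`. -/
def W : ZXDiag 1 2 := Z 1 2 1 ⨟ (T ⊠ wires 1) ⨟ (Z 1 2 1 ⊠ wires 1) ⨟ (wires 1 ⊠ X 2 1 1)

/-- The AND gate, built from triangles. -/
def And : ZXDiag 2 1 := (T ⊠ T) ⨟ Z 2 1 1 ⨟ Tinv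

/-- The algebraic ZX rules. -/
inductive Rule : ∀ {n m : ℕ}, ZXDiag n m → ZXDiag n m → Prop
  /- (S1): green spiders joined by at least one wire fuse and their parameters multiply. -/
  | S1 (n₁ m₁ k n₂ m₂ : ℕ) (a b : ℂ) :
      Rule
        (cast rfl (Nat.add_assoc m₁ (k + 1) n₂) (Z n₁ (m₁ + (k + 1)) a ⊠ wires n₂) ⨟
          (wires m₁ ⊠ Z (k + 1 + n₂) m₂ b))
        (Z (n₁ + n₂) (m₁ + m₂) (a * b))
  /- The legs of a green spider are interchangeable (part of the meaning of the pictures). -/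
  | S1_inputs (i j m : ℕ) (a : ℂ) :
      Rule ((wires i ⊠ swap 1 1 ⊠ wires j) ⨟ Z (i + 2 + j) m a) (Z (i + 2 + j) m a)
  | S1_outputs (n i j : ℕ) (a : ℂ) :
      Rule (Z n (i + 2 + j) a ⨟ (wires i ⊠ swap 1 1 ⊠ wires j)) (Z n (i + 2 + j) a)
  /- (S2) -/
  | S2_green : Rule (Z 1 1 1) (wires 1)
  | S2_red : Rule (X 1 1 1) (wires 1)
  /- (S3) -/
  | S3_green : Rule (Z 0 2 1) cap
  | S3_red : Rule (X 0 2 1) cap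
  /- (Ept) -/
  | Ept : Rule (scalar 1) (wires 0)
  /- (B1) -/
  | B1 : Rule ((X 0 1 1 ⨟ Z 1 2 1) ⊠ sqrtTwo) (X 0 1 1 ⊠ X 0 1 1)
  /- (B2) -/
  | B2 :
      Rule (X 2 1 1 ⨟ Z 1 2 1)
        (((Z 1 2 1 ⊠ Z 1 2 1) ⨟ (wires 1 ⊠ swap 1 1 ⊠ wires 1) ⨟ (X 2 1 1 ⊠ X 2 1 1)) ⊠ sqrtTwo)
  /- (EU): the two Euler decompositions of the Hadamard node. -/
  | EU_pos :
      Rule H ((Z 1 1 Complex.I ⨟ X 1 1 Complex.I ⨟ Z 1 1 Complex.I) ⊠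
        scalar (Complex.exp (-(Real.pi / 4 * Complex.I))))
  | EU_neg :
      Rule H ((Z 1 1 (-Complex.I) ⨟ X 1 1 (-Complex.I) ⨟ Z 1 1 (-Complex.I)) ⊠
        scalar (Complex.exp (Real.pi / 4 * Complex.I)))
  /- (Brk): flipping an input of an AND gate, `x ∧ ¬ y = x ⊕ (x ∧ y)`. -/
  | Brk :
      Rule ((wires 1 ⊠ X 1 1 (-1)) ⨟ And)
        (((Z 1 2 1 ⊠ wires 1) ⨟ (wires 1 ⊠ And) ⨟ X 2 1 1) ⊠ sqrtTwo)
  /- (Bas0), (Bas1) -/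
  | Bas0 : Rule (X 0 1 1 ⨟ T) (X 0 1 1)
  | Bas1 : Rule (X 0 1 (-1) ⨟ T) (Z 0 1 1 ⊠ sqrtTwo)
  /- (Suc) -/
  | Suc (a : ℂ) : Rule (T ⨟ Z 1 0 a) (Z 1 0 (a + 1))
  /- (Inv) -/
  | Inv_left : Rule (T ⨟ Tinv) (wires 1)
  | Inv_right : Rule (Tinv ⨟ T) (wires 1)
  /- (Zero) -/
  | Zero : Rule (Z 0 1 0 ⊠ sqrtTwo) (X 0 1 1)
  /- (Pcy): phases are copied by W. -/
  | Pcy (a : ℂ) : Rule (Z 1 1 a ⨟ W) (W ⨟ (Z 1 1 a ⊠ Z 1 1 a))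
  /- (Sym): W is symmetric. -/
  | Sym : Rule (W ⨟ swap 1 1) W
  /- (Aso): W is associative. -/
  | Aso : Rule (W ⨟ (W ⊠ wires 1)) (W ⨟ (wires 1 ⊠ W))

/-- `ZX ⊢ D = E`: the equality `D = E` is derivable from the algebraic ZX rules. -/
def Provable {n m : ℕ} (D E : ZXDiag n m) : Prop := Derives Rule D E

end ZX

/-! ### The ZH-calculus -/

/-- Generators of ZH-diagrams: the white spider and the H-box with parameter `a`. -/
inductive ZHGen : ℕ → ℕ → Type
  | Z (n m : ℕ) : ZHGen n m
  | H (n m : ℕ) (a : ℂ) : ZHGen n m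

abbrev ZHDiag (n m : ℕ) : Type := Diag ZHGen n m

namespace ZH

open Diag

/-- The standard interpretation of the ZH generators. -/
noncomputable def genSem : {n m : ℕ} → ZHGen n m → Matrix (Bits m) (Bits n) ℂ
  | _, _, .Z _ _ => fun y x =>
      (if (∀ i, y i = 0) ∧ (∀ j, x j = 0) then 1 else 0) +
        (if (∀ i, y i = 1) ∧ (∀ j, x j = 1) then 1 else 0)
  | _, _, .H _ _ a => fun y x => a ^ ((∏ i, (y i).val) * ∏ j, (x j).val)

/-- The standard interpretation of ZH-diagrams. -/
noncomputable def sem {n m : ℕ} (D : ZHDiag n m) : Matrix (Bits m) (Bits n) ℂ :=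
  Diag.sem genSem D

def Z (n m : ℕ) : ZHDiag n m := gen (.Z n m)

def H (n m : ℕ) (a : ℂ) : ZHDiag n m := gen (.H n m a)

/-- The scalar `c`, an H-box without legs. -/
def scalar (c : ℂ) : ZHDiag 0 0 := H 0 0 c

/-- An H-box without label has parameter `-1`; this is the one with one input and one output. -/
noncomputable def had : ZHDiag 1 1 := H 1 1 (-1)

/-- The grey spider. -/
noncomputable def X (n m : ℕ) : ZHDiag n m := (pow had n ⨟ Z n m ⨟ pow had m) ⊠ scalar (1 / 2)

/-- The negation. -/
noncomputable def neg : ZHDiag 1 1 :=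
  (had ⨟ (wires 1 ⊠ H 0 1 (-1)) ⨟ Z 2 1 ⨟ had) ⊠ scalar (1 / 2)

/-- The AND gate with `n` inputs. -/
noncomputable def And (n : ℕ) : ZHDiag n 1 := (H n 1 (-1) ⨟ had) ⊠ scalar (1 / 2)

/-- The rules of the ZH-calculus. -/
inductive Rule : ∀ {n m : ℕ}, ZHDiag n m → ZHDiag n m → Prop
  /- White spiders joined by at least one wire fuse. -/
  | ZS1 (n₁ m₁ k n₂ m₂ : ℕ) :
      Rule
        (cast rfl (Nat.add_assoc m₁ (k + 1) n₂) (Z n₁ (m₁ + (k + 1)) ⊠ wires n₂) ⨟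
          (wires m₁ ⊠ Z (k + 1 + n₂) m₂))
        (Z (n₁ + n₂) (m₁ + m₂))
  | ZS2 : Rule (Z 1 1) (wires 1)
  | HS1 (n m : ℕ) (a : ℂ) : Rule (H n 1 (-1) ⨟ had ⨟ H 1 m a) (H n m a ⊠ scalar 2)
  | HS2 : Rule (had ⨟ had) (wires 1 ⊠ scalar 2)
  /- The two bialgebra rules; the right-hand sides are complete bipartite graphs. -/
  | BA1 (n m : ℕ) : Rule (X n 1 ⨟ Z 1 m) (fanOut (Z 1 m) n ⨟ shuffle m n ⨟ fanIn (X n 1) m)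
  | BA2 (n m : ℕ) : Rule (And n ⨟ Z 1 m) (fanOut (Z 1 m) n ⨟ shuffle m n ⨟ fanIn (And n) m)
  /- Multiply and unit rules. -/
  | M (a b : ℂ) : Rule ((H 0 1 a ⊠ H 0 1 b) ⨟ Z 2 1) (H 0 1 (a * b))
  | U : Rule (H 0 1 1) (Z 0 1)
  /- Average rule: the sum over `y` of `a ^ (y x) * b ^ ((1 - y) x)` is `2 ((a + b) / 2) ^ x`. -/
  | A (a b : ℂ) :
      Rule
        ((Z 0 2 ⊠ Z 0 3) ⨟ (wires 1 ⊠ swap 1 1 ⊠ wires 2) ⨟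
          (H 2 0 a ⊠ ((neg ⊠ wires 1) ⨟ H 2 0 b) ⊠ wires 1))
        (H 0 1 ((a + b) / 2) ⊠ scalar 2)
  /- Intro rule: `a ^ x = a ^ (x y) * a ^ (x (1 - y))`. -/
  | I (a : ℂ) :
      Rule (H 0 1 a ⊠ Z 0 1)
        ((Z 0 3 ⊠ Z 0 3) ⨟ (wires 2 ⊠ swap 1 1 ⊠ wires 2) ⨟
          (wires 1 ⊠ H 2 0 a ⊠ ((wires 1 ⊠ neg) ⨟ H 2 0 a) ⊠ wires 1))
  /- Ortho rule: two H-boxes controlled by `x` and by `1 - x` need not share a white spider. -/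
  | O :
      Rule
        (((wires 1 ⊠ Z 1 2 ⊠ wires 1) ⨟ (wires 2 ⊠ Z 0 2 ⊠ wires 2) ⨟ (wires 4 ⊠ neg ⊠ wires 1) ⨟
          (H 3 0 (-1) ⊠ H 3 0 (-1))) ⊠ scalar 2)
        ((wires 1 ⊠ Z 1 2 ⊠ wires 1) ⨟ (wires 2 ⊠ (Z 0 1 ⊠ Z 0 1) ⊠ wires 2) ⨟ (wires 4 ⊠ neg ⊠ wires 1) ⨟
          (H 3 0 (-1) ⊠ H 3 0 (-1)))

/-- The translation of the ZH generators: the white spider becomes the green spider with parameter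
`1`, and the H-box becomes a green spider with a triangle on each leg (pointing towards the
spider) and a further leg that ends, through an inverse triangle, in a green box `a`. -/
def genToZX : {n m : ℕ} → ZHGen n m → ZXDiag n m
  | _, _, .Z n m => ZX.Z n m 1
  | _, _, .H n m a =>
      pow ZX.T n ⨟ ZX.Z n (m + 1) 1 ⨟ (pow ZX.Tdown m ⊠ (ZX.Tinv ⨟ ZX.Z 1 0 a))

/-- The translation of ZH-diagrams into ZX-diagrams. -/
def toZX : {n m : ℕ} → ZHDiag n m → ZXDiag n m
  | _, _, .gen g => genToZX g
  | _, _, .wires n => .wires n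
  | _, _, .swap n m => .swap n m
  | _, _, .cap => .cap
  | _, _, .cup => .cup
  | _, _, .comp f g => toZX f ⨟ toZX g
  | _, _, .tens f g => toZX f ⊠ toZX g

end ZH

/-!
The syntactic half is proved in an internal language of sums over bits, in which derivable equations
of ZX-diagrams become identities between sums in a Boolean ring.

ZX-diagrams modulo derivability form a symmetric monoidal category in which the wire is a
commutative comonoid: the green spiders copy and discard it. Maps `K ⟶ 𝟙_ C` out of a commutative
comonoid `K`, a *context*, are *effects* `Eff K`; they multiply pointwise, and a wire may be summed
over (`sm`). Comonoid maps `K ⟶ Y` are *terms* `Tm K Y`; they can be substituted for variables.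
The green cup is an equality test `eqv`, and `sm_eqv_mul` says that a sum over a variable that is
required to equal a term is a substitution. A map is determined by its graph, an effect on its
inputs and outputs, and the graph of a composite is a sum (`graph_comp`). Hence two diagrams are
provably equal as soon as their graphs `rel` agree on all terms (`provable_of_rel`), and every axiom
of the calculus becomes an equation of effects.

The axioms make the terms with values in a wire a Boolean ring. A diagram whose graph is total and
single-valued is an operation on terms (`isComonHom_of_graph`). By (B2) this applies to the red
spider, which gives the addition; the Hadamard node becomes a pairing `ch` that is multiplicative in
each variable, and (EU) says that the phase `-i` is a quadratic function with this polarization,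
which produces the constant `1` and makes the sign a character. The triangle is an order `y ≤ x`;
the rules for W say that phases are multiplicative on disjoint sums (`tri_ph`) and that the order is
compatible with them (`tri_symm`, `tri_assoc`), so that powers of the triangle add up
(`tripow_comp`) and the inverse triangle is its power `-1`. With (Brk), a computation with
alternating sums removes the sum from the AND gate (`andE_eq`); the AND gate is then an
operation on terms, it distributes over the addition, and `ch x y` is the sign of `x * y` (`ch_eq`).

In this language the translated H-box is the phase `a` of the product of its legs (`zrel_box`), the
grey spider, the negation and the AND gate compute sums, complements and products, and each ZH rule
is a short computation. The bialgebra rules hold for every diagram that computes a function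
(`bialgebra`).

The interpretation is preserved by induction on the diagram. The only generator that needs an
argument is the H-box, where the sum over the spider is `1 + (a - 1) = a` if all legs are `1`, and
`1` otherwise (`sem_box`).
-/

open CategoryTheory MonoidalCategory

namespace ZX

open Diag

/-! ### The symmetric monoidal category of ZX-diagrams modulo derivability -/

/-- Casting a diagram along equalities of the numbers of wires does not change it. -/
theorem derives_cast {n m n' m' : ℕ} (hn : n = n') (hm : m = m') (D : ZXDiag n m) :
    Derives Rule (Diag.cast hn hm D) D := by
  subst hn hm; exact .refl _

/-- The identity wires, with the number of outputs presented differently. -/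
def castWires {n m : ℕ} (h : n = m) : ZXDiag n m := Diag.cast rfl h (wires n)

theorem castWires_derives {n m : ℕ} (h : n = m) : Derives Rule (castWires h) (wires n) :=
  derives_cast _ _ _

theorem castWires_comp {n m k : ℕ} (h : n = m) (D : ZXDiag m k) :
    Derives Rule (castWires h ⨟ D) D := by
  subst h; exact .id_comp _

theorem comp_castWires {n m k : ℕ} (h : m = k) (D : ZXDiag n m) :
    Derives Rule (D ⨟ castWires h) D := by
  subst h; exact .comp_id _

/-- The objects of the category of ZX-diagrams: numbers of wires. -/
structure Obj where
  /-- The number of wires. -/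
  num : ℕ

/-- Provable equality of ZX-diagrams of a fixed type. -/
instance diagSetoid (n m : ℕ) : Setoid (ZXDiag n m) where
  r := Provable
  iseqv := ⟨.refl, .symm, .trans⟩

/-- Diagrams modulo derivability. -/
abbrev Hom (a b : Obj) : Type := Quotient (diagSetoid a.num b.num)

instance : Category Obj where
  Hom := Hom
  id a := ⟦wires a.num⟧
  comp f g := Quotient.map₂ (fun f g => f ⨟ g) (fun _ _ h _ _ h' => .comp_congr h h') f g
  id_comp := by rintro a b ⟨f⟩; exact Quotient.sound (.id_comp f)
  comp_id := by rintro a b ⟨f⟩; exact Quotient.sound (.comp_id f)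
  assoc := by rintro a b c d ⟨f⟩ ⟨g⟩ ⟨h⟩; exact Quotient.sound (.comp_assoc f g h)

/-- The class of a diagram. -/
def cls {n m : ℕ} (D : ZXDiag n m) : (⟨n⟩ : Obj) ⟶ ⟨m⟩ := (⟦D⟧ : Hom ⟨n⟩ ⟨m⟩)

theorem cls_eq {n m : ℕ} {D E : ZXDiag n m} : cls D = cls E ↔ Provable D E :=
  Quotient.eq (r := diagSetoid n m)

theorem cls_surj {a b : Obj} (f : a ⟶ b) : ∃ D : ZXDiag a.num b.num, f = cls D := by
  obtain ⟨D, rfl⟩ := Quotient.exists_rep f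
  exact ⟨D, rfl⟩

/-- An equality of the numbers of wires, as an isomorphism. -/
def castIso {a b : Obj} (h : a.num = b.num) : a ≅ b where
  hom := cls (castWires h)
  inv := cls (castWires h.symm)
  hom_inv_id := cls_eq.2 ((castWires_comp _ _).trans (castWires_derives _ |>.trans (by
    cases a; cases b; cases h; exact .refl _)))
  inv_hom_id := cls_eq.2 ((castWires_comp _ _).trans (castWires_derives _ |>.trans (by
    cases a; cases b; cases h; exact .refl _)))

/-- Juxtaposition of classes of diagrams. -/
def tensHom {a b c d : Obj} (f : a ⟶ b) (g : c ⟶ d) :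
    (⟨a.num + c.num⟩ : Obj) ⟶ ⟨b.num + d.num⟩ :=
  Quotient.map₂ (fun f g => f ⊠ g) (fun _ _ h _ _ h' => .tens_congr h h') f g

instance : MonoidalCategoryStruct Obj where
  tensorObj a b := ⟨a.num + b.num⟩
  tensorUnit := ⟨0⟩
  tensorHom f g := tensHom f g
  whiskerLeft a _ _ f := tensHom (𝟙 a) f
  whiskerRight f b := tensHom f (𝟙 b)
  associator a b c := castIso (Nat.add_assoc a.num b.num c.num)
  leftUnitor a := castIso (Nat.zero_add a.num)
  rightUnitor a := castIso (Nat.add_zero a.num)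

theorem derives_wires_comp {n m k l : ℕ} {D : ZXDiag n m} {E : ZXDiag m k} (h : l = n)
    (h' : l = m) (hD : Derives Rule D (wires l)) (hE : Derives Rule E (wires l)) :
    Derives Rule (D ⨟ E) (wires l) := by
  subst h h'
  exact (Derives.comp_congr hD hE).trans (.id_comp _)

theorem derives_wires_tens {n m k l p q : ℕ} {D : ZXDiag n m} {E : ZXDiag k l}
    (hD : Derives Rule D (wires p)) (hE : Derives Rule E (wires q)) :
    Derives Rule (D ⊠ E) (wires (p + q)) :=
  (Derives.tens_congr hD hE).trans (.tens_id _ _)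

theorem derives_wires_of_eq {n m k l : ℕ} {D : ZXDiag n m} (hD : Derives Rule D (wires k))
    (h : k = l) : Derives Rule D (wires l) := by
  subst h; exact hD

instance : MonoidalCategory Obj :=
  MonoidalCategory.ofTensorHom
    (id_tensorHom_id := fun a b => cls_eq.2 (.tens_id _ _))
    (id_tensorHom := fun _ _ _ _ => rfl)
    (tensorHom_id := fun _ _ => rfl)
    (tensorHom_comp_tensorHom := by
      rintro a b c d e f ⟨f₁⟩ ⟨f₂⟩ ⟨g₁⟩ ⟨g₂⟩
      exact cls_eq.2 (.interchange _ _ _ _))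
    (associator_naturality := by
      rintro a b c d e f ⟨f₁⟩ ⟨f₂⟩ ⟨f₃⟩
      exact cls_eq.2 ((comp_castWires _ _).trans ((Derives.tens_assoc _ _ _).trans
        (castWires_comp _ _).symm)))
    (leftUnitor_naturality := by
      rintro a b ⟨f⟩
      exact cls_eq.2 ((comp_castWires _ _).trans ((Derives.id_tens _).trans
        (castWires_comp _ _).symm)))
    (rightUnitor_naturality := by
      rintro a b ⟨f⟩
      exact cls_eq.2 ((comp_castWires _ _).trans ((Derives.tens_id_zero _).trans
        (castWires_comp _ _).symm)))
    (pentagon := by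
      rintro ⟨a⟩ ⟨b⟩ ⟨c⟩ ⟨d⟩
      refine cls_eq.2 (Derives.trans (E := wires (a + b + c + d)) ?_ (Derives.symm ?_))
      · refine derives_wires_comp rfl (by simp only [tensorObj]; omega)
          (derives_wires_tens (castWires_derives _) (.refl _))
          (derives_wires_comp (by simp only [tensorObj]; omega) (by simp only [tensorObj]; omega)
            (derives_wires_of_eq (castWires_derives _) (by simp only [tensorObj]; omega))
            (derives_wires_of_eq (derives_wires_tens (.refl _) (castWires_derives _))
              (by simp only [tensorObj]; omega)))
      · exact derives_wires_comp rfl (by simp only [tensorObj]; omega) (castWires_derives _)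
          (derives_wires_of_eq (castWires_derives _) (by simp only [tensorObj]; omega)))
    (triangle := by
      rintro ⟨a⟩ ⟨b⟩
      refine cls_eq.2 (Derives.trans (E := wires (a + b)) ?_ (Derives.symm ?_))
      · exact derives_wires_comp (by simp [tensorObj, tensorUnit])
          (by simp [tensorObj, tensorUnit])
          (derives_wires_of_eq (castWires_derives _) (by simp [tensorObj, tensorUnit]))
          (derives_wires_of_eq (derives_wires_tens (.refl _) (castWires_derives _))
            (by change a + (0 + b) = a + b; omega))
      · exact derives_wires_of_eq (derives_wires_tens (castWires_derives _) (.refl _))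
            (by change a + 0 + b = a + b; omega))

theorem cast_comp {n m m' k : ℕ} (h : m = m') (D : ZXDiag n m) (E : ZXDiag m' k) :
    Derives Rule (Diag.cast rfl h D ⨟ E) (D ⨟ (castWires h ⨟ E)) := by
  subst h
  exact .comp_congr (.refl _) (castWires_comp _ _).symm

/-- The symmetry, as an isomorphism. -/
def swapIso (X Y : Obj) : X ⊗ Y ≅ Y ⊗ X where
  hom := cls (swap X.num Y.num)
  inv := cls (swap Y.num X.num)
  hom_inv_id := cls_eq.2 (.swap_swap _ _)
  inv_hom_id := cls_eq.2 (.swap_swap _ _)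

theorem hexagon_swapIso (X Y Z : Obj) :
    (α_ X Y Z).hom ≫ (swapIso X (Y ⊗ Z)).hom ≫ (α_ Y Z X).hom =
      ((swapIso X Y).hom ▷ Z) ≫ (α_ Y X Z).hom ≫ (Y ◁ (swapIso X Z).hom) :=
  cls_eq.2 ((castWires_comp _ _).trans ((comp_castWires _ _).trans
    ((Derives.swap_add _ _ _).trans (cast_comp _ _ _))))

instance : SymmetricCategory Obj where
  braiding := swapIso
  braiding_naturality_right := by
    rintro a b c ⟨f⟩
    exact cls_eq.2 (.swap_natural _ _)
  braiding_naturality_left := by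
    rintro a b ⟨f⟩ c
    exact cls_eq.2 (.swap_natural _ _)
  hexagon_forward := hexagon_swapIso
  hexagon_reverse X Y Z := by
    have h : α_ Z X Y ≪≫ swapIso Z (X ⊗ Y) ≪≫ α_ X Y Z =
        whiskerRightIso (swapIso Z X) Y ≪≫ α_ X Z Y ≪≫ whiskerLeftIso X (swapIso Z Y) :=
      Iso.ext (hexagon_swapIso Z X Y)
    have h' := congrArg Iso.inv h
    simp only [Iso.trans_inv, Category.assoc, whiskerRightIso_inv, whiskerLeftIso_inv] at h'
    exact h'
  symmetry a b := cls_eq.2 (.swap_swap _ _)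

end ZX

namespace Ctx

open ComonObj

set_option linter.unusedSectionVars false

universe v u

variable {C : Type u} [Category.{v} C] [MonoidalCategory.{v} C] [SymmetricCategory.{v} C]

/-! ### Contexts: maps out of commutative comonoids -/

/-- Copy the context and apply `f` and `g` to the two copies. -/
def pair {K X Y : C} [ComonObj K] (f : K ⟶ X) (g : K ⟶ Y) : K ⟶ X ⊗ Y := Δ[K] ≫ (f ⊗ₘ g)

/-- The context without its last part. -/
def fst (K Y : C) [ComonObj Y] : K ⊗ Y ⟶ K := (K ◁ ε[Y]) ≫ (ρ_ K).hom

/-- The last part of a context. -/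
def snd (K Y : C) [ComonObj K] : K ⊗ Y ⟶ Y := (ε[K] ▷ Y) ≫ (λ_ Y).hom

section

variable {K L X Y Z X' Y' : C} [ComonObj K] [ComonObj L]

theorem comp_pair (s : L ⟶ K) [IsComonHom s] (f : K ⟶ X) (g : K ⟶ Y) :
    s ≫ pair f g = pair (s ≫ f) (s ≫ g) := by
  simp [pair]

theorem pair_tensor (f : K ⟶ X) (g : K ⟶ Y) (f' : X ⟶ X') (g' : Y ⟶ Y') :
    pair f g ≫ (f' ⊗ₘ g') = pair (f ≫ f') (g ≫ g') := by
  simp [pair]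

theorem pair_whiskerRight (f : K ⟶ X) (g : K ⟶ Y) (f' : X ⟶ X') :
    pair f g ≫ (f' ▷ Y) = pair (f ≫ f') g := by
  simp [pair, MonoidalCategory.tensorHom_def']

theorem pair_whiskerLeft (f : K ⟶ X) (g : K ⟶ Y) (g' : Y ⟶ Y') :
    pair f g ≫ (X ◁ g') = pair f (g ≫ g') := by
  simp [pair, MonoidalCategory.tensorHom_def]

theorem pair_braiding [IsCommComonObj K] (f : K ⟶ X) (g : K ⟶ Y) :
    pair f g ≫ (β_ X Y).hom = pair g f := by
  simp [pair]

theorem pair_assoc (f : K ⟶ X) (g : K ⟶ Y) (h : K ⟶ Z) :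
    pair (pair f g) h ≫ (α_ X Y Z).hom = pair f (pair g h) := by
  have e := ComonObj.comul_assoc K
  have e₁ : pair (pair f g) h = Δ[K] ≫ (Δ[K] ▷ K) ≫ ((f ⊗ₘ g) ⊗ₘ h) := by
    simp only [pair, MonoidalCategory.tensorHom_def', comp_whiskerRight,
      whisker_exchange_assoc]
  have e₂ : pair f (pair g h) = Δ[K] ≫ (K ◁ Δ[K]) ≫ (f ⊗ₘ (g ⊗ₘ h)) := by
    simp only [pair, MonoidalCategory.tensorHom_def, whiskerLeft_comp,
      whisker_exchange_assoc]
  rw [e₁, e₂, ← Category.assoc Δ[K] (K ◁ Δ[K]), e]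
  simp

theorem pair_counit (f : K ⟶ X) : pair f ε[K] ≫ (ρ_ X).hom = f := by
  have : pair f ε[K] = Δ[K] ≫ (K ◁ ε[K]) ≫ (f ▷ 𝟙_ C) := by
    simp [pair, MonoidalCategory.tensorHom_def']
  rw [this]; simp

theorem counit_pair (f : K ⟶ X) : pair ε[K] f ≫ (λ_ X).hom = f := by
  have : pair ε[K] f = Δ[K] ≫ (ε[K] ▷ K) ≫ (𝟙_ C ◁ f) := by
    simp [pair, MonoidalCategory.tensorHom_def]
  rw [this]; simp

theorem pair_tensor_tensor {K' L' : C} (a : K ⟶ X) (b : L ⟶ Y) (c : K ⟶ K') (d : L ⟶ L') :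
    pair (a ⊗ₘ b) (c ⊗ₘ d) = (pair a c ⊗ₘ pair b d) ≫ tensorμ X K' Y L' := by
  simp only [pair, Comon.tensorObj_comul, Category.assoc, ← tensorμ_natural,
    tensorHom_comp_tensorHom_assoc]

theorem comul_eq_pair : Δ[K] = pair (𝟙 K) (𝟙 K) := by simp [pair]

instance tensorHom_isComonHom {f : K ⟶ X'} {g : L ⟶ Y'} [ComonObj X'] [ComonObj Y']
    [IsComonHom f] [IsComonHom g] : IsComonHom (f ⊗ₘ g) where
  hom_counit := by
    simp only [Comon.tensorObj_counit, tensorHom_comp_tensorHom_assoc, IsComonHom.hom_counit]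
  hom_comul := by
    change _ = pair (f ⊗ₘ g) (f ⊗ₘ g)
    rw [pair_tensor_tensor, Comon.tensorObj_comul, tensorHom_comp_tensorHom_assoc]
    simp only [pair, IsComonHom.hom_comul]

theorem fst_eq [ComonObj Y] : fst K Y = (𝟙 K ⊗ₘ ε[Y]) ≫ (ρ_ K).hom := by simp [fst]

theorem snd_eq : snd K Y = (ε[K] ⊗ₘ 𝟙 Y) ≫ (λ_ Y).hom := by simp [snd]

theorem pair_counit_counit : pair ε[K] ε[K] = ε[K] ≫ (λ_ (𝟙_ C)).inv := by
  rw [← cancel_mono (λ_ (𝟙_ C)).hom, counit_pair]; simp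

variable [ComonObj Y]

instance : IsComonHom (fst K Y) where
  hom_counit := by
    rw [Comon.tensorObj_counit]
    simp [fst, MonoidalCategory.tensorHom_def', unitors_equal]
  hom_comul := by
    change _ = pair (fst K Y) (fst K Y)
    rw [fst_eq, ← pair_tensor, pair_tensor_tensor, pair_counit_counit, Category.assoc,
      ← comul_eq_pair]
    have := tensor_right_unitality K K
    have e : (Δ[K] ⊗ₘ ε[Y] ≫ (λ_ (𝟙_ C)).inv) =
      (Δ[K] ⊗ₘ ε[Y]) ≫ ((K ⊗ K) ◁ (λ_ (𝟙_ C)).inv) := by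
      simp only [← id_tensorHom, tensorHom_comp_tensorHom, Category.comp_id]
    rw [e, Category.assoc, Category.assoc, ← this]
    simp [MonoidalCategory.tensorHom_def']

instance : IsComonHom (snd K Y) where
  hom_counit := by
    rw [Comon.tensorObj_counit]
    simp [snd, MonoidalCategory.tensorHom_def]
  hom_comul := by
    change _ = pair (snd K Y) (snd K Y)
    rw [snd_eq, ← pair_tensor, pair_tensor_tensor, pair_counit_counit, Category.assoc,
      ← comul_eq_pair]
    have := tensor_left_unitality Y Y
    have e : (ε[K] ≫ (λ_ (𝟙_ C)).inv ⊗ₘ Δ[Y]) =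
      (ε[K] ⊗ₘ Δ[Y]) ≫ ((λ_ (𝟙_ C)).inv ▷ (Y ⊗ Y)) := by
      simp only [← tensorHom_id, tensorHom_comp_tensorHom, Category.comp_id]
    rw [e, Category.assoc, Category.assoc, ← this]
    simp [MonoidalCategory.tensorHom_def]

theorem pair_id_counit : pair (𝟙 K) ε[K] = (ρ_ K).inv := by
  rw [← cancel_mono (ρ_ K).hom, pair_counit]; simp

theorem counit_pair_id : pair ε[K] (𝟙 K) = (λ_ K).inv := by
  rw [← cancel_mono (λ_ K).hom, counit_pair]; simp

theorem pair_fst_snd : pair (fst K Y) (snd K Y) = 𝟙 (K ⊗ Y) := by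
  rw [fst_eq, snd_eq, ← pair_tensor, pair_tensor_tensor, pair_id_counit, counit_pair_id]
  have e : (β_ (𝟙_ C) (𝟙_ C)).hom = 𝟙 _ := by
    rw [braiding_tensorUnit_left, unitors_equal]; simp
  rw [tensorμ, e]
  monoidal

theorem pair_fst_comp (f : K ⊗ Y ⟶ X) (g : K ⟶ Z) :
    pair f (fst K Y ≫ g) = (Δ[K] ▷ Y) ≫ (α_ _ _ _).hom ≫ (K ◁ (β_ K Y).hom) ≫ (α_ _ _ _).inv ≫
      (f ⊗ₘ g) := by
  have e : pair f (fst K Y ≫ g) =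
      pair (𝟙 K ⊗ₘ 𝟙 Y) (𝟙 K ⊗ₘ ε[Y]) ≫ (f ⊗ₘ ((ρ_ K).hom ≫ g)) := by
    rw [pair_tensor, fst_eq]; simp
  rw [e, pair_tensor_tensor, pair_id_counit, ← comul_eq_pair]
  simp [tensorμ, MonoidalCategory.tensorHom_def]

theorem pair_snd_comp (f : K ⊗ Y ⟶ X) (g : Y ⟶ Z) :
    pair f (snd K Y ≫ g) = (K ◁ Δ[Y]) ≫ (α_ _ _ _).inv ≫ (f ⊗ₘ g) := by
  have e : pair f (snd K Y ≫ g) =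
      pair (𝟙 K ⊗ₘ 𝟙 Y) (ε[K] ⊗ₘ 𝟙 Y) ≫ (f ⊗ₘ ((λ_ Y).hom ≫ g)) := by
    rw [pair_tensor, snd_eq]; simp
  rw [e, pair_tensor_tensor, pair_id_counit, ← comul_eq_pair]
  rw [tensorμ, braiding_tensorUnit_left]
  monoidal

theorem pair_fst (f : K ⟶ X) (g : K ⟶ Y) [IsComonHom g] : pair f g ≫ fst X Y = f := by
  rw [fst, ← Category.assoc, pair_whiskerLeft, IsComonHom.hom_counit, pair_counit]

theorem pair_snd {X : C} [ComonObj X] (f : K ⟶ X) (g : K ⟶ Y) [IsComonHom f] :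
    pair f g ≫ snd X Y = g := by
  rw [snd, ← Category.assoc, pair_whiskerRight, IsComonHom.hom_counit, counit_pair]

theorem pair_pair_tensorμ [IsCommComonObj K] {A B A' B' : C} (a : K ⟶ A) (b : K ⟶ B) (a' : K ⟶ A')
    (b' : K ⟶ B') :
    pair (pair a b) (pair a' b') ≫ tensorμ A B A' B' = pair (pair a a') (pair b b') := by
  have h : pair (pair a b) (pair a' b') ≫ (α_ _ _ _).hom ≫ (A ◁ (α_ _ _ _).inv) =
      pair a (pair (pair b a') b') := by
    rw [← Category.assoc, pair_assoc, pair_whiskerLeft, ← pair_assoc]; simp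
  have h' : pair (pair a a') (pair b b') ≫ (α_ _ _ _).hom ≫ (A ◁ (α_ _ _ _).inv) =
      pair a (pair (pair a' b) b') := by
    rw [← Category.assoc, pair_assoc, pair_whiskerLeft, ← pair_assoc]; simp
  have h'' := congrArg (· ≫ (A ◁ ((β_ B A').hom ▷ B'))) h
  simp only [Category.assoc, pair_whiskerLeft, pair_whiskerRight, pair_braiding] at h''
  rw [← h'] at h''
  have := congrArg (· ≫ (A ◁ (α_ _ _ _).hom) ≫ (α_ _ _ _).inv) h''
  simpa [tensorμ] using this

/-- Copying is a map of contexts, because contexts are commutative. -/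
instance comul_isComonHom [IsCommComonObj K] : IsComonHom Δ[K] where
  hom_counit := by
    rw [Comon.tensorObj_counit]
    simp [MonoidalCategory.tensorHom_def]
  hom_comul := by
    have h := pair_pair_tensorμ (𝟙 K) (𝟙 K) (𝟙 K) (𝟙 K)
    rw [← comul_eq_pair] at h
    rw [Comon.tensorObj_comul]
    simpa [pair] using h

instance pair_isComonHom {X : C} [ComonObj X] [IsCommComonObj K] (f : K ⟶ X) (g : K ⟶ Y)
    [IsComonHom f] [IsComonHom g] : IsComonHom (pair f g) := by
  unfold pair
  infer_instance

end

/-! ### Effects, their products and sums over fresh variables -/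

/-- Effects in a context: scalar-valued functions of the variables of the context. The wrapper keeps
their pointwise product apart from composition. -/
@[ext]
structure Eff (K : C) : Type v where
  hom : K ⟶ 𝟙_ C

section

variable {K L X Y Z : C} [ComonObj K] [IsCommComonObj K]

theorem braiding_unit : (β_ (𝟙_ C) (𝟙_ C)).hom = 𝟙 _ := by
  rw [braiding_tensorUnit_left, unitors_equal]; simp

/-- Effects multiply pointwise. -/
instance : CommMonoid (Eff K) where
  mul f g := ⟨pair f.hom g.hom ≫ (λ_ (𝟙_ C)).hom⟩
  one := ⟨ε[K]⟩
  mul_one f := by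
    ext
    change pair f.hom ε[K] ≫ (λ_ (𝟙_ C)).hom = f.hom
    rw [unitors_equal, pair_counit]
  one_mul f := by
    ext
    change pair ε[K] f.hom ≫ (λ_ (𝟙_ C)).hom = f.hom
    rw [counit_pair]
  mul_comm f g := by
    ext
    change pair f.hom g.hom ≫ (λ_ (𝟙_ C)).hom = pair g.hom f.hom ≫ (λ_ (𝟙_ C)).hom
    rw [← pair_braiding g.hom f.hom, braiding_unit, Category.comp_id]
  mul_assoc f g h := by
    ext
    change pair (pair f.hom g.hom ≫ (λ_ (𝟙_ C)).hom) h.hom ≫ (λ_ (𝟙_ C)).hom =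
      pair f.hom (pair g.hom h.hom ≫ (λ_ (𝟙_ C)).hom) ≫ (λ_ (𝟙_ C)).hom
    rw [← pair_whiskerRight, ← pair_whiskerLeft, ← pair_assoc]
    simp [unitors_equal]

theorem mul_hom (f g : Eff K) : (f * g).hom = pair f.hom g.hom ≫ (λ_ (𝟙_ C)).hom := rfl

theorem one_hom : (1 : Eff K).hom = ε[K] := rfl

/-- Substitution along a map of contexts. -/
def pull [ComonObj L] [IsCommComonObj L] (s : L ⟶ K) [IsComonHom s] : Eff K →* Eff L where
  toFun f := ⟨s ≫ f.hom⟩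
  map_one' := by ext; exact IsComonHom.hom_counit s
  map_mul' f g := by
    ext
    change s ≫ pair f.hom g.hom ≫ _ = pair _ _ ≫ _
    rw [← Category.assoc, comp_pair]

theorem pull_hom [ComonObj L] [IsCommComonObj L] (s : L ⟶ K) [IsComonHom s] (f : Eff K) :
    (pull s f).hom = s ≫ f.hom := rfl

/-- The sum over a fresh variable `Y`. -/
def Sg (η : 𝟙_ C ⟶ Y) (f : Eff (K ⊗ Y)) : Eff K := ⟨(ρ_ K).inv ≫ K ◁ η ≫ f.hom⟩

theorem Sg_hom (η : 𝟙_ C ⟶ Y) (f : Eff (K ⊗ Y)) : (Sg η f).hom = (ρ_ K).inv ≫ K ◁ η ≫ f.hom := rfl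

instance whiskerRight_isComonHom {K L Y : C} [ComonObj K] [ComonObj L] [ComonObj Y] (s : L ⟶ K)
    [IsComonHom s] : IsComonHom (s ▷ Y) := by
  rw [← tensorHom_id]; infer_instance

variable [ComonObj Y] [IsCommComonObj Y] [ComonObj Z] [IsCommComonObj Z]
  [ComonObj L] [IsCommComonObj L]

theorem pull_pull {M : C} [ComonObj M] [IsCommComonObj M] (s : L ⟶ K) [IsComonHom s] (t : M ⟶ L)
    [IsComonHom t] (f : Eff K) : pull t (pull s f) = pull (t ≫ s) f := by
  ext; simp [pull_hom]

theorem pull_Sg (s : L ⟶ K) [IsComonHom s] (η : 𝟙_ C ⟶ Y) (f : Eff (K ⊗ Y)) :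
    pull s (Sg η f) = Sg η (pull (s ▷ Y) f) := by
  ext
  simp only [pull_hom, Sg_hom]
  rw [whisker_exchange_assoc]; simp

/-- A factor that does not depend on the summation variable may be taken out of the sum. -/
theorem Sg_mul (η : 𝟙_ C ⟶ Y) (f : Eff (K ⊗ Y)) (g : Eff K) :
    Sg η (f * pull (fst K Y) g) = Sg η f * g := by
  ext
  simp only [pull_hom, Sg_hom, mul_hom, pair_fst_comp]
  simp only [pair, Category.assoc]
  rw [whisker_exchange_assoc]
  have h : (K ⊗ K) ◁ η ≫ (α_ K K Y).hom ≫ K ◁ (β_ K Y).hom ≫ (α_ K Y K).inv =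
      (α_ _ _ _).hom ≫ K ◁ (ρ_ K).hom ≫ K ◁ (λ_ K).inv ≫ (α_ _ _ _).inv ≫ (K ◁ η) ▷ K := by
    simp only [tensor_whiskerLeft, Category.assoc, Iso.inv_hom_id_assoc]
    rw [← whiskerLeft_comp_assoc K (K ◁ η), BraidedCategory.braiding_naturality_right,
      braiding_tensorUnit_right]
    simp
  have h' := congrArg (fun t => (ρ_ K).inv ≫ Δ[K] ▷ _ ≫ t ≫ (f.hom ⊗ₘ g.hom) ≫
    (λ_ (𝟙_ C)).hom) h
  simp only [Category.assoc] at h' ⊢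
  rw [h']
  simp [MonoidalCategory.tensorHom_def]

/-- The exchange of the last two variables, written as a substitution. -/
theorem exchange_eq : pair (pair (fst (K ⊗ Z) Y ≫ fst K Z) (snd (K ⊗ Z) Y))
    (fst (K ⊗ Z) Y ≫ snd K Z) = (α_ _ _ _).hom ≫ K ◁ (β_ Z Y).hom ≫ (α_ _ _ _).inv := by
  rw [← cancel_mono (α_ _ _ _).hom, pair_assoc,
    ← pair_braiding (fst (K ⊗ Z) Y ≫ snd K Z) (snd (K ⊗ Z) Y), ← pair_whiskerLeft,
    ← pair_assoc, ← comp_pair, pair_fst_snd, Category.comp_id, pair_fst_snd]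
  simp

/-- The associator, written as a substitution. -/
theorem assoc_eq : pair (fst (K ⊗ Y) Z ≫ fst K Y) (pair (fst (K ⊗ Y) Z ≫ snd K Y)
    (snd (K ⊗ Y) Z)) = (α_ _ _ _).hom := by
  rw [← pair_assoc, ← comp_pair, pair_fst_snd, Category.comp_id, pair_fst_snd, Category.id_comp]

theorem Sg_comm (η : 𝟙_ C ⟶ Y) (θ : 𝟙_ C ⟶ Z) (f : Eff ((K ⊗ Y) ⊗ Z)) :
    Sg η (Sg θ f) =
      Sg θ (Sg η (pull (pair (pair (fst _ _ ≫ fst _ _) (snd _ _)) (fst _ _ ≫ snd _ _)) f)) := by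
  ext
  simp only [Sg_hom, pull_hom, exchange_eq]
  simp only [tensor_whiskerLeft, Category.assoc, Iso.inv_hom_id_assoc]
  rw [← whiskerLeft_comp_assoc K (Z ◁ η), BraidedCategory.braiding_naturality_right,
    braiding_tensorUnit_right]
  have e : (ρ_ K).inv ≫ K ◁ η ≫ (ρ_ (K ⊗ Y)).inv ≫ (α_ K Y (𝟙_ C)).hom ≫ K ◁ Y ◁ θ =
      (ρ_ K).inv ≫ K ◁ θ ≫ K ◁ (λ_ Z).inv ≫ K ◁ (η ▷ Z) := by
    have h := whisker_exchange η θ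
    have h' := congrArg (fun t => (ρ_ K).inv ≫ K ◁ (ρ_ _).inv ≫ K ◁ t) h
    simp only [whiskerLeft_comp] at h'
    calc _ = (ρ_ K).inv ≫ K ◁ (ρ_ _).inv ≫ K ◁ η ▷ 𝟙_ C ≫ K ◁ Y ◁ θ := by simp
      _ = (ρ_ K).inv ≫ K ◁ (λ_ _).inv ≫ K ◁ 𝟙_ C ◁ θ ≫ K ◁ η ▷ Z := by
        rw [← h', unitors_inv_equal]
      _ = _ := by simp
  have e' := congrArg (· ≫ (α_ _ _ _).inv ≫ f.hom) e
  simp only [Category.assoc] at e'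
  rw [e']
  simp

/-- A sum over pairs is an iterated sum. -/
theorem Sg_tensor (η : 𝟙_ C ⟶ Y) (θ : 𝟙_ C ⟶ Z) (f : Eff (K ⊗ (Y ⊗ Z))) :
    Sg ((λ_ _).inv ≫ (η ⊗ₘ θ)) f =
      Sg η (Sg θ (pull (pair (fst _ _ ≫ fst _ _) (pair (fst _ _ ≫ snd _ _) (snd _ _))) f)) := by
  ext
  simp only [Sg_hom, pull_hom, assoc_eq]
  simp [MonoidalCategory.tensorHom_def]

end

section

variable {K L X Y Z U V : C} [ComonObj K] [IsCommComonObj K] [ComonObj Y] [ComonObj U] [ComonObj V]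
  [IsCommComonObj Y]

/-- A wire that is not copied may be precomposed with any map. -/
theorem whiskerRight_pair_snd (u : V ⟶ U) (a : U ⊗ K ⟶ X) (b : K ⟶ Z) :
    (u ▷ K) ≫ pair a (snd U K ≫ b) = pair ((u ▷ K) ≫ a) (snd V K ≫ b) := by
  rw [pair_snd_comp, pair_snd_comp, ← whisker_exchange_assoc]
  simp [MonoidalCategory.tensorHom_def]

/-- Effects act on maps out of a context. -/
def act (e : Eff K) (f : K ⟶ Z) : K ⟶ Z := pair e.hom f ≫ (λ_ Z).hom

theorem act_comp (e : Eff K) (f : K ⟶ Z) (g : Z ⟶ X) : act e f ≫ g = act e (f ≫ g) := by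
  simp [act, ← pair_whiskerLeft]

theorem act_hom (e f : Eff K) : act e f.hom = (e * f).hom := rfl

theorem act_one (f : K ⟶ Z) : act 1 f = f := counit_pair f

theorem pair_act_left (e : Eff K) (f : K ⟶ X) (g : K ⟶ Z) :
    pair (act e f) g = act e (pair f g) := by
  rw [act, act, ← pair_whiskerRight, ← pair_assoc]
  simp

theorem act_act (e e' : Eff K) (f : K ⟶ Z) : act e (act e' f) = act (e * e') f := by
  rw [act, act, act, mul_hom, ← pair_whiskerRight, ← pair_whiskerLeft, ← pair_assoc]
  simp

theorem pair_act_right (e : Eff K) (f : K ⟶ X) (g : K ⟶ Z) :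
    pair f (act e g) = act e (pair f g) := by
  rw [← pair_braiding, pair_act_left, act_comp, pair_braiding]

theorem act_tensor (e e' : Eff K) (f : K ⟶ X) (g : K ⟶ Z) :
    act (e * e') (pair f g) = pair (act e f) (act e' g) := by
  rw [← act_act, pair_act_left, pair_act_right]

/-- Terms that the effect `e` makes equal may be exchanged beside `e`. -/
theorem mul_eq_of_act_eq (e : Eff K) (x y : K ⟶ Y) [IsComonHom x] [IsComonHom y]
    (h : act e x = act e y) (f : Eff (K ⊗ Y)) :
    e * pull (pair (𝟙 K) x) f = e * pull (pair (𝟙 K) y) f := by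
  ext
  rw [← act_hom, ← act_hom, pull_hom, pull_hom, ← act_comp, ← act_comp, ← pair_act_right,
    ← pair_act_right, h]

/-- Summation over a fresh variable of an effect that acts on a map independent of it. -/
theorem sum_act_fst (η : 𝟙_ C ⟶ Y) (e : Eff (K ⊗ Y)) (g : K ⟶ Z) :
    (ρ_ K).inv ≫ K ◁ η ≫ act e (fst K Y ≫ g) = act (Sg η e) g := by
  simp only [act, pair_fst_comp, Sg_hom]
  simp only [pair, Category.assoc]
  rw [whisker_exchange_assoc]
  have h : (K ⊗ K) ◁ η ≫ (α_ K K Y).hom ≫ K ◁ (β_ K Y).hom ≫ (α_ K Y K).inv =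
      (α_ _ _ _).hom ≫ K ◁ (ρ_ K).hom ≫ K ◁ (λ_ K).inv ≫ (α_ _ _ _).inv ≫ (K ◁ η) ▷ K := by
    simp only [tensor_whiskerLeft, Category.assoc, Iso.inv_hom_id_assoc]
    rw [← whiskerLeft_comp_assoc K (K ◁ η), BraidedCategory.braiding_naturality_right,
      braiding_tensorUnit_right]
    simp
  have h' := congrArg (fun t => (ρ_ K).inv ≫ Δ[K] ▷ _ ≫ t ≫ (e.hom ⊗ₘ g) ≫
    (λ_ _).hom) h
  simp only [Category.assoc] at h' ⊢
  rw [h']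
  simp [MonoidalCategory.tensorHom_def]

variable [IsCommComonObj U] [IsCommComonObj V]

instance associator_isComonHom : IsComonHom (α_ U K Y).hom := by
  rw [← assoc_eq]; infer_instance

/-- A wire that is not copied may be precomposed with any map, under a further variable. -/
theorem whiskerRight_pair_lin (u : V ⟶ U) (a : (U ⊗ K) ⊗ Y ⟶ X) (b : K ⊗ Y ⟶ Z) :
    ((u ▷ K) ▷ Y) ≫ pair a ((snd U K ▷ Y) ≫ b) =
      pair (((u ▷ K) ▷ Y) ≫ a) ((snd V K ▷ Y) ≫ b) := by
  have e : ∀ (U : C) [ComonObj U], snd U K ▷ Y = (α_ U K Y).hom ≫ snd U (K ⊗ Y) := by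
    intro U _; simp [snd]
  have hU : ∀ (U : C) [ComonObj U] [IsCommComonObj U] (a : (U ⊗ K) ⊗ Y ⟶ X),
      pair a ((snd U K ▷ Y) ≫ b) =
        (α_ U K Y).hom ≫ pair ((α_ U K Y).inv ≫ a) (snd U (K ⊗ Y) ≫ b) := by
    intro U _ _ a
    rw [comp_pair, e]; simp
  have hu : (u ▷ K) ▷ Y ≫ (α_ U K Y).hom = (α_ V K Y).hom ≫ u ▷ (K ⊗ Y) := by simp
  rw [hU, hU, reassoc_of% hu, whiskerRight_pair_snd]
  congr 2
  simp

end

/-! ### Terms, equality effects and relations -/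

/-- A term of type `Y` in the context `K`: a map that can be copied and discarded. -/
@[ext]
structure Tm (K Y : C) [ComonObj K] [ComonObj Y] where
  hom : K ⟶ Y
  det : IsComonHom hom

attribute [instance] Tm.det

/-- A commutative comonoid with an equality test `cup` and a sum `unit` over all its values, such
that equal terms can replace each other and exactly one value equals a given one. This is a special
commutative Frobenius algebra, presented through the laws that sums and substitutions use. -/
class Frob (Y : C) [ComonObj Y] [IsCommComonObj Y] where
  cup : Y ⊗ Y ⟶ 𝟙_ C
  unit : 𝟙_ C ⟶ Y
  braiding_cup : (β_ Y Y).hom ≫ cup = cup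
  comul_cup : Δ[Y] ≫ cup = ε[Y]
  unit_cup : (ρ_ Y).inv ≫ Y ◁ unit ≫ cup = ε[Y]
  act_cup : act ⟨cup⟩ (fst Y Y) = act ⟨cup⟩ (snd Y Y)

section

variable {K L M X Y Z : C} [ComonObj K] [IsCommComonObj K] [ComonObj L] [IsCommComonObj L]
  [ComonObj M] [IsCommComonObj M] [ComonObj X] [IsCommComonObj X] [ComonObj Y] [IsCommComonObj Y]
  [ComonObj Z] [IsCommComonObj Z]

/-- Substitution in a term. -/
def Tm.sub (x : Tm K Y) (s : L ⟶ K) [IsComonHom s] : Tm L Y := ⟨s ≫ x.hom, inferInstance⟩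

/-- Weakening of a term by a fresh variable of type `Z`. -/
def Tm.wk' (Z : C) [ComonObj Z] [IsCommComonObj Z] (x : Tm K Y) : Tm (K ⊗ Z) Y :=
  x.sub (fst K Z)

/-- The fresh variable of an extended context. -/
def fresh (K Y : C) [ComonObj K] [IsCommComonObj K] [ComonObj Y] [IsCommComonObj Y] :
    Tm (K ⊗ Y) Y := ⟨snd K Y, inferInstance⟩

/-- Substitution of a term for the fresh variable. -/
def inst (x : Tm K Y) : K ⟶ K ⊗ Y := pair (𝟙 K) x.hom

instance (x : Tm K Y) : IsComonHom (inst x) := by unfold inst; infer_instance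

theorem Tm.sub_sub (x : Tm K Y) (s : L ⟶ K) [IsComonHom s] (t : M ⟶ L) [IsComonHom t] :
    (x.sub s).sub t = x.sub (t ≫ s) := by ext; simp [Tm.sub]

theorem Tm.sub_id (x : Tm K Y) : x.sub (𝟙 K) = x := by ext; simp [Tm.sub]

theorem pull_congr {s t : L ⟶ K} [IsComonHom s] [IsComonHom t] (h : s = t) (f : Eff K) :
    pull s f = pull t f := by subst h; rfl

theorem pull_id (f : Eff K) : pull (𝟙 K) f = f := by ext; simp [pull_hom]

@[simp] theorem wk'_inst (x : Tm K Y) (y : Tm K Z) : (x.wk' Z).sub (inst y) = x := by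
  ext; simp [Tm.wk', Tm.sub, inst, ← Category.assoc, pair_fst]

@[simp] theorem fresh_inst (x : Tm K Y) : (fresh K Y).sub (inst x) = x := by
  ext; simp [Tm.sub, fresh, inst, pair_snd]

theorem whiskerRight_fst {K L : C} (s : L ⟶ K) : s ▷ Y ≫ fst K Y = fst L Y ≫ s := by
  simp [fst, ← whisker_exchange_assoc]

theorem whiskerRight_snd (s : L ⟶ K) [IsComonHom s] : s ▷ Y ≫ snd K Y = snd L Y := by
  simp [snd, ← comp_whiskerRight_assoc]

@[simp] theorem wk'_whiskerRight (x : Tm K Z) (s : L ⟶ K) [IsComonHom s] :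
    (x.wk' Y).sub (s ▷ Y) = (x.sub s).wk' Y := by
  ext; simp [Tm.wk', Tm.sub, ← Category.assoc, whiskerRight_fst]

@[simp] theorem fresh_whiskerRight (s : L ⟶ K) [IsComonHom s] :
    (fresh K Y).sub (s ▷ Y) = fresh L Y := by
  ext; simp [Tm.sub, fresh, whiskerRight_snd]

variable [Frob Y] [Frob Z]

/-- Equality of two terms, as an effect. -/
def eqv (x y : Tm K Y) : Eff K := ⟨pair x.hom y.hom ≫ Frob.cup⟩

theorem pull_eqv (s : L ⟶ K) [IsComonHom s] (x y : Tm K Y) :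
    pull s (eqv x y) = eqv (x.sub s) (y.sub s) := by
  ext; simp [pull_hom, eqv, Tm.sub, ← comp_pair]

theorem eqv_comm (x y : Tm K Y) : eqv x y = eqv y x := by
  ext
  simp only [eqv]
  rw [← pair_braiding, Category.assoc, Frob.braiding_cup]

theorem eqv_self (x : Tm K Y) : eqv x x = 1 := by
  ext
  simp only [eqv]
  have : pair x.hom x.hom = x.hom ≫ Δ[Y] := by simp [pair]
  rw [this, Category.assoc, Frob.comul_cup, IsComonHom.hom_counit]; rfl

theorem comp_act (s : L ⟶ K) [IsComonHom s] (e : Eff K) (f : K ⟶ X) :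
    s ≫ act e f = act (pull s e) (s ≫ f) := by
  simp only [act, pull_hom]; rw [← Category.assoc, comp_pair]

theorem act_eqv (x y : Tm K Y) : act (eqv x y) x.hom = act (eqv x y) y.hom := by
  have h := congrArg (pair x.hom y.hom ≫ ·) (Frob.act_cup (Y := Y))
  simp only [comp_act, pair_fst, pair_snd] at h
  exact h

/-- Equal terms can replace each other in every effect. -/
theorem eqv_mul (x y : Tm K Y) (f : Eff (K ⊗ Y)) :
    eqv x y * pull (inst x) f = eqv x y * pull (inst y) f :=
  mul_eq_of_act_eq _ _ _ (act_eqv x y) f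

/-- The sum of an effect over a fresh variable. -/
def sm (f : Eff (K ⊗ Y)) : Eff K := Sg Frob.unit f

theorem sm_eqv (x : Tm K Y) : sm (eqv (x.wk' Y) (fresh K Y)) = 1 := by
  ext
  have e : pair (fst K Y ≫ x.hom) (snd K Y) = x.hom ▷ Y := by
    rw [← pair_whiskerRight, pair_fst_snd, Category.id_comp]
  simp only [sm, Sg_hom, eqv, Tm.wk', Tm.sub, fresh, one_hom]
  rw [e, whisker_exchange_assoc, ← rightUnitor_inv_naturality_assoc, Frob.unit_cup,
    IsComonHom.hom_counit]

/-- A sum with an equality constraint on its variable is a substitution. -/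
theorem sm_eqv_mul (x : Tm K Y) (f : Eff (K ⊗ Y)) :
    sm (eqv (x.wk' Y) (fresh K Y) * f) = pull (inst x) f := by
  have h := eqv_mul (x.wk' Y) (fresh K Y) (pull (fst K Y ▷ Y) f)
  rw [pull_pull, pull_pull] at h
  have e₁ : inst (fresh K Y) ≫ fst K Y ▷ Y = 𝟙 _ := by
    simp only [inst, pair_whiskerRight, fresh, Category.id_comp, pair_fst_snd]
  have e₂ : inst (x.wk' Y) ≫ fst K Y ▷ Y = fst K Y ≫ inst x := by
    simp only [inst, pair_whiskerRight, comp_pair, Category.id_comp, Category.comp_id]; rfl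
  rw [pull_congr e₁, pull_congr e₂, ← pull_pull, pull_id] at h
  rw [← h, sm, Sg_mul]
  change sm _ * _ = _
  rw [sm_eqv, one_mul]

theorem pull_sm (s : L ⟶ K) [IsComonHom s] (f : Eff (K ⊗ Y)) :
    pull s (sm f) = sm (pull (s ▷ Y) f) := pull_Sg _ _ _

/-- The snake equation of the self-duality given by `cup` and `unit`. -/
theorem snake : (ρ_ Y).inv ≫ Y ◁ Frob.unit ≫ act ⟨Frob.cup⟩ (snd Y Y) = 𝟙 Y := by
  have h := sum_act_fst (K := Y) (Y := Y) Frob.unit ⟨Frob.cup⟩ (𝟙 Y)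
  have h' : Sg (K := Y) (Y := Y) Frob.unit ⟨Frob.cup⟩ = 1 := by
    ext; exact Frob.unit_cup
  rw [Category.comp_id, Frob.act_cup, h', act_one] at h
  exact h

/-- A map is determined by its graph. -/
theorem eq_of_whiskerRight_cup {V : C} {f g : V ⟶ Y}
    (h : f ▷ Y ≫ Frob.cup = g ▷ Y ≫ Frob.cup) [ComonObj V] : f = g := by
  have key : ∀ f : V ⟶ Y, f = (ρ_ V).inv ≫ V ◁ Frob.unit ≫
      pair (f ▷ Y ≫ Frob.cup) (snd V Y) ≫ (λ_ Y).hom := by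
    intro f
    have h := whiskerRight_pair_snd (K := Y) f (Frob.cup (Y := Y)) (𝟙 Y)
    rw [Category.comp_id, Category.comp_id] at h
    calc f = f ≫ (ρ_ Y).inv ≫ Y ◁ Frob.unit ≫ act ⟨Frob.cup⟩ (snd Y Y) := by
          rw [snake, Category.comp_id]
      _ = _ := by
          rw [rightUnitor_inv_naturality_assoc, ← whisker_exchange_assoc, act, reassoc_of% h]
  rw [key f, h, ← key g]

/-- The graph of a map, which need not be a term, as an effect. -/
def graph (f : X ⟶ Y) (x : Tm K X) (y : Tm K Y) : Eff K :=
  ⟨pair (x.hom ≫ f) y.hom ≫ Frob.cup⟩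

/-- Maps with the same graph on generic variables are equal. -/
theorem eq_of_graph {f g : X ⟶ Y}
    (h : graph f (⟨fst X Y, inferInstance⟩ : Tm (X ⊗ Y) X) ⟨snd X Y, inferInstance⟩ =
      graph g ⟨fst X Y, inferInstance⟩ ⟨snd X Y, inferInstance⟩) : f = g := by
  have e : ∀ f : X ⟶ Y, pair (fst X Y ≫ f) (snd X Y) = f ▷ Y := by
    intro f; rw [← pair_whiskerRight, pair_fst_snd, Category.id_comp]
  have h' := congrArg Eff.hom h
  simp only [graph, e] at h'
  exact eq_of_whiskerRight_cup h'

theorem pull_graph (s : L ⟶ K) [IsComonHom s] (f : X ⟶ Y) (x : Tm K X) (y : Tm K Y) :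
    pull s (graph f x y) = graph f (x.sub s) (y.sub s) := by
  ext; simp only [pull_hom, graph, Tm.sub, ← Category.assoc, comp_pair]

theorem graph_of_term {f : X ⟶ Y} {x : Tm K X} {x' : Tm K Y} (h : x.hom ≫ f = x'.hom)
    (y : Tm K Y) : graph f x y = eqv x' y := by
  rw [graph, h]; rfl

theorem graph_comp_of_term {f : X ⟶ Y} {g : Y ⟶ Z} {x : Tm K X} {x' : Tm K Y}
    (h : x.hom ≫ f = x'.hom) (z : Tm K Z) : graph (f ≫ g) x z = graph g x' z := by
  rw [graph, graph, ← h, Category.assoc]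

/-- Composition of graphs. -/
theorem graph_comp (f : X ⟶ Y) (g : Y ⟶ Z) (x : Tm K X) (z : Tm K Z) :
    graph (f ≫ g) x z = sm (graph f (x.wk' Y) (fresh K Y) * graph g (fresh K Y) (z.wk' Y)) := by
  -- `v` is not a term, so it cannot be substituted for a variable. The sum over a variable equal to
  -- the term `fst Y K` is computed in the context `Y ⊗ K`, and `v` is composed with it afterwards.
  set v := x.hom ≫ f with hv
  have key := sm_eqv_mul (⟨fst Y K, inferInstance⟩ : Tm (Y ⊗ K) Y)
    (graph g (fresh (Y ⊗ K) Y) ((z.sub (snd Y K)).wk' Y))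
  rw [pull_graph, fresh_inst, wk'_inst] at key
  have key' := congrArg (fun e : Eff (Y ⊗ K) => Δ[K] ≫ v ▷ K ≫ e.hom) key
  have h₁ : Δ[K] ≫ v ▷ K ≫ (graph g (⟨fst Y K, inferInstance⟩ : Tm (Y ⊗ K) Y)
      (z.sub (snd Y K))).hom = (graph (f ≫ g) x z).hom := by
    simp only [graph, Tm.sub]
    rw [← Category.assoc (v ▷ K), whiskerRight_pair_snd, ← Category.assoc (v ▷ K),
      whiskerRight_fst, ← Category.assoc Δ[K], comp_pair, comul_eq_pair]
    simp only [← Category.assoc, pair_fst, pair_snd]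
    simp [hv]
  have h₂ : Δ[K] ≫ v ▷ K ≫ (sm (eqv ((⟨fst Y K, inferInstance⟩ : Tm (Y ⊗ K) Y).wk' Y)
      (fresh (Y ⊗ K) Y) * graph g (fresh (Y ⊗ K) Y) ((z.sub (snd Y K)).wk' Y))).hom =
      (sm (graph f (x.wk' Y) (fresh K Y) * graph g (fresh K Y) (z.wk' Y))).hom := by
    have a₁ : (eqv ((⟨fst Y K, inferInstance⟩ : Tm (Y ⊗ K) Y).wk' Y) (fresh (Y ⊗ K) Y)).hom =
        fst Y K ▷ Y ≫ Frob.cup := by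
      simp only [eqv, Tm.wk', Tm.sub, fresh, ← pair_whiskerRight, pair_fst_snd, Category.id_comp]
    have a₂ : (graph f (x.wk' Y) (fresh K Y)).hom = v ▷ Y ≫ Frob.cup := by
      simp only [graph, Tm.wk', Tm.sub, fresh, Category.assoc, ← hv]
      rw [← pair_whiskerRight, pair_fst_snd, Category.id_comp]
    have a₃ : (graph g (fresh (Y ⊗ K) Y) ((z.sub (snd Y K)).wk' Y)).hom =
        snd Y K ▷ Y ≫ (graph g (fresh K Y) (z.wk' Y)).hom := by
      rw [← pull_hom, pull_graph, fresh_whiskerRight, wk'_whiskerRight]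
    simp only [sm, Sg_hom, mul_hom, a₁, a₂, a₃]
    rw [rightUnitor_inv_naturality_assoc, ← whisker_exchange_assoc,
      ← Category.assoc ((v ▷ K) ▷ Y), whiskerRight_pair_lin, rightUnitor_inv_naturality_assoc,
      ← whisker_exchange_assoc, ← Category.assoc (Δ[K] ▷ Y), comp_pair,
      ← comp_whiskerRight_assoc, ← comp_whiskerRight_assoc, Category.assoc, whiskerRight_fst,
      ← comp_whiskerRight_assoc, comul_eq_pair, ← Category.assoc (pair _ _), pair_fst, pair_snd]
    simp
  rw [h₁, h₂] at key'
  ext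
  exact key'.symm

/-! ### Products of types -/

attribute [local instance] ComonObj.instTensorUnit

instance unitFrob : Frob (𝟙_ C) where
  cup := (λ_ _).hom
  unit := 𝟙 _
  braiding_cup := by rw [braiding_unit, Category.id_comp]
  comul_cup := by simp
  unit_cup := by simp [unitors_equal]
  act_cup := by
    congr 1
    simp [fst, snd, unitors_equal]

instance counit_isComonHom : IsComonHom ε[K] where
  hom_counit := Category.comp_id _
  hom_comul := pair_counit_counit.symm

/-- The sum over the unit type has one term. -/
theorem sm_unit (f : Eff (K ⊗ 𝟙_ C)) :
    sm f = pull (inst (⟨ε[K], inferInstance⟩ : Tm K (𝟙_ C))) f := by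
  ext
  simp [sm, Sg_hom, Frob.unit, pull_hom, inst, pair_id_counit]

theorem sm_comm (f : Eff ((K ⊗ Y) ⊗ Z)) : sm (sm f) =
    sm (sm (pull (pair (pair (fst _ _ ≫ fst _ _) (snd _ _)) (fst _ _ ≫ snd _ _)) f)) :=
  Sg_comm _ _ _

/-- The componentwise equality test on pairs. -/
def pairCup (Y Z : C) [ComonObj Y] [IsCommComonObj Y] [ComonObj Z] [IsCommComonObj Z] [Frob Y]
    [Frob Z] : (Y ⊗ Z) ⊗ (Y ⊗ Z) ⟶ 𝟙_ C :=
  tensorμ Y Z Y Z ≫ (Frob.cup ⊗ₘ Frob.cup) ≫ (λ_ _).hom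

theorem pair_pairCup (a a' : K ⟶ Y) (b b' : K ⟶ Z) : pair (pair a b) (pair a' b') ≫ pairCup Y Z =
    ((⟨pair a a' ≫ Frob.cup⟩ : Eff K) * ⟨pair b b' ≫ Frob.cup⟩).hom := by
  rw [pairCup, ← Category.assoc, pair_pair_tensorμ, ← Category.assoc, pair_tensor]; rfl

/-- The first component of a term. -/
def Tm.l (x : Tm K (Y ⊗ Z)) : Tm K Y := ⟨x.hom ≫ fst Y Z, inferInstance⟩

/-- The second component of a term. -/
def Tm.r (x : Tm K (Y ⊗ Z)) : Tm K Z := ⟨x.hom ≫ snd Y Z, inferInstance⟩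

/-- The pair of two terms. -/
def Tm.mk2 (x : Tm K Y) (y : Tm K Z) : Tm K (Y ⊗ Z) := ⟨pair x.hom y.hom, inferInstance⟩

theorem Tm.hom_eq_pair (x : Tm K (Y ⊗ Z)) : x.hom = pair x.l.hom x.r.hom := by
  simp only [Tm.l, Tm.r]
  rw [← comp_pair, pair_fst_snd, Category.comp_id]

theorem pair_hom_pairCup (x y : Tm K (Y ⊗ Z)) :
    pair x.hom y.hom ≫ pairCup Y Z = (eqv x.l y.l * eqv x.r y.r).hom := by
  rw [Tm.hom_eq_pair x, Tm.hom_eq_pair y, pair_pairCup]; rfl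

theorem sum_mk2 (f : Eff (K ⊗ (Y ⊗ Z))) : Sg ((λ_ _).inv ≫ (Frob.unit ⊗ₘ Frob.unit)) f =
    sm (sm (pull (pair (fst _ _ ≫ fst _ _) (pair (fst _ _ ≫ snd _ _) (snd _ _))) f)) :=
  Sg_tensor _ _ _

theorem pair_id_id_cup (W : C) [ComonObj W] [IsCommComonObj W] (c : W ⊗ W ⟶ 𝟙_ C) :
    c = pair (⟨fst W W, inferInstance⟩ : Tm (W ⊗ W) W).hom
      (⟨snd W W, inferInstance⟩ : Tm (W ⊗ W) W).hom ≫ c := by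
  simp [pair_fst_snd]

instance tensorFrob : Frob (Y ⊗ Z) where
  cup := pairCup Y Z
  unit := (λ_ _).inv ≫ (Frob.unit ⊗ₘ Frob.unit)
  braiding_cup := by
    have e : (β_ (Y ⊗ Z) (Y ⊗ Z)).hom = pair (snd _ _) (fst _ _) := by
      rw [← pair_braiding, pair_fst_snd, Category.id_comp]
    rw [e, pair_id_id_cup _ (pairCup Y Z), ← Category.assoc, comp_pair]
    simp only [pair_fst, pair_snd]
    have h₁ := pair_hom_pairCup (⟨fst (Y ⊗ Z) (Y ⊗ Z), inferInstance⟩ : Tm _ (Y ⊗ Z))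
      ⟨snd (Y ⊗ Z) (Y ⊗ Z), inferInstance⟩
    have h₂ := pair_hom_pairCup (⟨snd (Y ⊗ Z) (Y ⊗ Z), inferInstance⟩ : Tm _ (Y ⊗ Z))
      ⟨fst (Y ⊗ Z) (Y ⊗ Z), inferInstance⟩
    rw [eqv_comm, eqv_comm (Tm.r _)] at h₂
    exact h₂.trans h₁.symm
  comul_cup := by
    rw [comul_eq_pair]
    have h := pair_hom_pairCup (⟨𝟙 (Y ⊗ Z), inferInstance⟩ : Tm _ (Y ⊗ Z)) ⟨𝟙 _, inferInstance⟩
    rw [eqv_self, eqv_self, one_mul] at h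
    exact h
  unit_cup := by
    have h := sum_mk2 (K := Y ⊗ Z) (Y := Y) (Z := Z) ⟨pairCup Y Z⟩
    have e : pull (pair (fst _ _ ≫ fst _ _) (pair (fst _ _ ≫ snd _ _) (snd _ _)))
        (⟨pairCup Y Z⟩ : Eff ((Y ⊗ Z) ⊗ (Y ⊗ Z))) =
        eqv (((⟨snd Y Z, inferInstance⟩ : Tm (Y ⊗ Z) Z).wk' Y).wk' Z) (fresh _ _) *
        pull (fst _ Z) (eqv ((⟨fst Y Z, inferInstance⟩ : Tm (Y ⊗ Z) Y).wk' Y) (fresh _ _)) := by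
      ext
      have h₁ := pair_pairCup (K := ((Y ⊗ Z) ⊗ Y) ⊗ Z) (fst _ _ ≫ fst _ _ ≫ fst _ _)
        (fst _ _ ≫ snd _ _) (fst _ _ ≫ fst _ _ ≫ snd _ _) (snd _ _)
      rw [mul_comm, pull_eqv, pull_hom]
      refine Eq.trans ?_ h₁
      rw [← comp_pair, ← comp_pair, pair_fst_snd, Category.comp_id]
    have h' : sm (pull (pair (fst _ _ ≫ fst _ _) (pair (fst _ _ ≫ snd _ _) (snd _ _)))
        (⟨pairCup Y Z⟩ : Eff ((Y ⊗ Z) ⊗ (Y ⊗ Z)))) =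
        eqv ((⟨fst Y Z, inferInstance⟩ : Tm (Y ⊗ Z) Y).wk' Y) (fresh _ _) := by
      rw [e, sm, Sg_mul]
      change sm _ * _ = _
      rw [sm_eqv, one_mul]
    rw [h', sm_eqv] at h
    exact congrArg Eff.hom h
  act_cup := by
    have h := pair_hom_pairCup (⟨fst (Y ⊗ Z) (Y ⊗ Z), inferInstance⟩ : Tm _ (Y ⊗ Z))
      ⟨snd (Y ⊗ Z) (Y ⊗ Z), inferInstance⟩
    rw [← pair_id_id_cup] at h
    rw [show (⟨pairCup Y Z⟩ : Eff _) = eqv _ _ * eqv _ _ from Eff.ext h]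
    have h₁ := Tm.hom_eq_pair (⟨fst (Y ⊗ Z) (Y ⊗ Z), inferInstance⟩ : Tm _ (Y ⊗ Z))
    have h₂ := Tm.hom_eq_pair (⟨snd (Y ⊗ Z) (Y ⊗ Z), inferInstance⟩ : Tm _ (Y ⊗ Z))
    refine (congrArg _ h₁).trans (Eq.trans ?_ (congrArg _ h₂.symm))
    rw [act_tensor, act_tensor, act_eqv, act_eqv (Tm.r _)]

end

end Ctx

namespace ZX

open Diag Ctx ComonObj

set_option linter.unusedSectionVars false

/-! ### The wire as a commutative comonoid -/

theorem copy_comm : Derives Rule (Z 1 2 1 ⨟ swap 1 1) (Z 1 2 1) :=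
  (Derives.comp_congr (.refl _) ((Derives.tens_id_zero _).trans (.id_tens _)).symm).trans
    (.rule (.S1_outputs 1 0 0 1))

theorem cup_comm : Derives Rule (swap 1 1 ⨟ Z 2 0 1) (Z 2 0 1) :=
  (Derives.comp_congr ((Derives.tens_id_zero _).trans (.id_tens _)).symm (.refl _)).trans
    (.rule (.S1_inputs 0 0 0 1))

theorem merge_comm : Derives Rule (swap 1 1 ⨟ Z 2 1 1) (Z 2 1 1) :=
  (Derives.comp_congr ((Derives.tens_id_zero _).trans (.id_tens _)).symm (.refl _)).trans
    (.rule (.S1_inputs 0 0 1 1))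

/-- Fusion of two spiders, the upper one having no further inputs beside it. -/
theorem fuse_below (n m k l : ℕ) (a b : ℂ) :
    Derives Rule (Z n (m + (k + 1)) a ⨟ (wires m ⊠ Z (k + 1) l b)) (Z n (m + l) (a * b)) := by
  refine Derives.trans (Derives.comp_congr (Derives.symm ?_) (.refl _))
    (.rule (.S1 n m k 0 l a b))
  exact (derives_cast _ _ _).trans (.tens_id_zero _)

theorem copy_counit : Derives Rule (Z 1 2 1 ⨟ (wires 1 ⊠ Z 1 0 1)) (wires 1) := by
  have h := fuse_below 1 1 0 0 1 1
  rw [one_mul] at h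
  exact h.trans (.rule .S2_green)

theorem copy_copy_right : Derives Rule (Z 1 2 1 ⨟ (wires 1 ⊠ Z 1 2 1)) (Z 1 3 1) := by
  have h := fuse_below 1 1 0 2 1 1
  rwa [one_mul] at h

theorem copy_cup : Derives Rule (Z 1 2 1 ⨟ Z 2 0 1) (Z 1 0 1) := by
  have h := fuse_below 1 0 1 0 1 1
  rw [one_mul] at h
  exact (Derives.comp_congr (.refl _) (Derives.id_tens _).symm).trans h

theorem copy_merge_cup : Derives Rule ((Z 1 2 1 ⊠ wires 1) ⨟ (wires 1 ⊠ Z 2 0 1)) (Z 2 1 1) := by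
  have h := Derives.rule (Rule.S1 1 1 0 1 0 1 1)
  rw [one_mul] at h
  exact h

theorem unit_cup : Derives Rule ((Z 0 1 1 ⊠ wires 1) ⨟ Z 2 0 1) (Z 1 0 1) := by
  have h := Derives.rule (Rule.S1 0 0 0 1 0 1 1)
  rw [one_mul] at h
  exact (Derives.comp_congr (.refl _) (Derives.id_tens _).symm).trans h

theorem copy_swap_right : Derives Rule (Z 1 3 1 ⨟ swap 1 2) (Z 1 3 1) := by
  have h₁ : Derives Rule (Z 1 3 1 ⨟ (swap 1 1 ⊠ wires 1)) (Z 1 3 1) :=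
    (Derives.comp_congr (.refl _) (.tens_congr (Derives.id_tens _).symm (.refl _))).trans
      (.rule (Rule.S1_outputs 1 0 1 1))
  have h₂ : Derives Rule (Z 1 3 1 ⨟ (wires 1 ⊠ swap 1 1)) (Z 1 3 1) :=
    (Derives.comp_congr (.refl _) (Derives.tens_id_zero _).symm).trans
      (.rule (.S1_outputs 1 1 0 1))
  have h₃ : Derives Rule (swap 1 2) ((swap 1 1 ⊠ wires 1) ⨟ (wires 1 ⊠ swap 1 1)) :=
    Derives.swap_add 1 1 1
  exact (Derives.comp_congr (.refl _) h₃).trans ((Derives.comp_assoc _ _ _).symm.trans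
    ((Derives.comp_congr h₁ (.refl _)).trans h₂))

theorem copy_copy_left : Derives Rule (Z 1 2 1 ⨟ (Z 1 2 1 ⊠ wires 1)) (Z 1 3 1) :=
  (Derives.comp_congr copy_comm.symm (.refl _)).trans ((Derives.comp_assoc _ _ _).trans
    ((Derives.comp_congr (.refl _) (Derives.swap_natural (wires 1) (Z 1 2 1)).symm).trans
      ((Derives.comp_assoc _ _ _).symm.trans ((Derives.comp_congr copy_copy_right (.refl _)).trans
        copy_swap_right))))

/-- A single wire. -/
def wire : Obj := ⟨1⟩

/-- The green spider that copies a wire. -/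
def copyHom : wire ⟶ wire ⊗ wire := cls (Z 1 2 1)

/-- The green spider that discards a wire. -/
def discardHom : wire ⟶ 𝟙_ Obj := cls (Z 1 0 1)

/-- The green spider that identifies two wires and keeps one. -/
def mergeHom : wire ⊗ wire ⟶ wire := cls (Z 2 1 1)

/-- The green spider that identifies two wires. -/
def cupHom : wire ⊗ wire ⟶ 𝟙_ Obj := cls (Z 2 0 1)

/-- The green spider that sums over a wire. -/
def unitHom : 𝟙_ Obj ⟶ wire := cls (Z 0 1 1)

theorem copy_braiding : copyHom ≫ (β_ wire wire).hom = copyHom := cls_eq.2 copy_comm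

theorem copy_discard : copyHom ≫ wire ◁ discardHom = (ρ_ wire).inv :=
  cls_eq.2 (copy_counit.trans (castWires_derives _).symm)

/-- The green spiders make the wire a comonoid. -/
instance : ComonObj wire where
  counit := discardHom
  comul := copyHom
  counit_comul := by
    rw [← copy_braiding, Category.assoc, ← BraidedCategory.braiding_naturality_right,
      reassoc_of% copy_discard, braiding_tensorUnit_right]
    simp
  comul_counit := copy_discard
  comul_assoc := cls_eq.2 (copy_copy_right.trans (copy_copy_left.symm.trans
    (Derives.comp_congr (.refl _) (comp_castWires _ _).symm)))

instance : IsCommComonObj wire where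
  comul_comm := copy_braiding

theorem braiding_cupHom : (β_ wire wire).hom ≫ cupHom = cupHom := cls_eq.2 cup_comm

theorem comul_cupHom : Δ[wire] ≫ cupHom = ε[wire] := cls_eq.2 copy_cup

theorem unitHom_cupHom : (ρ_ wire).inv ≫ wire ◁ unitHom ≫ cupHom = ε[wire] := by
  have h : unitHom ▷ wire ≫ cupHom = (λ_ wire).hom ≫ ε[wire] :=
    cls_eq.2 (unit_cup.trans (castWires_comp _ _).symm)
  rw [← braiding_cupHom, ← Category.assoc (wire ◁ unitHom),
    BraidedCategory.braiding_naturality_right, Category.assoc, h, braiding_tensorUnit_right]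
  simp

theorem braiding_mergeHom : (β_ wire wire).hom ≫ mergeHom = mergeHom := cls_eq.2 merge_comm

theorem act_cup_left {K : Obj} [ComonObj K] [IsCommComonObj K] (x y : K ⟶ wire) [IsComonHom x]
    [IsComonHom y] : act ⟨pair x y ≫ cupHom⟩ x = pair x y ≫ mergeHom := by
  have h : (Δ[wire] ▷ wire) ≫ (α_ _ _ _).hom ≫ (wire ◁ cupHom) ≫ (ρ_ wire).hom = mergeHom :=
    cls_eq.2 (((Derives.comp_congr (.refl _) ((castWires_comp _ _).trans
      (comp_castWires _ _)))).trans copy_merge_cup)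
  rw [← h, ← Category.assoc, pair_whiskerRight, ← Category.assoc]
  have : x ≫ Δ[wire] = pair x x := by simp [pair]
  rw [this, pair_assoc, ← Category.assoc, pair_whiskerLeft, act, ← pair_braiding]
  simp [braiding_tensorUnit_right]

theorem act_cup_right {K : Obj} [ComonObj K] [IsCommComonObj K] (x y : K ⟶ wire) [IsComonHom x]
    [IsComonHom y] : act ⟨pair x y ≫ cupHom⟩ y = pair x y ≫ mergeHom := by
  have h := act_cup_left y x
  rwa [← pair_braiding, Category.assoc, Category.assoc, braiding_cupHom, braiding_mergeHom] at h

instance : Frob wire where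
  cup := cupHom
  unit := unitHom
  braiding_cup := braiding_cupHom
  comul_cup := comul_cupHom
  unit_cup := unitHom_cupHom
  act_cup := by
    have h := (act_cup_left (fst wire wire) (snd wire wire)).trans
      (act_cup_right (fst wire wire) (snd wire wire)).symm
    rwa [pair_fst_snd, Category.id_comp] at h

attribute [local instance] ComonObj.instTensorUnit

/-! ### Tuples of terms and the graph of a diagram -/

/-- `n` parallel wires, as a type of values. It is `⟨n⟩`; the separate name carries the comonoid
structure built one wire at a time, for which `reg (n + 1)` is by definition `reg n ⊗ wire`. -/
def reg (n : ℕ) : Obj := ⟨n⟩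

instance regComonObj : (n : ℕ) → ComonObj (reg n)
  | 0 => inferInstanceAs (ComonObj (𝟙_ Obj))
  | n + 1 => letI := regComonObj n; inferInstanceAs (ComonObj (reg n ⊗ wire))

instance regIsCommComonObj : (n : ℕ) → IsCommComonObj (reg n)
  | 0 => inferInstanceAs (IsCommComonObj (𝟙_ Obj))
  | n + 1 => letI := regIsCommComonObj n; inferInstanceAs (IsCommComonObj (reg n ⊗ wire))

instance regFrob : (n : ℕ) → Frob (reg n)
  | 0 => inferInstanceAs (Frob (𝟙_ Obj))
  | n + 1 => letI := regFrob n; inferInstanceAs (Frob (reg n ⊗ wire))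

/-- Terms whose value is a single wire. -/
abbrev Var (K : Obj) [ComonObj K] : Type := Tm K wire

/-- Tuples of terms, growing at the right end as `reg` does. -/
def Tup (K : Obj) [ComonObj K] : ℕ → Type
  | 0 => PUnit
  | n + 1 => Tup K n × Var K

section

variable {K L M : Obj} [ComonObj K] [IsCommComonObj K] [ComonObj L] [IsCommComonObj L]
  [ComonObj M] [IsCommComonObj M]

namespace Tup

/-- Substitution in a tuple. -/
def sub : {n : ℕ} → Tup K n → (s : L ⟶ K) → [IsComonHom s] → Tup L n
  | 0, _, _, _ => ⟨⟩
  | _ + 1, x, s, _ => (sub x.1 s, x.2.sub s)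

/-- Concatenation of tuples. -/
def append {n : ℕ} (x : Tup K n) : {m : ℕ} → Tup K m → Tup K (n + m)
  | 0, _ => x
  | _ + 1, y => (append x y.1, y.2)

/-- The constant tuple. -/
def const : (n : ℕ) → Var K → Tup K n
  | 0, _ => ⟨⟩
  | n + 1, a => (const n a, a)

/-- The product of a family of effects over two tuples. -/
def prod2 (f : Var K → Var K → Eff K) : {n : ℕ} → Tup K n → Tup K n → Eff K
  | 0, _, _ => 1
  | _ + 1, x, y => prod2 f x.1 y.1 * f x.2 y.2

/-- The product of a family of effects over a tuple. -/
def prod (f : Var K → Eff K) : {n : ℕ} → Tup K n → Eff K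
  | 0, _ => 1
  | _ + 1, x => prod f x.1 * f x.2

/-- A tuple as a single term. -/
def tm : {n : ℕ} → Tup K n → Tm K (reg n)
  | 0, _ => (⟨ε[K], inferInstance⟩ : Tm K (𝟙_ Obj))
  | n + 1, x => (Tm.mk2 (tm x.1) x.2 : Tm K (reg n ⊗ wire))

/-- The components of a term. -/
def ofTm : {n : ℕ} → Tm K (reg n) → Tup K n
  | 0, _ => ⟨⟩
  | n + 1, t => (ofTm (Tm.l (Y := reg n) (Z := wire) t), Tm.r (Y := reg n) (Z := wire) t)

theorem tm_ofTm {n : ℕ} (t : Tm K (reg n)) : tm (ofTm t) = t := by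
  induction n with
  | zero =>
    ext
    have h : t.hom ≫ 𝟙 (𝟙_ Obj) = ε[K] := t.det.hom_counit
    exact h.symm.trans (Category.comp_id _)
  | succ n ih =>
    ext
    simp only [ofTm, tm, ih]
    exact (Tm.hom_eq_pair (Y := reg n) (Z := wire) t).symm

theorem tm_sub {n : ℕ} (x : Tup K n) (s : L ⟶ K) [IsComonHom s] : tm (x.sub s) = (tm x).sub s := by
  induction n with
  | zero => ext; exact (IsComonHom.hom_counit s).symm
  | succ n ih =>
    ext
    simp only [sub, tm, ih]
    exact (comp_pair s (tm x.1).hom x.2.hom).symm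

theorem sub_sub {n : ℕ} (x : Tup K n) (s : L ⟶ K) [IsComonHom s] (t : M ⟶ L) [IsComonHom t] :
    (x.sub s).sub t = x.sub (t ≫ s) := by
  induction n with
  | zero => rfl
  | succ n ih => simp only [sub, ih, Tm.sub_sub]; rfl

theorem append_sub {n m : ℕ} (x : Tup K n) (y : Tup K m) (s : L ⟶ K) [IsComonHom s] :
    (append x y).sub s = append (x.sub s) (y.sub s) := by
  induction m with
  | zero => rfl
  | succ n ih => simp only [sub, append, ih]; rfl

theorem const_sub (n : ℕ) (a : Var K) (s : L ⟶ K) [IsComonHom s] :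
    (const n a).sub s = const n (a.sub s) := by
  induction n with
  | zero => rfl
  | succ n ih => simp only [sub, const, ih]; rfl

theorem const_append (n m : ℕ) (a : Var K) :
    append (const n a) (const m a) = const (n + m) a := by
  induction m with
  | zero => rfl
  | succ m ih => simp only [append, const, ih]; rfl

theorem prod2_append (f : Var K → Var K → Eff K) {n m : ℕ} (x x' : Tup K n) (y y' : Tup K m) :
    prod2 f (append x y) (append x' y') = prod2 f x x' * prod2 f y y' := by
  induction m with
  | zero => simp [prod2, append]
  | succ m ih => simp only [prod2, append]; rw [← mul_assoc, ← ih]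

theorem tm_append {n m : ℕ} (x : Tup K n) (y : Tup K m) :
    (tm (append x y)).hom = pair (tm x).hom (tm y).hom := by
  induction m with
  | zero => exact (pair_counit (tm x).hom).symm.trans (Category.comp_id (pair (tm x).hom ε[K]))
  | succ m ih =>
    have h := pair_assoc (tm x).hom (tm y.1).hom y.2.hom
    refine Eq.trans ?_ h
    rw [← ih]
    exact (Category.comp_id (pair (tm (append x y.1)).hom y.2.hom)).symm

theorem eqv_tm {n : ℕ} (x y : Tup K n) : eqv (tm x) (tm y) = prod2 eqv x y := by
  induction n with
  | zero =>
    have h : (tm x : Tm K (reg 0)) = tm y := rfl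
    rw [h, eqv_self]; rfl
  | succ n ih =>
    simp only [prod2, ← ih]
    ext
    exact pair_pairCup (tm x.1).hom (tm y.1).hom x.2.hom y.2.hom

end Tup

/-- The equality test on `n + m` wires compares the first `n` and the last `m` wires. -/
theorem cup_reg_add (n m : ℕ) : (Frob.cup : reg (n + m) ⊗ reg (n + m) ⟶ 𝟙_ Obj) =
    pairCup (reg n) (reg m) := by
  let P := reg n ⊗ reg m
  let a : Tup (P ⊗ P) n := .ofTm (Tm.l (⟨fst P P, inferInstance⟩ : Tm (P ⊗ P) P))
  let b : Tup (P ⊗ P) m := .ofTm (Tm.r (⟨fst P P, inferInstance⟩ : Tm (P ⊗ P) P))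
  let a' : Tup (P ⊗ P) n := .ofTm (Tm.l (⟨snd P P, inferInstance⟩ : Tm (P ⊗ P) P))
  let b' : Tup (P ⊗ P) m := .ofTm (Tm.r (⟨snd P P, inferInstance⟩ : Tm (P ⊗ P) P))
  have h₁ := Tup.tm_append a b
  have h₂ := Tup.tm_append a' b'
  have e : pair (pair (a.tm).hom (b.tm).hom) (pair (a'.tm).hom (b'.tm).hom) = 𝟙 (P ⊗ P) := by
    simp only [a, b, a', b', Tup.tm_ofTm, ← Tm.hom_eq_pair]
    exact pair_fst_snd
  have h := congrArg Eff.hom ((Tup.eqv_tm _ _).trans (Tup.prod2_append eqv a a' b b'))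
  have h' := pair_pairCup a.tm.hom a'.tm.hom b.tm.hom b'.tm.hom
  rw [← Tup.eqv_tm, ← Tup.eqv_tm] at h
  simp only [eqv, h₁, h₂] at h h'
  rw [← h] at h'
  rw [e, Category.id_comp] at h'
  refine Eq.symm (h'.trans ?_)
  exact (congrArg (· ≫ Frob.cup (Y := reg (n + m))) e).trans (Category.id_comp _)

/-- The class of a diagram, as a map between types of values. -/
def dg {n m : ℕ} (D : ZXDiag n m) : reg n ⟶ reg m := cls D

/-- The graph of a diagram as an effect on its inputs and outputs. -/
def rel {n m : ℕ} (D : ZXDiag n m) (x : Tup K n) (y : Tup K m) : Eff K :=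
  graph (dg D) x.tm y.tm

theorem rel_congr {n m : ℕ} {D E : ZXDiag n m} (h : Provable D E) (x : Tup K n) (y : Tup K m) :
    rel D x y = rel E x y := by
  simp only [rel, dg, cls_eq.2 h]

/-- Diagrams with the same graph are provably equal. -/
theorem provable_of_rel {n m : ℕ} {D E : ZXDiag n m}
    (h : ∀ (K : Obj) [ComonObj K] [IsCommComonObj K] (x : Tup K n) (y : Tup K m),
      rel D x y = rel E x y) : Provable D E := by
  refine cls_eq.1 (eq_of_graph (f := dg D) (g := dg E) ?_)
  have h' := h (reg n ⊗ reg m) (Tup.ofTm ⟨fst _ _, inferInstance⟩)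
    (Tup.ofTm ⟨snd _ _, inferInstance⟩)
  simpa only [rel, Tup.tm_ofTm] using h'

theorem pull_rel {n m : ℕ} (D : ZXDiag n m) (x : Tup K n) (y : Tup K m) (s : L ⟶ K)
    [IsComonHom s] : pull s (rel D x y) = rel D (x.sub s) (y.sub s) := by
  simp only [rel, Tup.tm_sub]
  exact pull_graph s (dg D) x.tm y.tm

theorem rel_tens {n m n' m' : ℕ} (D : ZXDiag n m) (E : ZXDiag n' m') (x : Tup K n) (y : Tup K m)
    (x' : Tup K n') (y' : Tup K m') :
    rel (D ⊠ E) (x.append x') (y.append y') = rel D x y * rel E x' y' := by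
  ext
  have h := pair_pairCup (x.tm.hom ≫ dg D) y.tm.hom
    (x'.tm.hom ≫ dg E) y'.tm.hom
  rw [← pair_tensor _ _ (dg D) (dg E), ← Tup.tm_append, ← Tup.tm_append, ← cup_reg_add] at h
  exact h

/-- The diagram `D` maps the terms `x` to the terms `y`; its graph at `x` is then equality with
`y`. -/
def Det {n m : ℕ} (D : ZXDiag n m) (x : Tup K n) (y : Tup K m) : Prop :=
  x.tm.hom ≫ dg D = y.tm.hom

/-- The graph of a composite is a sum over the values of the wires in the middle. -/
theorem rel_comp {n m k : ℕ} (D : ZXDiag n m) (E : ZXDiag m k) (x : Tup K n) (z : Tup K k) :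
    rel (D ⨟ E) x z = sm (rel D (x.sub (fst K (reg m))) (.ofTm (fresh K (reg m))) *
      rel E (.ofTm (fresh K (reg m))) (z.sub (fst K (reg m)))) := by
  simp only [rel, Tup.tm_sub, Tup.tm_ofTm]
  exact graph_comp (dg D) (dg E) x.tm z.tm

end

section

variable {K L M Y : Obj} [ComonObj K] [IsCommComonObj K] [ComonObj L] [IsCommComonObj L]
  [ComonObj M] [IsCommComonObj M] [ComonObj Y] [IsCommComonObj Y]

/-! ### Evaluation of composite diagrams -/

namespace Tup

/-- Weakening of a tuple. -/
def wk' (Y : Obj) [ComonObj Y] [IsCommComonObj Y] {n : ℕ} (x : Tup K n) : Tup (K ⊗ Y) n :=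
  x.sub (fst K Y)

theorem sub_congr {n : ℕ} {s t : L ⟶ K} [IsComonHom s] [IsComonHom t] (h : s = t) (x : Tup K n) :
    x.sub s = x.sub t := by subst h; rfl

theorem sub_id {n : ℕ} (x : Tup K n) : x.sub (𝟙 K) = x := by
  induction n with
  | zero => rfl
  | succ n ih => simp only [sub, ih, Tm.sub_id]; rfl

@[simp] theorem wk'_inst {n : ℕ} (x : Tup K n) (y : Tm K Y) : (x.wk' Y).sub (inst y) = x := by
  rw [wk', sub_sub, sub_congr (t := 𝟙 K), sub_id]
  exact pair_fst (𝟙 K) y.hom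

@[simp] theorem wk'_whiskerRight {n : ℕ} (x : Tup K n) (s : L ⟶ K) [IsComonHom s] :
    (x.wk' Y).sub (s ▷ Y) = (x.sub s).wk' Y := by
  rw [wk', wk', sub_sub, sub_sub, sub_congr (whiskerRight_fst s)]

/-- The empty tuple. -/
def t0 : Tup K 0 := PUnit.unit

@[simp] theorem nil_sub (x : Tup K 0) (s : L ⟶ K) [IsComonHom s] : x.sub s = t0 := rfl

/-- A tuple with a further term at its end. -/
def snoc {n : ℕ} (x : Tup K n) (a : Var K) : Tup K (n + 1) := (x, a)

@[simp] theorem snoc_sub {n : ℕ} (x : Tup K n) (a : Var K) (s : L ⟶ K) [IsComonHom s] :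
    (x.snoc a).sub s = (x.sub s).snoc (a.sub s) := rfl

/-- The tuple of one term. -/
abbrev t1 (a : Var K) : Tup K 1 := t0.snoc a

/-- The tuple of two terms. -/
abbrev t2 (a b : Var K) : Tup K 2 := (t1 a).snoc b

/-- The tuple of three terms. -/
abbrev t3 (a b c : Var K) : Tup K 3 := (t2 a b).snoc c

theorem tm_t1 (a : Var K) : (tm (t1 a)).hom = a.hom :=
  (Category.comp_id (pair ε[K] a.hom)).symm.trans (counit_pair a.hom)

theorem tm_t2 (a b : Var K) : (tm (t2 a b)).hom = pair a.hom b.hom := by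
  change pair (tm (t1 a)).hom b.hom = _
  rw [tm_t1]; rfl

/-- The first part of a tuple. -/
def take {n : ℕ} : {m : ℕ} → Tup K (n + m) → Tup K n
  | 0, x => x
  | _ + 1, x => take x.1

/-- The second part of a tuple. -/
def drop {n : ℕ} : {m : ℕ} → Tup K (n + m) → Tup K m
  | 0, _ => PUnit.unit
  | _ + 1, x => (drop x.1, x.2)

theorem append_take_drop {n m : ℕ} (x : Tup K (n + m)) : append x.take (drop x) = x := by
  induction m with
  | zero => rfl
  | succ m ih => simp only [append, take, drop, ih]; rfl

end Tup

open Tup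

/-- Weakening of a term by a fresh wire. -/
postfix:max "↟" => Tm.wk' wire

/-- Weakening by a fresh wire. -/
abbrev Tup.wk {n : ℕ} (x : Tup K n) : Tup (K ⊗ wire) n := x.wk' wire

/-- The variable of the fresh wire. -/
notation "nw" => fresh _ wire

theorem sm_reg_zero (f : Eff (K ⊗ reg 0)) : sm f = pull (inst t0.tm) f := sm_unit (C := Obj) f

theorem sm_reg_succ (m : ℕ) (f : Eff (K ⊗ reg (m + 1))) : sm f =
    sm (sm (pull (pair (fst (K ⊗ reg m) wire ≫ fst K (reg m))
      (Tup.tm (n := m + 1) ((ofTm (fresh K (reg m))).wk.snoc nw)).hom) f)) := by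
  refine (sum_mk2 (Y := reg m) (Z := wire) f).trans ?_
  have h : (ofTm (fresh K (reg m))).wk.tm.hom = fst (K ⊗ reg m) wire ≫ snd K (reg m) := by
    rw [Tup.wk, Tup.wk', tm_sub, tm_ofTm]; rfl
  congr 2
  exact pull_congr (congrArg (fun t => pair (fst (K ⊗ reg m) wire ≫ fst K (reg m))
    (pair t (snd (K ⊗ reg m) wire))) h.symm) f

theorem ofTm_tm {n : ℕ} (x : Tup K n) : ofTm x.tm = x := by
  induction n with
  | zero => rfl
  | succ n ih =>
    have h₁ : Tm.l (Y := reg n) (Z := wire) x.tm = tm x.1 := by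
      ext; exact pair_fst (tm x.1).hom x.2.hom
    have h₂ : Tm.r (Y := reg n) (Z := wire) x.tm = x.2 := by
      ext; exact pair_snd (tm x.1).hom x.2.hom
    simp only [ofTm, h₁, h₂, ih]; rfl

theorem ofTm_sub {n : ℕ} (t : Tm K (reg n)) (s : L ⟶ K) [IsComonHom s] :
    ofTm (t.sub s) = (ofTm t).sub s := by
  rw [← tm_ofTm t, ← tm_sub, ofTm_tm, tm_ofTm]

theorem fold_wk {n : ℕ} (x : Tup K n) : x.sub (fst K Y) = x.wk' Y := rfl

/-- Substitution of a tuple for the fresh wires does not affect the other variables. -/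
theorem pair_peel {m n : ℕ} (x : Tup K n) (s : L ⟶ K) [IsComonHom s] (y : Tup L m) :
    (x.wk' (reg m)).sub (pair s y.tm.hom) = x.sub s := by
  rw [wk', Tup.sub_sub, sub_congr (pair_fst s y.tm.hom)]

theorem nw_peel {m : ℕ} (s : L ⟶ K) [IsComonHom s] (y : Tup L m) :
    (ofTm (fresh K (reg m))).sub (pair s y.tm.hom) = y := by
  rw [← ofTm_sub]
  have : (fresh K (reg m)).sub (pair s y.tm.hom) = y.tm := by
    ext; exact pair_snd s y.tm.hom
  rw [this, ofTm_tm]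

theorem sub_wk_peel {n m : ℕ} (x : Tup K n) (s : L ⟶ K ⊗ reg m) [IsComonHom s] :
    x.sub (s ≫ fst K (reg m)) = (x.wk' (reg m)).sub s := by
  rw [wk', Tup.sub_sub]

theorem rel_comp1 {n k : ℕ} (D : ZXDiag n 1) (E : ZXDiag 1 k) (x : Tup K n)
    (z : Tup K k) : rel (D ⨟ E) x z = sm (rel D x.wk (t1 nw) * rel E (t1 nw) z.wk) := by
  rw [rel_comp, sm_reg_succ, sm_reg_zero, pull_sm, map_mul, map_mul]
  simp only [pull_rel, pair_peel, nw_peel, sub_wk_peel,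
    Tup.wk'_whiskerRight, Tup.wk'_inst, fold_wk, snoc_sub, nil_sub, fresh_whiskerRight]

theorem rel_comp2 {n k : ℕ} (D : ZXDiag n 2) (E : ZXDiag 2 k) (x : Tup K n)
    (z : Tup K k) : rel (D ⨟ E) x z =
      sm (sm (rel D x.wk.wk (t2 nw↟ nw) * rel E (t2 nw↟ nw) z.wk.wk)) := by
  rw [rel_comp, sm_reg_succ, sm_reg_succ, sm_reg_zero, pull_sm, pull_sm, pull_sm]
  simp only [map_mul, pull_rel, pair_peel, nw_peel, sub_wk_peel,
    Tup.wk'_whiskerRight, Tup.wk'_inst, fold_wk, snoc_sub, nil_sub, fresh_whiskerRight]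
  rfl

theorem rel_comp_det {n m k : ℕ} {D : ZXDiag n m} {x : Tup K n} {y : Tup K m} (h : Det D x y)
    (E : ZXDiag m k) (z : Tup K k) : rel (D ⨟ E) x z = rel E y z :=
  graph_comp_of_term (Y := reg m) (g := dg E) h z.tm

theorem rel_det {n m : ℕ} {D : ZXDiag n m} {x : Tup K n} {y : Tup K m} (h : Det D x y)
    (z : Tup K m) : rel D x z = prod2 eqv y z :=
  (graph_of_term (Y := reg m) h z.tm).trans (eqv_tm y z)

theorem Det.comp {n m k : ℕ} {D : ZXDiag n m} {E : ZXDiag m k} {x : Tup K n} {y : Tup K m}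
    {z : Tup K k} (h : Det D x y) (h' : Det E y z) : Det (D ⨟ E) x z := by
  have e : dg (D ⨟ E) = dg D ≫ dg E := rfl
  unfold Det at *
  rw [e, ← h', ← h, Category.assoc]

theorem Det.tens {n m n' m' : ℕ} {D : ZXDiag n m} {E : ZXDiag n' m'} {x : Tup K n} {y : Tup K m}
    {x' : Tup K n'} {y' : Tup K m'} (h : Det D x y) (h' : Det E x' y') :
    Det (D ⊠ E) (x.append x') (y.append y') := by
  have e := pair_tensor x.tm.hom x'.tm.hom (dg D) (dg E)
  unfold Det at *
  rw [h, h', ← tm_append, ← tm_append] at e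
  exact e

theorem Det.wires {n : ℕ} (x : Tup K n) : Det (wires n) x x := Category.comp_id x.tm.hom

theorem Det.swap {n m : ℕ} (x : Tup K n) (y : Tup K m) :
    Det (swap n m) (x.append y) (y.append x) := by
  have e := pair_braiding x.tm.hom y.tm.hom
  rw [← tm_append, ← tm_append] at e
  exact e

theorem Det.copy (a : Var K) : Det (Z 1 2 1) (t1 a) (t2 a a) := by
  unfold Det
  rw [tm_t1, tm_t2]
  have h := IsComonHom.hom_comul a.hom
  exact h

theorem Det.discard (a : Var K) : Det (Z 1 0 1) (t1 a) t0 := by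
  unfold Det
  rw [tm_t1]
  have h := IsComonHom.hom_counit a.hom
  exact h

/-- The diagram `E` maps `y` to `z` when read backwards: its graph at the output `z` says that the
inputs are `y`. -/
def Codet {m k : ℕ} (E : ZXDiag m k) (z : Tup K k) (y : Tup K m) : Prop :=
  ∀ (L : Obj) [ComonObj L] [IsCommComonObj L] (s : L ⟶ K) [IsComonHom s] (p : Tup L m),
    rel E p (z.sub s) = prod2 eqv p (y.sub s)

theorem Codet.sub {m k : ℕ} {E : ZXDiag m k} {z : Tup K k} {y : Tup K m} (h : Codet E z y)
    (s : L ⟶ K) [IsComonHom s] : Codet E (z.sub s) (y.sub s) := by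
  intro L _ _ t _ p
  rw [Tup.sub_sub, Tup.sub_sub, h]

theorem rel_comp_codet {n m k : ℕ} {E : ZXDiag m k} {z : Tup K k} {y : Tup K m} (h : Codet E z y)
    (D : ZXDiag n m) (x : Tup K n) : rel (D ⨟ E) x z = rel D x y := by
  rw [rel_comp, h, ← eqv_tm, tm_ofTm, mul_comm, tm_sub, eqv_comm]
  refine (sm_eqv_mul y.tm _).trans ?_
  simp only [fold_wk, pull_rel, inst, pair_peel, nw_peel, sub_id]

theorem Codet.comp {n m k : ℕ} {D : ZXDiag n m} {E : ZXDiag m k} {x : Tup K n} {y : Tup K m}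
    {z : Tup K k} (h : Codet D y x) (h' : Codet E z y) : Codet (D ⨟ E) z x := by
  intro L _ _ s _ p
  rw [rel_comp_codet (h'.sub s), h]

theorem Codet.tens {n m n' m' : ℕ} {D : ZXDiag n m} {E : ZXDiag n' m'} {x : Tup K n} {y : Tup K m}
    {x' : Tup K n'} {y' : Tup K m'} (h : Codet D y x) (h' : Codet E y' x') :
    Codet (D ⊠ E) (y.append y') (x.append x') := by
  intro L _ _ s _ p
  rw [← append_take_drop p, append_sub, append_sub, rel_tens, h, h', prod2_append]

theorem Codet.wires {n : ℕ} (x : Tup K n) : Codet (wires n) x x := by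
  intro L _ _ s _ p
  rw [rel_det (Det.wires p)]

theorem rel_wires {n : ℕ} (x y : Tup K n) : rel (.wires n) x y = prod2 eqv x y :=
  rel_det (Det.wires x) y

theorem rel_wires_one (x y : Var K) : rel (.wires 1) (t1 x) (t1 y) = eqv x y :=
  (rel_wires _ _).trans (one_mul _)

theorem Codet.swap {n m : ℕ} (x : Tup K n) (y : Tup K m) :
    Codet (Diag.swap n m) (y.append x) (x.append y) := by
  intro L _ _ s _ p
  rw [← append_take_drop p, append_sub, append_sub, rel_det (Det.swap _ _), prod2_append,
    prod2_append, mul_comm]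

/-- Equal terms can replace each other. -/
theorem eqv_mul_congr (x y : Var K) (f : Eff (K ⊗ wire)) {g h : Eff K}
    (hg : pull (inst x) f = g) (hh : pull (inst y) f = h) : eqv x y * g = eqv x y * h := by
  rw [← hg, ← hh, eqv_mul]

theorem sm_mul_const (f : Eff (K ⊗ wire)) (g : Eff K) :
    sm (f * pull (fst K wire) g) = sm f * g := Sg_mul _ _ _

theorem cup_reg_one : (Frob.cup : reg 1 ⊗ reg 1 ⟶ 𝟙_ Obj) = (Frob.cup : wire ⊗ wire ⟶ 𝟙_ Obj) := by
  have e : ∀ f : wire ⊗ wire ⟶ wire, pair ε[wire ⊗ wire] f = f := fun f =>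
    (Category.comp_id (pair ε[wire ⊗ wire] f)).symm.trans (counit_pair f)
  have h := pair_pairCup (Y := 𝟙_ Obj) ε[wire ⊗ wire] ε[wire ⊗ wire] (fst wire wire)
    (snd wire wire)
  have h₁ : (⟨pair ε[wire ⊗ wire] ε[wire ⊗ wire] ≫ Frob.cup⟩ : Eff (wire ⊗ wire)) = 1 := by
    ext; exact counit_pair _
  rw [h₁, one_mul] at h
  have h₂ : pair (pair ε[wire ⊗ wire] (fst wire wire)) (pair ε[wire ⊗ wire] (snd wire wire)) =
      𝟙 (wire ⊗ wire) := by
    refine Eq.trans ?_ pair_fst_snd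
    exact congrArg₂ pair (e _) (e _)
  have h₃ := (congrArg (· ≫ pairCup (𝟙_ Obj) wire) h₂).symm.trans h
  rw [pair_fst_snd] at h₃
  exact (Category.id_comp _).symm.trans (h₃.trans (Category.id_comp _))

theorem rel_one {n : ℕ} (D : ZXDiag n 1) (x : Tup K n) (z : Var K) :
    rel D x (t1 z) = ⟨pair (Y := wire) (x.tm.hom ≫ dg D) z.hom ≫ (Frob.cup (Y := wire))⟩ := by
  ext
  change pair (x.tm.hom ≫ dg D) (t1 z).tm.hom ≫ (Frob.cup (Y := reg 1)) = _
  rw [tm_t1, cup_reg_one]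
  rfl

theorem rel_merge (x y z : Var K) : rel (Z 2 1 1) (t2 x y) (t1 z) = eqv x z * eqv y z := by
  have h₁ : (rel (Z 2 1 1) (t2 x y) (t1 z)) = eqv x y * eqv x z := by
    rw [rel_one, tm_t2]
    have h := act_cup_left x.hom y.hom
    refine (congrArg (fun t => (⟨pair t z.hom ≫ Frob.cup⟩ : Eff K)) h.symm).trans ?_
    rw [pair_act_left, act_comp]; rfl
  rw [h₁, eqv_comm y z, mul_comm]
  exact eqv_mul_congr x z (eqv nw y↟) (by rw [pull_eqv]; simp) (by rw [pull_eqv]; simp)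

theorem Codet.merge (a : Var K) : Codet (Z 2 1 1) (t1 a) (t2 a a) := by
  intro L _ _ s _ p
  obtain ⟨⟨⟨⟩, x⟩, y⟩ := p
  exact (rel_merge x y (a.sub s)).trans (congrArg (· * eqv y (a.sub s)) (one_mul _).symm)

theorem rel_discard (x : Var K) : rel (Z 1 0 1) (t1 x) t0 = 1 := rel_det (Det.discard x) t0

theorem rel_pow (f : ZXDiag 1 1) {n : ℕ} (x y : Tup K n) :
    rel (pow f n) x y = prod2 (fun a b => rel f (t1 a) (t1 b)) x y := by
  induction n with
  | zero => exact rel_wires (n := 0) x y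
  | succ n ih =>
    rw [prod2, ← ih]
    exact rel_tens (pow f n) f x.1 y.1 (t1 x.2) (t1 y.2)

/-! ### Graphs of spiders -/

attribute [simp] pull_eqv pull_rel pull_sm

@[simp] theorem t0_wk' : (t0 : Tup K 0).wk' Y = t0 := rfl

@[simp] theorem snoc_wk' {n : ℕ} (x : Tup K n) (a : Var K) :
    (x.snoc a).wk' Y = (x.wk' Y).snoc (a.wk' Y) := rfl

/-- A sum over a variable `nw` that has a factor `eqv x nw`. -/
theorem sm_elim (x : Var K) (g : Eff (K ⊗ wire)) {f : Eff (K ⊗ wire)} {h : Eff K}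
    (hf : f = eqv x↟ nw * g) (hg : pull (inst x) g = h) : sm f = h := by
  rw [hf, sm_eqv_mul, hg]

theorem rel_zero {n : ℕ} (D : ZXDiag n 0) (x : Tup K n) : rel D x t0 = ⟨x.tm.hom ≫ dg D⟩ := by
  ext
  have h := counit_pair (C := Obj) (K := K) (X := 𝟙_ Obj) (x.tm.hom ≫ dg D)
  have h' := pair_braiding (C := Obj) (K := K) (X := 𝟙_ Obj) (Y := 𝟙_ Obj) ε[K] (x.tm.hom ≫ dg D)
  rw [braiding_unit, Category.comp_id] at h'
  rw [h'] at h
  exact h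

theorem rel_green_cup (x y : Var K) : rel (Z 2 0 1) (t2 x y) t0 = eqv x y := by
  rw [rel_zero, tm_t2]; rfl

/-- The phase `a` on a wire, the effect `a ^ x`. In particular `ph 0 x` says that `x` is zero. -/
def ph (a : ℂ) (x : Var K) : Eff K := rel (Z 1 0 a) (t1 x) t0

@[simp] theorem pull_ph (a : ℂ) (x : Var K) (s : L ⟶ K) [IsComonHom s] :
    pull s (ph a x) = ph a (x.sub s) := by simp [ph]

theorem ph_one (x : Var K) : ph 1 x = 1 := rel_discard x

theorem state_cup (a : ℂ) : Provable ((Z 0 1 a ⊠ wires 1) ⨟ Z 2 0 1) (Z 1 0 a) := by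
  have h := Derives.rule (Rule.S1 0 0 0 1 0 a 1)
  rw [mul_one] at h
  exact (Derives.comp_congr (.refl _) (Derives.id_tens _).symm).trans h

theorem rel_state (a : ℂ) (x : Var K) : rel (Z 0 1 a) t0 (t1 x) = ph a x := by
  rw [ph, ← rel_congr (state_cup a), rel_comp2]
  symm
  refine sm_elim x (rel (Z 0 1 a) t0 (t1 nw)) ?_ (by simp)
  refine sm_elim nw (rel (Z 0 1 a ⊠ wires 1) (t1 x↟↟) (t2 nw↟ nw)) ?_ ?_
  · simp [rel_green_cup, mul_comm]
  · rw [pull_rel, ← rel_wires_one, mul_comm]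
    simp
    exact rel_tens (Z 0 1 a) (wires 1) t0 (t1 nw) (t1 x↟) (t1 nw)

theorem rel_phase (a : ℂ) (x y : Var K) : rel (Z 1 1 a) (t1 x) (t1 y) = ph a x * eqv x y := by
  have h : Provable (Z 1 2 1 ⨟ (wires 1 ⊠ Z 1 0 a)) (Z 1 1 a) := by
    have h := fuse_below 1 1 0 0 1 a
    rw [one_mul] at h
    exact h
  rw [← rel_congr h, rel_comp_det (Det.copy x), ← rel_wires_one, mul_comm]
  exact rel_tens (wires 1) (Z 1 0 a) (t1 x) (t1 y) (t1 x) t0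

/-! #### Spiders with many legs -/

theorem Det.spider (m : ℕ) (a : Var K) : Det (Z 1 m 1) (t1 a) (const m a) := by
  induction m with
  | zero => exact Det.discard a
  | succ m ih =>
    have h := fuse_below 1 1 0 m 1 1
    rw [one_mul] at h
    have h' := (Det.copy a).comp ((Det.wires (t1 a)).tens ih)
    have e : append (t1 a) (const m a) = const (1 + m) a := const_append 1 m a
    rw [e] at h'
    have h'' : Det (Z 1 (1 + m) 1) (t1 a) (const (1 + m) a) := by
      unfold Det at h' ⊢
      rw [← h']
      exact congrArg ((t1 a).tm.hom ≫ ·) (cls_eq.2 h.symm)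
    rwa [Nat.add_comm] at h''

theorem Codet.congr {n m : ℕ} {D E : ZXDiag n m} (h : Provable D E) {z : Tup K m} {y : Tup K n}
    (hD : Codet D z y) : Codet E z y := by
  intro L _ _ s _ p
  rw [← rel_congr h, hD]

theorem Codet.spider (n : ℕ) (a : Var K) : Codet (Z n 1 1) (t1 a) (const n a) := by
  induction n with
  | zero =>
    intro L _ _ s _ p
    exact (rel_state 1 (a.sub s)).trans (ph_one _)
  | succ n ih =>
    have h := Derives.rule (Rule.S1 n 0 0 1 1 (1 : ℂ) (1 : ℂ))
    rw [one_mul] at h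
    have h' : Codet (m := n + 1) (Diag.comp (Diag.tens (Z n 1 1) (Diag.wires 1))
        (Z (1 + 1) 1 1)) (t1 a) (const (n + 1) a) :=
      (ih.tens (Codet.wires (t1 a))).comp (Codet.merge a)
    exact h'.congr ((Derives.comp_congr (.refl _) (Derives.id_tens _).symm).trans h)

theorem spider_congr {n m n' m' : ℕ} (hn : n = n') (hm : m = m') (a : ℂ) :
    Derives Rule (Z n m a) (Z n' m' a) := by
  subst hn hm; exact .refl _

/-- A spider splits into a merge, a phase and a copy. -/
theorem spider_split (n m : ℕ) (a : ℂ) :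
    Provable (Z n 1 1 ⨟ (Z 1 1 a ⨟ Z 1 m 1)) (Z n m a) := by
  have h₁ := fuse_below 1 0 0 m a 1
  have h₂ := fuse_below n 0 0 m 1 a
  have e : Derives Rule (Z n (0 + m) a) (Z n m a) := spider_congr rfl (Nat.zero_add m) a
  have e' : Derives Rule (Z 1 (0 + m) a) (Z (0 + 1) m a) := spider_congr rfl (Nat.zero_add m) a
  rw [one_mul] at h₂
  rw [mul_one] at h₁
  exact (Derives.comp_congr (.refl _) ((Derives.comp_congr (.refl _) (Derives.id_tens _).symm).trans
    (h₁.trans e'))).trans ((Derives.comp_congr (.refl _) (Derives.id_tens _).symm).trans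
      (h₂.trans e))

@[simp] theorem const_wk (n : ℕ) (a : Var K) (s : L ⟶ K) [IsComonHom s] :
    (const n a).sub s = const n (a.sub s) := const_sub n a s

/-- A green spider between two diagrams. -/
theorem rel_spider {n m n' m' : ℕ} (D : ZXDiag n' n) (E : ZXDiag m m') (a : ℂ) (x : Tup K n')
    (y : Tup K m') : rel (D ⨟ Z n m a ⨟ E) x y =
      sm (rel D x.wk (const n nw) * ph a nw * rel E (const m nw) y.wk) := by
  have h : Provable (D ⨟ Z n m a ⨟ E) ((D ⨟ Z n 1 1) ⨟ (Z 1 1 a ⨟ (Z 1 m 1 ⨟ E))) :=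
    ((Derives.comp_assoc _ _ _).trans (.comp_congr (.refl _)
      ((Derives.comp_congr (spider_split n m a).symm (.refl _)).trans
        ((Derives.comp_assoc _ _ _).trans
          (.comp_congr (.refl _) (Derives.comp_assoc _ _ _)))))).trans
      (Derives.comp_assoc _ _ _).symm
  rw [rel_congr h, rel_comp1]
  congr 1
  rw [rel_comp_codet (Codet.spider n nw), rel_comp1, mul_assoc]
  congr 1
  refine sm_elim nw (ph a nw↟ * rel E (const m nw) y.wk.wk) ?_ (by simp)
  rw [rel_comp_det (Det.spider m nw)]
  have : (t1 (nw : Var (K ⊗ wire))).wk = t1 nw↟ := rfl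
  rw [this, rel_phase]
  ac_rfl

theorem rel_red {n m : ℕ} (a : ℂ) (x : Tup K n) (y : Tup K m) : rel (X n m a) x y =
    sm (rel (pow H n) x.wk (const n nw) * ph a nw * rel (pow H m) (const m nw) y.wk) :=
  rel_spider _ _ _ _ _

/-! #### Caps, cups and bent triangles -/

theorem cap_provable : Provable (Z 0 1 1 ⨟ Z 1 2 1) cap := by
  have h := fuse_below 0 0 0 2 1 1
  rw [one_mul] at h
  exact (Derives.comp_congr (.refl _) (Derives.id_tens _).symm).trans
    (h.trans (.rule .S3_green))

theorem rel_whisker_unit (x p q : Var K) :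
    rel (wires 1 ⊠ Z 0 1 1) (t1 x) (t2 p q) = eqv x p := by
  rw [← rel_wires_one, ← mul_one (rel (wires 1) _ _), ← ph_one q, ← rel_state]
  exact rel_tens (wires 1) (Z 0 1 1) (t1 x) (t1 p) t0 (t1 q)

theorem rel_unit_whisker (x p q : Var K) :
    rel (Z 0 1 1 ⊠ wires 1) (t1 x) (t2 p q) = eqv x q := by
  rw [← rel_wires_one, ← one_mul (rel (wires 1) _ _), ← ph_one p, ← rel_state]
  exact rel_tens (Z 0 1 1) (wires 1) t0 (t1 p) (t1 x) (t1 q)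

/-- The abstract cup of the compact structure is the green equality test. -/
theorem rel_cup (x y : Var K) : rel cup (t2 x y) t0 = eqv x y := by
  have h : Provable ((wires 1 ⊠ Z 0 1 1) ⨟ ((wires 1 ⊠ Z 1 2 1) ⨟ (cup ⊠ wires 1))) (wires 1) := by
    refine Derives.trans ?_ (Derives.snake_right)
    refine (Derives.comp_assoc _ _ _).symm.trans (.comp_congr ?_ (.refl _))
    exact (Derives.interchange _ _ _ _).trans (.tens_congr (.id_comp _) cap_provable)
  have h' := rel_congr h (t1 x) (t1 y)
  have e : ∀ {L : Obj} [ComonObj L] [IsCommComonObj L] (p q y : Var L),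
      rel ((wires 1 ⊠ Z 1 2 1) ⨟ (cup ⊠ wires 1)) (t2 p q) (t1 y) =
        rel cup (t2 p q) t0 * eqv q y := by
    intro L _ _ p q y
    have hd : Det (wires 1 ⊠ Z 1 2 1) (t2 p q) ((t2 p q).append (t1 q)) :=
      (Det.wires (t1 p)).tens (Det.copy q)
    rw [rel_comp_det hd, ← rel_wires_one]
    exact rel_tens cup (wires 1) (t2 p q) t0 (t1 q) (t1 y)
  rw [rel_wires_one, rel_comp2] at h'
  rw [← h']
  symm
  refine sm_elim x (rel cup (t2 nw y↟) t0) ?_ (by simp)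
  refine sm_elim y↟ (eqv x↟↟ nw↟ * rel cup (t2 nw↟ nw) t0) ?_ (by simp)
  simp only [t0_wk', snoc_wk', rel_whisker_unit, e]
  rw [eqv_comm nw]
  ac_rfl

/-- Bending the wires of the triangle exchanges its input and output. -/
theorem rel_Tdown (x y : Var K) : rel Tdown (t1 x) (t1 y) = rel T (t1 y) (t1 x) := by
  have h : Provable Tdown ((Z 0 1 1 ⊠ wires 1) ⨟ ((Z 1 2 1 ⊠ wires 1) ⨟
      (wires 1 ⊠ ((T ⊠ wires 1) ⨟ cup)))) := by
    refine (Derives.comp_assoc _ _ _).trans ?_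
    refine Derives.trans ?_ (Derives.comp_assoc _ _ _)
    refine Derives.comp_congr (Derives.symm ?_) ?_
    · exact (Derives.interchange _ _ _ _).trans (.tens_congr cap_provable (.id_comp _))
    · refine (Derives.comp_congr (Derives.tens_assoc (wires 1) T (wires 1)) (.refl _)).trans ?_
      exact (Derives.interchange _ _ _ _).trans (.tens_congr (.id_comp _) (.refl _))
  have e : ∀ {L : Obj} [ComonObj L] [IsCommComonObj L] (p q : Var L),
      rel ((T ⊠ wires 1) ⨟ cup) (t2 p q) t0 = rel T (t1 p) (t1 q) := by
    intro L _ _ p q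
    rw [rel_comp2]
    refine sm_elim q (rel T (t1 p↟) (t1 nw)) ?_ (by simp)
    refine sm_elim nw (rel T (t1 p↟↟) (t1 nw↟) * eqv q↟↟ nw) ?_ (by simp [mul_comm])
    simp only [t0_wk', snoc_wk', rel_cup, ← rel_wires_one]
    rw [mul_comm]
    congr 1
    exact rel_tens T (wires 1) (t1 p↟↟) (t1 nw↟) (t1 q↟↟) (t1 nw)
  have e' : ∀ {L : Obj} [ComonObj L] [IsCommComonObj L] (p q y : Var L),
      rel ((Z 1 2 1 ⊠ wires 1) ⨟ (wires 1 ⊠ ((T ⊠ wires 1) ⨟ cup))) (t2 p q) (t1 y) =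
        eqv p y * rel T (t1 p) (t1 q) := by
    intro L _ _ p q y
    have hd : Det (Z 1 2 1 ⊠ wires 1) (t2 p q) ((t1 p).append (t2 p q)) :=
      (Det.copy p).tens (Det.wires (t1 q))
    rw [rel_comp_det hd, ← rel_wires_one, ← e]
    exact rel_tens (wires 1) _ (t1 p) (t1 y) (t2 p q) t0
  rw [rel_congr h, rel_comp2]
  refine sm_elim y (rel T (t1 nw) (t1 x↟)) ?_ (by simp)
  refine sm_elim x↟ (eqv y↟↟ nw↟ * rel T (t1 nw↟) (t1 nw)) ?_ (by simp)
  simp only [t0_wk', snoc_wk', rel_unit_whisker, e']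
  rw [eqv_comm nw↟]

/-! ### The rules as equations between effects -/

/-- The triangle, as an effect on its input and output: it says that `y ≤ x`. -/
def tri (x y : Var K) : Eff K := rel T (t1 x) (t1 y)

/-- The inverse triangle, as an effect on its input and output. -/
def trinv (x y : Var K) : Eff K := rel Tinv (t1 x) (t1 y)

/-- The Hadamard node, as an effect on its input and output: `(-1) ^ (x y) / √2`. -/
def hd (x y : Var K) : Eff K := rel H (t1 x) (t1 y)

/-- The scalar `√2`, as an effect that depends on no variable. -/
def rho (K : Obj) [ComonObj K] [IsCommComonObj K] : Eff K := rel sqrtTwo t0 t0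

@[simp] theorem pull_tri (x y : Var K) (s : L ⟶ K) [IsComonHom s] :
    pull s (tri x y) = tri (x.sub s) (y.sub s) := by simp [tri]

@[simp] theorem pull_trinv (x y : Var K) (s : L ⟶ K) [IsComonHom s] :
    pull s (trinv x y) = trinv (x.sub s) (y.sub s) := by simp [trinv]

@[simp] theorem pull_hd (x y : Var K) (s : L ⟶ K) [IsComonHom s] :
    pull s (hd x y) = hd (x.sub s) (y.sub s) := by simp [hd]

@[simp] theorem pull_rho (s : L ⟶ K) [IsComonHom s] : pull s (rho K) = rho L := by simp [rho]

@[simp] theorem sub_fst (x : Var K) : x.sub (fst K Y) = x.wk' Y := rfl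

@[simp] theorem const_zero (a : Var K) : const 0 a = t0 := rfl
@[simp] theorem const_one (a : Var K) : const 1 a = t1 a := rfl
@[simp] theorem const_two (a : Var K) : const 2 a = t2 a a := rfl

@[simp] theorem prod2_t0 (f : Var K → Var K → Eff K) (x y : Tup K 0) : prod2 f x y = 1 := rfl

@[simp] theorem prod2_snoc (f : Var K → Var K → Eff K) {n : ℕ} (x y : Tup K n) (a b : Var K) :
    prod2 f (x.snoc a) (y.snoc b) = prod2 f x y * f a b := rfl

theorem mul_sm (g : Eff K) (f : Eff (K ⊗ wire)) : g * sm f = sm (pull (fst K wire) g * f) := by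
  rw [mul_comm, ← sm_mul_const, mul_comm]

/-- A double sum whose outer variable is determined. -/
theorem sm_sm_elim (x : Var K) (g : Eff ((K ⊗ wire) ⊗ wire)) {f : Eff ((K ⊗ wire) ⊗ wire)}
    {h : Eff (K ⊗ wire)} (hf : f = eqv x↟↟ nw↟ * g) (hg : pull (inst x ▷ wire) g = h) :
    sm (sm f) = sm h := by
  have e : sm f = eqv x↟ nw * sm g := by rw [mul_sm, hf]; simp
  rw [e, sm_eqv_mul, pull_sm, hg]

/-- A red state, as an effect on its output. -/
def rst (a : ℂ) (x : Var K) : Eff K := sm (ph a nw * hd nw x↟)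

/-- A red phase, as an effect on its input and output. -/
def rph (a : ℂ) (x y : Var K) : Eff K := sm (hd x↟ nw * ph a nw * hd nw y↟)

/-- The red spider with two inputs and one output, as an effect: it says that `z = x + y`, up to the
scalar `√2`. -/
def rsp (x y z : Var K) : Eff K := sm (hd x↟ nw * hd y↟ nw * hd nw z↟)

theorem rel_rst (a : ℂ) (x : Var K) : rel (X 0 1 a) t0 (t1 x) = rst a x := by
  rw [rel_red]; simp [rel_pow, rst]; rfl

theorem rel_rph (a : ℂ) (x y : Var K) : rel (X 1 1 a) (t1 x) (t1 y) = rph a x y := by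
  rw [rel_red]; simp [rel_pow, rph]; rfl

theorem rel_rsp (x y z : Var K) : rel (X 2 1 1) (t2 x y) (t1 z) = rsp x y z := by
  rw [rel_red]; simp [rel_pow, rsp, ph_one]; rfl

theorem hd_hd (x y : Var K) : sm (hd x↟ nw * hd nw y↟) = eqv x y := by
  have h := rel_congr (.rule .S2_red) (t1 x) (t1 y)
  rw [rel_rph, rel_wires_one] at h
  simpa [rph, ph_one] using h

theorem hd_hd_swap (x y : Var K) : sm (hd nw x↟ * hd nw y↟) = eqv x y := by
  have h₁ : rel cap t0 (t2 x y) = eqv x y := by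
    rw [← rel_congr cap_provable, rel_comp1]
    refine sm_elim x (eqv nw y↟) ?_ (by simp)
    simp only [t0_wk', snoc_wk', rel_state, ph_one, rel_det (Det.copy _), eqv_comm x↟]
    simp
  have h := rel_congr (.rule .S3_red) t0 (t2 x y)
  rw [rel_red, h₁] at h
  simp [rel_pow, ph_one] at h
  exact h

theorem zero_rule (x : Var K) : ph 0 x * rho K = rst 1 x := by
  rw [← rel_rst, ← rel_congr (.rule .Zero), rho, ← rel_state]
  exact (rel_tens (Z 0 1 0) sqrtTwo t0 (t1 x) t0 t0).symm

theorem rho_eq : rho K = sm (rst 1 nw) := by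
  rw [rho, sqrtTwo, rel_comp1]
  simp [rel_rst, rel_discard]

theorem rel_tens_scalar {n m : ℕ} (D : ZXDiag n m) (E : ZXDiag 0 0) (x : Tup K n) (y : Tup K m) :
    rel (D ⊠ E) x y = rel D x y * rel E t0 t0 := rel_tens D E x y t0 t0

theorem rel_empty : rel (wires 0) t0 t0 = (1 : Eff K) := rel_wires t0 t0

theorem rel_scalar (c : ℂ) : rel (scalar c) t0 t0 =
    (sm (rst (-1) nw * ph (c / ((Real.sqrt 2 : ℝ) : ℂ)) nw) : Eff K) := by
  rw [scalar, rel_comp1]; simp [rel_rst]; rfl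

theorem rel_comp_copy {n : ℕ} (D : ZXDiag n 1) (x : Tup K n) (y z : Var K) :
    rel (D ⨟ Z 1 2 1) x (t2 y z) = rel D x (t1 y) * eqv y z := by
  rw [rel_comp1]
  refine sm_elim y (rel D x.wk (t1 nw) * eqv nw z↟) ?_ (by simp)
  rw [rel_det (Det.copy _), eqv_comm y↟]
  simp
  grind

theorem b1_rule (x y : Var K) : rst 1 x * eqv x y * rho K = rst 1 x * rst 1 y := by
  have h := rel_congr (.rule .B1) t0 (t2 x y)
  rw [rel_tens_scalar, rel_comp_copy] at h
  rw [← rel_rst, ← rel_rst]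
  exact h.trans (rel_tens (X 0 1 1) (X 0 1 1) t0 (t1 x) t0 (t1 y))

theorem b2_rule (x y u v : Var K) : rsp x y u * eqv u v = rsp x y u * rsp x y v * rho K := by
  have h := rel_congr (.rule .B2) (t2 x y) (t2 u v)
  have hd : Det ((Z 1 2 1 ⊠ Z 1 2 1) ⨟ (wires 1 ⊠ swap 1 1 ⊠ wires 1)) (t2 x y)
      ((t2 x y).append (t2 x y)) :=
    ((Det.copy x).tens (Det.copy y)).comp
      (((Det.wires (t1 x)).tens (Det.swap (t1 x) (t1 y))).tens (Det.wires (t1 y)))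
  rw [rel_tens_scalar, rel_comp_copy, rel_rsp, rel_comp_det hd] at h
  rw [h, ← rel_rsp, ← rel_rsp]
  congr 1
  exact rel_tens (X 2 1 1) (X 2 1 1) (t2 x y) (t1 u) (t2 x y) (t1 v)

theorem rel_phase_comp {m : ℕ} (a : ℂ) (E : ZXDiag 1 m) (x : Var K) (y : Tup K m) :
    rel (Z 1 1 a ⨟ E) (t1 x) y = ph a x * rel E (t1 x) y := by
  rw [rel_comp1]
  refine sm_elim x (ph a nw * rel E (t1 nw) y.wk) ?_ (by simp)
  simp only [snoc_wk', t0_wk', rel_phase]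
  rw [mul_comm (ph a x↟), eqv_mul_congr x↟ nw (g := ph a x↟) (h := ph a nw) (ph a nw)
    (by simp) (by simp), mul_assoc]

theorem rel_comp_phase {n : ℕ} (a : ℂ) (D : ZXDiag n 1) (x : Tup K n) (y : Var K) :
    rel (D ⨟ Z 1 1 a) x (t1 y) = rel D x (t1 y) * ph a y := by
  rw [rel_comp1]
  refine sm_elim y (rel D x.wk (t1 nw) * ph a nw) ?_ (by simp)
  simp only [snoc_wk', t0_wk', rel_phase]
  rw [eqv_comm y↟]
  grind

theorem eu_pos_rule (x y : Var K) : hd x y = ph Complex.I x * rph Complex.I x y *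
    ph Complex.I y * rel (scalar (Complex.exp (-(Real.pi / 4 * Complex.I)))) t0 t0 := by
  rw [hd, rel_congr (.rule .EU_pos), rel_tens_scalar, rel_comp_phase, rel_phase_comp, rel_rph]

theorem bas0_rule (y : Var K) : sm (rst 1 nw * tri nw y↟) = rst 1 y := by
  rw [← rel_rst 1 y, ← rel_congr (.rule .Bas0), rel_comp1]
  simp [rel_rst, tri]

theorem bas1_rule (y : Var K) : sm (rst (-1) nw * tri nw y↟) = rho K := by
  have h := rel_congr (.rule .Bas1) t0 (t1 y)
  rw [rel_tens_scalar, rel_state, ph_one, one_mul, rel_comp1] at h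
  rw [rho, ← h]
  simp [rel_rst, tri]

theorem suc_rule (a : ℂ) (x : Var K) : sm (tri x↟ nw * ph a nw) = ph (a + 1) x := by
  have h := rel_congr (.rule (.Suc a)) (t1 x) t0
  rw [rel_comp1] at h
  exact h

theorem inv_right_rule (x y : Var K) : sm (trinv x↟ nw * tri nw y↟) = eqv x y := by
  rw [← rel_wires_one, ← rel_congr (.rule .Inv_right), rel_comp1]
  simp [tri, trinv]

/-- The AND gate as an effect: it says that `z` is the conjunction of `x` and `y`. -/
def andE (x y z : Var K) : Eff K := sm (tri x↟ nw * tri y↟ nw * trinv nw z↟)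

@[simp] theorem pull_andE (x y z : Var K) (s : L ⟶ K) [IsComonHom s] :
    pull s (andE x y z) = andE (x.sub s) (y.sub s) (z.sub s) := by simp [andE]

@[simp] theorem pull_rst (a : ℂ) (x : Var K) (s : L ⟶ K) [IsComonHom s] :
    pull s (rst a x) = rst a (x.sub s) := by simp [rst]

@[simp] theorem pull_rph (a : ℂ) (x y : Var K) (s : L ⟶ K) [IsComonHom s] :
    pull s (rph a x y) = rph a (x.sub s) (y.sub s) := by simp [rph]

@[simp] theorem pull_rsp (x y z : Var K) (s : L ⟶ K) [IsComonHom s] :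
    pull s (rsp x y z) = rsp (x.sub s) (y.sub s) (z.sub s) := by simp [rsp]

theorem rel_and (x y z : Var K) : rel And (t2 x y) (t1 z) = andE x y z := by
  rw [And, rel_comp1]
  congr 1
  rw [rel_comp_codet (Codet.merge _)]
  congr 1
  exact rel_tens T T (t1 x↟) (t1 nw) (t1 y↟) (t1 nw)

theorem brk_rule (x y z : Var K) : sm (rph (-1) y↟ nw * andE x↟ nw z↟) =
    sm (andE x↟ y↟ nw * rsp x↟ nw z↟) * rho K := by
  have h := rel_congr (.rule .Brk) (t2 x y) (t1 z)
  have e₁ : rel ((wires 1 ⊠ X 1 1 (-1)) ⨟ And) (t2 x y) (t1 z) =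
      sm (rph (-1) y↟ nw * andE x↟ nw z↟) := by
    rw [rel_comp2]
    refine sm_sm_elim x (rph (-1) y↟↟ nw * andE nw↟ nw z↟↟) ?_ (by simp)
    simp only [snoc_wk', t0_wk', rel_and]
    rw [← mul_assoc, ← rel_wires_one, ← rel_rph]
    congr 1
    exact rel_tens (wires 1) (X 1 1 (-1)) (t1 x↟↟) (t1 nw↟) (t1 y↟↟) (t1 nw)
  have e₂ : ∀ {L : Obj} [ComonObj L] [IsCommComonObj L] (x y p q : Var L),
      rel ((Z 1 2 1 ⊠ wires 1) ⨟ (wires 1 ⊠ And)) (t2 x y) (t2 p q) = eqv x p * andE x y q := by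
    intro L _ _ x y p q
    have hd : Det (Z 1 2 1 ⊠ wires 1) (t2 x y) ((t1 x).append (t2 x y)) :=
      (Det.copy x).tens (Det.wires (t1 y))
    rw [rel_comp_det hd, ← rel_wires_one, ← rel_and]
    exact rel_tens (wires 1) And (t1 x) (t1 p) (t2 x y) (t1 q)
  rw [e₁, rel_tens_scalar, rel_comp2] at h
  rw [h]
  congr 1
  refine sm_sm_elim x (andE x↟↟ y↟↟ nw * rsp nw↟ nw z↟↟) ?_ (by simp)
  simp only [snoc_wk', t0_wk', rel_rsp, e₂]
  rw [mul_assoc]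

/-- The W diagram as an effect: `y ≤ x` and `z = x + y`, up to the scalar `√2`. -/
def wE (x y z : Var K) : Eff K := tri x y * rsp y x z

theorem rel_W (x y z : Var K) : rel W (t1 x) (t2 y z) = wE x y z := by
  have h : Provable W (Z 1 2 1 ⨟ ((T ⊠ wires 1) ⨟ ((Z 1 2 1 ⊠ wires 1) ⨟ (wires 1 ⊠ X 2 1 1)))) :=
    (Derives.comp_assoc _ _ _).trans ((Derives.comp_assoc _ _ _).trans
      (Derives.comp_congr (.refl _) (.refl _)))
  have e : ∀ {L : Obj} [ComonObj L] [IsCommComonObj L] (p q y z : Var L),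
      rel ((Z 1 2 1 ⊠ wires 1) ⨟ (wires 1 ⊠ X 2 1 1)) (t2 p q) (t2 y z) =
        eqv p y * rsp p q z := by
    intro L _ _ p q y z
    have hd : Det (Z 1 2 1 ⊠ wires 1) (t2 p q) ((t1 p).append (t2 p q)) :=
      (Det.copy p).tens (Det.wires (t1 q))
    rw [rel_comp_det hd, ← rel_wires_one, ← rel_rsp]
    exact rel_tens (wires 1) (X 2 1 1) (t1 p) (t1 y) (t2 p q) (t1 z)
  rw [rel_congr h, rel_comp_det (Det.copy x), rel_comp2]
  refine sm_elim y (tri x↟ nw * rsp nw x↟ z↟) ?_ (by simp [wE])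
  refine sm_elim x↟ (tri x↟↟ nw↟ * eqv y↟↟ nw↟ * rsp nw↟ nw z↟↟) ?_ ?_
  · simp only [snoc_wk', t0_wk', e]
    have : rel (T ⊠ wires 1) (t2 x↟↟ x↟↟) (t2 nw↟ nw) =
        tri x↟↟ nw↟ * eqv x↟↟ nw := by
      rw [← rel_wires_one]
      exact rel_tens T (wires 1) (t1 x↟↟) (t1 nw↟) (t1 x↟↟) (t1 nw)
    rw [this, eqv_comm nw↟]
    grind
  · simp; grind

@[simp] theorem pull_wE (x y z : Var K) (s : L ⟶ K) [IsComonHom s] :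
    pull s (wE x y z) = wE (x.sub s) (y.sub s) (z.sub s) := by simp [wE]

theorem pcy_rule (a : ℂ) (x y z : Var K) : ph a x * wE x y z = wE x y z * ph a y * ph a z := by
  rw [← rel_W, ← rel_phase_comp, rel_congr (.rule (.Pcy a)), rel_comp2]
  refine sm_elim y (wE x↟ nw z↟ * ph a nw * ph a z↟) ?_ (by simp [rel_W])
  refine sm_elim z↟ (wE x↟↟ nw↟ nw * ph a nw↟ * eqv y↟↟ nw↟ * ph a nw) ?_ ?_
  · simp only [snoc_wk', t0_wk', rel_W]
    have : rel (Z 1 1 a ⊠ Z 1 1 a) (t2 nw↟ nw) (t2 y↟↟ z↟↟) =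
        (ph a nw↟ * eqv nw↟ y↟↟) * (ph a nw * eqv nw z↟↟) := by
      rw [← rel_phase, ← rel_phase]
      exact rel_tens (Z 1 1 a) (Z 1 1 a) (t1 nw↟) (t1 y↟↟) (t1 nw) (t1 z↟↟)
    rw [this, eqv_comm nw, eqv_comm nw↟]
    grind
  · simp; grind

theorem sym_rule (x y z : Var K) : wE x y z = wE x z y := by
  rw [← rel_W, ← rel_congr (.rule .Sym), ← rel_W]
  exact (rel_comp_codet (Codet.swap (t1 z) (t1 y)) _ _)

theorem aso_rule (x a b c : Var K) : sm (wE x↟ nw c↟ * wE nw a↟ b↟) =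
    sm (wE x↟ a↟ nw * wE nw b↟ c↟) := by
  have h := rel_congr (.rule .Aso) (t1 x) (t3 a b c)
  rw [rel_comp2, rel_comp2] at h
  have e₁ : ∀ {L : Obj} [ComonObj L] [IsCommComonObj L] (p q a b c : Var L),
      rel (W ⊠ wires 1) (t2 p q) (t3 a b c) = wE p a b * eqv c q := by
    intro L _ _ p q a b c
    rw [eqv_comm, ← rel_wires_one, ← rel_W]
    exact rel_tens W (wires 1) (t1 p) (t2 a b) (t1 q) (t1 c)
  have e₂ : ∀ {L : Obj} [ComonObj L] [IsCommComonObj L] (p q a b c : Var L),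
      rel (wires 1 ⊠ W) (t2 p q) (t3 a b c) = eqv a p * wE q b c := by
    intro L _ _ p q a b c
    rw [eqv_comm, ← rel_wires_one, ← rel_W]
    exact rel_tens (wires 1) W (t1 p) (t1 a) (t1 q) (t2 b c)
  simp only [snoc_wk', t0_wk', rel_W, e₁, e₂] at h
  refine Eq.trans ?_ (h.trans ?_)
  · congr 1
    symm
    exact sm_elim c↟ (wE x↟↟ nw↟ nw * wE nw↟ a↟↟ b↟↟) (by grind) (by simp)
  · exact sm_sm_elim a (wE x↟↟ nw↟ nw * wE nw b↟↟ c↟↟) (by grind) (by simp)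

/-! ### Tools for sums -/

/-- The exchange of two fresh variables. -/
def xch (K : Obj) [ComonObj K] [IsCommComonObj K] : (K ⊗ wire) ⊗ wire ⟶ (K ⊗ wire) ⊗ wire :=
  pair (pair (fst _ _ ≫ fst _ _) (snd _ _)) (fst _ _ ≫ snd _ _)

instance : IsComonHom (xch K) := by unfold xch; infer_instance

@[simp] theorem xch_old (x : Var K) : (x↟↟).sub (xch K) = x↟↟ := by
  ext
  simp only [Tm.wk', Tm.sub, xch, ← Category.assoc, pair_fst]

@[simp] theorem xch_fst : (nw↟).sub (xch K) = nw := by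
  ext
  simp only [Tm.wk', Tm.sub, xch, fresh, ← Category.assoc, pair_fst, pair_snd]

@[simp] theorem xch_snd : (nw).sub (xch K) = nw↟ := by
  ext
  simp only [Tm.wk', Tm.sub, xch, fresh, pair_snd]

theorem sm_comm' (f : Eff ((K ⊗ wire) ⊗ wire)) {g : Eff ((K ⊗ wire) ⊗ wire)}
    (h : pull (xch K) f = g) : sm (sm f) = sm (sm g) := by
  subst h; exact sm_comm f

theorem eq_of_eqv {x y : Var K} (h : eqv x y = 1) : x = y := by
  have := act_eqv x y
  rw [h, act_one, act_one] at this
  exact Tm.ext this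

theorem sm_mul (f : Eff (K ⊗ wire)) (g : Eff K) : sm f * g = sm (f * pull (fst K wire) g) :=
  (sm_mul_const f g).symm

/-- Composition of kernels is associative: in `∑ y, f y * ∑ z, g y z * h z` the sums may be
exchanged. -/
theorem sm_assoc (f h : Eff (K ⊗ wire)) (g : Eff ((K ⊗ wire) ⊗ wire)) :
    sm (f * sm (g * pull (fst K wire ▷ wire) h)) =
      sm (sm (pull (fst K wire ▷ wire) f * pull (xch K) g) * h) := by
  have e : fst K wire ▷ wire = pair (fst (K ⊗ wire) wire ≫ fst K wire) (snd (K ⊗ wire) wire) := by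
    rw [← pair_whiskerRight, pair_fst_snd, Category.id_comp]
  have e₂ : xch K ≫ fst (K ⊗ wire) wire = fst K wire ▷ wire := by
    rw [e, xch, pair_fst]
  have e₁ : xch K ≫ fst K wire ▷ wire = fst (K ⊗ wire) wire := by
    rw [e, comp_pair, ← Category.assoc, e₂, whiskerRight_fst, xch, pair_snd, ← comp_pair,
      pair_fst_snd, Category.comp_id]
  rw [mul_sm, sm_mul]
  refine sm_comm' _ ?_
  rw [map_mul, map_mul, pull_pull, pull_pull, pull_congr e₁, pull_congr e₂, mul_assoc]

theorem sm_eqv_right (y : Var K) (f : Eff (K ⊗ wire)) : sm (f * eqv nw y↟) = pull (inst y) f := by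
  rw [mul_comm, eqv_comm, sm_eqv_mul]

theorem sm_eqv_left (y : Var K) (f : Eff (K ⊗ wire)) : sm (eqv y↟ nw * f) = pull (inst y) f :=
  sm_eqv_mul y f

theorem hd_comm (x y : Var K) : hd x y = hd y x := by
  have h := sm_assoc (hd nw x↟) (hd nw y↟) (hd nw↟ nw)
  simp only [pull_hd, xch_fst, xch_snd, fresh_whiskerRight, Ctx.wk'_whiskerRight, sub_fst,
    hd_hd, hd_hd_swap] at h
  rw [sm_eqv_right, sm_eqv_left] at h
  simpa using h.symm

/-- The Hadamard transform is injective on terms. -/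
theorem eq_of_hd {x y : Var K} (h : hd x↟ nw = hd y↟ nw) : x = y := by
  refine eq_of_eqv ?_
  rw [← eqv_self y, ← hd_hd, ← hd_hd, h]

/-! ### The scalar `√2` and the constant `0` -/

theorem rst_one_eq (x : Var K) : rst 1 x = sm (hd nw x↟) := by simp [rst, ph_one]

theorem rst_hd (a : ℂ) (x : Var K) : sm (rst a nw * hd nw x↟) = ph a x := by
  have h := sm_assoc (ph a nw) (hd nw x↟) (hd nw↟ nw)
  simp [hd_hd] at h
  rw [sm_eqv_right] at h
  simpa [rst, hd_comm] using h.symm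

theorem rst_rph (a : ℂ) (x : Var K) : sm (rst 1 nw * rph a nw x↟) = rst a x := by
  have h := sm_assoc (rst 1 nw) (ph a nw * hd nw x↟) (hd nw↟ nw)
  simp [← mul_assoc, rst_hd] at h
  simp only [ph_one, one_mul] at h
  exact h

/-- The scalar `√2` is invertible, because `s_1` is the empty diagram and contains a factor `√2`. -/
theorem rho_cancel {a b : Eff K} (h : rho K * a = rho K * b) : a = b := by
  -- The red state `-1` in `s_1` is the red phase `-1` of the red state `1`, which has a factor `√2`
  -- by the zero rule.
  have e : ∃ r : Eff K, rho K * r = 1 := by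
    refine ⟨sm (sm (ph 0 nw * rph (-1) nw nw↟ * ph (1 / ((Real.sqrt 2 : ℝ) : ℂ)) nw↟)), ?_⟩
    have h₂ := rel_congr (.rule .Ept) (t0 : Tup K 0) t0
    rw [rel_empty, rel_scalar] at h₂
    rw [← h₂, mul_sm]
    refine congrArg sm ?_
    rw [← rst_rph, sm_mul, mul_sm]
    refine congrArg sm ?_
    simp
    rw [← zero_rule]
    grind
  obtain ⟨r, hr⟩ := e
  calc a = r * (rho K * a) := by rw [← mul_assoc, mul_comm r, hr, one_mul]
    _ = r * (rho K * b) := by rw [h]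
    _ = b := by rw [← mul_assoc, mul_comm r, hr, one_mul]

theorem ph_zero_mul (x y : Var K) : ph 0 x * ph 0 y = ph 0 x * eqv x y := by
  have h := b1_rule x y
  rw [← zero_rule, ← zero_rule] at h
  refine rho_cancel (rho_cancel ?_)
  grind

theorem sm_ph_zero : sm (ph 0 nw) = (1 : Eff K) := by
  refine rho_cancel ?_
  rw [mul_one, mul_sm]
  conv_rhs => rw [rho_eq]
  simp [← zero_rule, mul_comm]

/-! ### Functional diagrams -/

/-- A diagram with one output, as a morphism to the wire. -/
def dgw {n : ℕ} (D : ZXDiag n 1) : reg n ⟶ wire := dg D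

/-- A diagram with one output whose graph is single-valued and total maps terms to terms. -/
theorem isComonHom_of_graph {n : ℕ} (D : ZXDiag n 1)
    (h₁ : ∀ (K : Obj) [ComonObj K] [IsCommComonObj K] (x : Tup K n), sm (rel D x.wk (t1 nw)) = 1)
    (h₂ : ∀ (K : Obj) [ComonObj K] [IsCommComonObj K] (x : Tup K n) (y z : Var K),
      rel D x (t1 y) * rel D x (t1 z) = rel D x (t1 y) * eqv y z) :
    IsComonHom (dgw D) where
  hom_counit := by
    have e : ∀ (K : Obj) [ComonObj K] [IsCommComonObj K] (x : Tup K n),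
        rel (D ⨟ Z 1 0 1) x t0 = 1 := by
      intro K _ _ x
      rw [rel_comp1, ← h₁ K x]
      simp [rel_discard]
    have h := e (reg n) (Tup.ofTm ⟨𝟙 _, inferInstance⟩)
    rw [rel_zero, tm_ofTm] at h
    have h' := congrArg Eff.hom h
    exact (Category.id_comp _).symm.trans h'
  hom_comul := by
    have e : ∀ (K : Obj) [ComonObj K] [IsCommComonObj K] (x : Tup K n) (y z : Var K),
        rel (D ⨟ Z 1 2 1) x (t2 y z) = rel D x (t1 y) * rel D x (t1 z) := by
      intro K _ _ x y z
      rw [rel_comp_copy, h₂]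
    obtain ⟨E, hE⟩ := cls_surj (Δ[reg n] ≫ (dg D ⊗ₘ dg D))
    have hE' : dg (n := n) (m := 2) E = Δ[reg n] ≫ (dg D ⊗ₘ dg D) := hE.symm
    have h : Provable (D ⨟ Z 1 2 1) E := by
      refine provable_of_rel fun K _ _ x y => ?_
      obtain ⟨⟨⟨⟩, y⟩, z⟩ := y
      refine (e K x y z).trans (Eq.trans (rel_tens D D x (t1 y) x (t1 z)).symm ?_)
      have h' : x.tm.hom ≫ dg (n := n) (m := 2) E = (x.append x).tm.hom ≫ dg (D ⊠ D) := by
        have a : x.tm.hom ≫ Δ[reg n] ≫ (dg D ⊗ₘ dg D) =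
            pair x.tm.hom x.tm.hom ≫ (dg D ⊗ₘ dg D) := by
          rw [← Category.assoc, IsComonHom.hom_comul x.tm.hom, Category.assoc, pair,
            Category.assoc]
        rw [tm_append]
        exact (congrArg (x.tm.hom ≫ ·) hE').trans a
      simp only [rel, graph, h']
      rfl
    exact (cls_eq.2 h).trans hE'

/-- The term that a functional diagram makes of terms. -/
def app {n : ℕ} (D : ZXDiag n 1) (hD : IsComonHom (dgw D)) (x : Tup K n) : Var K :=
  ⟨x.tm.hom ≫ dgw D, inferInstance⟩

theorem det_app {n : ℕ} (D : ZXDiag n 1) (hD : IsComonHom (dgw D)) (x : Tup K n) :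
    Det D x (t1 (app D hD x)) := by
  unfold Det
  rw [tm_t1]; rfl

theorem app_sub {n : ℕ} (D : ZXDiag n 1) (hD : IsComonHom (dgw D)) (x : Tup K n)
    (s : L ⟶ K) [IsComonHom s] : (app D hD x).sub s = app D hD (x.sub s) := by
  ext
  simp only [app, Tm.sub, tm_sub]
  exact (Category.assoc _ _ _).symm

theorem rel_app {n : ℕ} (D : ZXDiag n 1) (hD : IsComonHom (dgw D)) (x : Tup K n) (y : Var K) :
    rel D x (t1 y) = eqv (app D hD x) y := by
  rw [rel_det (det_app D hD x)]
  simp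

/-! ### Phases and the constant `0` -/

theorem ph_mul (a b : ℂ) (x : Var K) : ph a x * ph b x = ph (a * b) x := by
  have h : Provable (Z 1 1 a ⨟ Z 1 0 b) (Z 1 0 (a * b)) :=
    (Derives.comp_congr (.refl _) (Derives.id_tens _).symm).trans (fuse_below 1 0 0 0 a b)
  exact (rel_phase_comp a (Z 1 0 b) x t0).symm.trans (rel_congr h _ _)

theorem zero_functional : IsComonHom (dgw (Z 0 1 0)) :=
  isComonHom_of_graph _ (fun K _ _ x => by
      obtain ⟨⟩ := x
      exact (congrArg sm (rel_state 0 nw)).trans sm_ph_zero)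
    (fun K _ _ x y z => by
      obtain ⟨⟩ := x
      have e : ∀ y : Var K, rel (Z 0 1 0) t0 (t1 y) = ph 0 y := rel_state 0
      refine (congrArg₂ (· * ·) (e y) (e z)).trans (Eq.trans ?_
        (congrArg (· * eqv y z) (e y)).symm)
      exact ph_zero_mul y z)

/-- The constant `0`, the green state with parameter `0`. -/
instance : Zero (Var K) := ⟨app (Z 0 1 0) zero_functional t0⟩

@[simp] theorem zero_sub' (s : L ⟶ K) [IsComonHom s] : (0 : Var K).sub s = 0 :=
  app_sub _ zero_functional _ s

@[simp] theorem zero_wk : (0 : Var K).wk' Y = 0 := zero_sub' _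

theorem eqv_zero (x : Var K) : eqv x 0 = ph 0 x := by
  rw [← rel_state, eqv_comm]
  exact (rel_app _ zero_functional t0 x).symm

@[simp] theorem ph_zero_right (a : ℂ) : ph a (0 : Var K) = 1 := by
  have h : ph 0 (0 : Var K) = 1 := by rw [← eqv_zero, eqv_self]
  have h₂ := ph_mul 0 a (0 : Var K)
  rwa [zero_mul, h, one_mul] at h₂

theorem sm_ph_zero_mul (f : Eff (K ⊗ wire)) : sm (ph 0 nw * f) = pull (inst 0) f := by
  rw [← sm_eqv_left, zero_wk, eqv_comm, eqv_zero]

theorem ph_zero_mul_congr (x : Var K) (f : Eff (K ⊗ wire)) {g h : Eff K}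
    (hg : pull (inst x) f = g) (hh : pull (inst 0) f = h) : ph 0 x * g = ph 0 x * h := by
  rw [← eqv_zero]; exact eqv_mul_congr x 0 f hg hh

/-! ### The sign pairing -/

/-- The pairing `(-1) ^ (x y)`, a rescaled Hadamard node. -/
def ch (x y : Var K) : Eff K := rho K * hd x y

@[simp] theorem pull_ch (x y : Var K) (s : L ⟶ K) [IsComonHom s] :
    pull s (ch x y) = ch (x.sub s) (y.sub s) := by simp [ch]

theorem ch_comm (x y : Var K) : ch x y = ch y x := by rw [ch, hd_comm]; rfl

@[simp] theorem ch_zero_left (x : Var K) : ch 0 x = 1 := by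
  have h := rst_hd 1 x
  rw [ph_one] at h
  rw [ch, ← h]
  have e := sm_ph_zero_mul (hd nw x↟)
  simp only [pull_hd, fresh_inst, Ctx.wk'_inst] at e
  rw [← e, mul_sm]
  refine congrArg sm ?_
  rw [← zero_rule]; simp; grind

@[simp] theorem ch_zero_right (x : Var K) : ch x 0 = 1 := by rw [ch_comm, ch_zero_left]

/-- The sign pairing separates terms; identities of terms are proved by comparing characters. -/
theorem eq_of_ch {x y : Var K} (h : ch x↟ nw = ch y↟ nw) : x = y := eq_of_hd (rho_cancel h)

theorem sm_hd (x : Var K) : sm (hd x↟ nw) = ph 0 x * rho K := by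
  rw [zero_rule, rst_one_eq, hd_comm]

theorem sm_ch (x : Var K) : sm (ch x↟ nw) = rho K * rho K * ph 0 x := by
  have h := mul_sm (rho K) (hd x↟ nw)
  rw [sm_hd, pull_rho] at h
  rw [ch, ← h]; grind

theorem sm_ch_ch (x y : Var K) : sm (ch x↟ nw * ch nw y↟) = rho K * rho K * eqv x y := by
  rw [← hd_hd, mul_sm]
  refine congrArg sm ?_
  simp [ch]; grind

/-! ### Addition modulo two -/

/-- The red spider with two inputs and one output, rescaled to be functional. -/
def xorD : ZXDiag 2 1 := X 2 1 1 ⊠ sqrtTwo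

theorem rel_xorD (x y z : Var K) : rel xorD (t2 x y) (t1 z) = rsp x y z * rho K := by
  rw [← rel_rsp]; exact rel_tens_scalar (X 2 1 1) sqrtTwo (t2 x y) (t1 z)

theorem rsp_functional : IsComonHom (dgw xorD) := by
  refine isComonHom_of_graph _ (fun K _ _ x => ?_) (fun K _ _ x u v => ?_)
  · obtain ⟨⟨⟨⟩, x⟩, y⟩ := x
    refine Eq.trans (congrArg sm (rel_xorD x↟ y↟ nw)) ?_
    have e : sm (rsp x↟ y↟ nw) = sm (ph 0 nw * (hd x↟ nw * hd y↟ nw * rho _)) := by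
      rw [rsp, sm_comm' _ (g := (hd x↟↟ nw↟ * hd y↟↟ nw↟) * hd nw↟ nw) (by simp)]
      refine congrArg sm ?_
      have h := mul_sm (hd x↟ nw * hd y↟ nw) (hd nw↟ nw)
      simp only [map_mul, pull_hd, sub_fst] at h
      rw [← h, sm_hd]; grind
    have h₂ := mul_sm (rho K) (rsp x↟ y↟ nw)
    rw [e, sm_ph_zero_mul, pull_rho, mul_comm] at h₂
    rw [mul_comm, ← h₂]
    simp
    have hx := ch_zero_right x
    have hy := ch_zero_right y
    rw [ch] at hx hy
    grind
  · obtain ⟨⟨⟨⟩, x⟩, y⟩ := x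
    refine (congrArg₂ (· * ·) (rel_xorD x y u) (rel_xorD x y v)).trans (Eq.trans ?_
        (congrArg (· * eqv u v) (rel_xorD x y u)).symm)
    have := b2_rule x y u v
    grind

/-- Addition modulo two of terms, computed by the red spider. -/
instance : Add (Var K) := ⟨fun x y => app xorD rsp_functional (t2 x y)⟩

@[simp] theorem add_sub' (x y : Var K) (s : L ⟶ K) [IsComonHom s] :
    (x + y).sub s = x.sub s + y.sub s := app_sub _ rsp_functional _ s

@[simp] theorem add_wk (x y : Var K) : (x + y).wk' Y = x.wk' Y + y.wk' Y := add_sub' x y _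

theorem eqv_add (x y z : Var K) : eqv (x + y) z = rsp x y z * rho K := by
  rw [← rel_xorD]; exact (rel_app _ rsp_functional (t2 x y) z).symm

theorem ch_add (x y w : Var K) : ch (x + y) w = ch x w * ch y w := by
  have h := sm_assoc (hd x↟ nw * hd y↟ nw) (hd nw w↟) (hd nw↟ nw)
  have e₀ := sm_eqv_left (x + y) (hd nw w↟)
  have e₁ : sm (eqv (x + y)↟ nw * hd nw w↟) = rho K * sm (rsp x↟ y↟ nw * hd nw w↟) := by
    rw [mul_sm]; refine congrArg sm ?_
    rw [add_wk, eqv_add]; simp; grind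
  simp only [map_mul, pull_hd, xch_fst, xch_snd, fresh_whiskerRight, Ctx.wk'_whiskerRight, sub_fst,
    hd_hd, sm_eqv_right, Ctx.wk'_inst, fresh_inst] at h e₀
  rw [ch, ← e₀, e₁]
  unfold rsp
  rw [← h]
  simp [ch]; grind

instance : AddCommMonoid (Var K) where
  add_assoc x y z := eq_of_ch (by simp [ch_add, mul_assoc])
  zero_add x := eq_of_ch (by simp [ch_add])
  add_zero x := eq_of_ch (by simp [ch_add])
  add_comm x y := eq_of_ch (by simp [ch_add, mul_comm])
  nsmul := nsmulRec

theorem ph_zero_add (x y : Var K) : ph 0 (x + y) = eqv x y := by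
  rw [← eqv_zero, eqv_add, rsp, ← hd_hd, mul_comm, mul_sm]
  refine congrArg sm ?_
  have := ch_zero_right (nw : Var (K ⊗ wire))
  rw [ch] at this
  simp
  rw [hd_comm nw y↟]
  grind

@[simp] theorem add_self (x : Var K) : x + x = 0 := eq_of_eqv (by
  rw [eqv_zero, ph_zero_add, eqv_self])

@[simp] theorem add_add_self (x y : Var K) : x + (x + y) = y := by
  rw [← add_assoc, add_self, zero_add]

theorem eqv_add_left (x y z : Var K) : eqv (x + y) z = eqv y (x + z) := by
  rw [← ph_zero_add, ← ph_zero_add, add_left_comm, add_assoc]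

theorem ch_mul_self (x y : Var K) : ch x y * ch x y = 1 := by
  rw [← ch_add, add_self, ch_zero_left]

/-! ### Phases as quadratic functions, and the constant `1` -/

/-- Addition of a fixed term to the last variable. -/
def shift (x : Var K) : K ⊗ wire ⟶ K ⊗ wire := inst (x↟ + nw) ≫ fst K wire ▷ wire

instance (x : Var K) : IsComonHom (shift x) := by unfold shift; infer_instance

@[simp] theorem wk_shift (x y : Var K) : (y↟).sub (shift x) = y↟ := by
  unfold shift; rw [← Tm.sub_sub]; simp

@[simp] theorem fresh_shift (x : Var K) : (nw).sub (shift x) = x↟ + nw := by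
  unfold shift; rw [← Tm.sub_sub]; simp

/-- A sum does not change when its variable is shifted. -/
theorem sm_shift (x : Var K) (f : Eff (K ⊗ wire)) {g : Eff (K ⊗ wire)}
    (h : pull (shift x) f = g) : sm f = sm g := by
  have e₂ : xch K ≫ fst (K ⊗ wire) wire = fst K wire ▷ wire := by
    have e : fst K wire ▷ wire = pair (fst (K ⊗ wire) wire ≫ fst K wire) (snd (K ⊗ wire) wire) := by
      rw [← pair_whiskerRight, pair_fst_snd, Category.id_comp]
    rw [e, xch, pair_fst]
  have h₁ : sm f = sm (sm (pull (fst (K ⊗ wire) wire) f * eqv (x↟ + nw)↟ nw)) := by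
    congr 1
    rw [← mul_sm, sm_eqv, mul_one]
  rw [h₁, sm_comm' _ rfl]
  congr 1
  rw [map_mul, pull_pull, pull_congr e₂]
  have h₂ : pull (xch K) (eqv (x↟ + nw)↟ nw) = eqv nw (x↟ + nw)↟ := by
    rw [eqv_comm nw]; simp only [pull_eqv, add_wk, add_sub', xch_old, xch_fst, xch_snd]
    rw [eqv_add_left]; exact eqv_comm _ _
  rw [h₂, sm_eqv_right, pull_pull, ← h]
  rfl

/-- The Fourier transform `∑ n, (-1) ^ (x n) a ^ n` of a phase. -/
def fou (a : ℂ) (x : Var K) : Eff K := sm (ch x↟ nw * ph a nw)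

@[simp] theorem pull_fou (a : ℂ) (x : Var K) (s : L ⟶ K) [IsComonHom s] :
    pull s (fou a x) = fou a (x.sub s) := by simp [fou]

theorem rph_eq_fou (a : ℂ) (x y : Var K) : rho K * (rho K * rph a x y) = fou a (x + y) := by
  rw [rph, mul_sm, mul_sm, fou]
  refine congrArg sm ?_
  have h := ch_add x↟ y↟ nw
  unfold ch at h
  simp [ch]
  rw [hd_comm nw]; grind

theorem ph_neg_I_mul (x : Var K) : ph (-Complex.I) x * ph Complex.I x = 1 := by
  rw [ph_mul]; simp [ph_one]

/-- The phase `-i` is a quadratic function of its variable, whose polarization is the sign pairing.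
This is the Euler decomposition: it expresses `ch x y` through `x`, `y` and `x + y`. -/
theorem ph_neg_I_add (x y : Var K) :
    ph (-Complex.I) (x + y) = ph (-Complex.I) x * ph (-Complex.I) y * ch x y := by
  -- The left side depends on `x + y` only, so that the right side is the same at `x + y` and `0`.
  have h : ∃ s : Eff K, ∀ x y : Var K, fou Complex.I (x + y) * s =
      rho K * ch x y * ph (-Complex.I) x * ph (-Complex.I) y := by
    refine ⟨rel (scalar (Complex.exp (-(Real.pi / 4 * Complex.I)))) t0 t0, fun x y => ?_⟩
    rw [← rph_eq_fou, ch, eu_pos_rule]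
    have h₁ := ph_neg_I_mul x
    have h₂ := ph_neg_I_mul y
    grind
  obtain ⟨s, h⟩ := h
  have h₁ := h (x + y) 0
  have h₂ := h x y
  simp at h₁
  refine rho_cancel ?_
  grind

theorem ph_neg_one_add (x y : Var K) : ph (-1) (x + y) = ph (-1) x * ph (-1) y := by
  have h : ∀ x : Var K, ph (-1) x = ph (-Complex.I) x * ph (-Complex.I) x := by
    intro x; rw [ph_mul]; simp
  rw [h, h, h, ph_neg_I_add]
  have := ch_mul_self x y
  grind

theorem ph_I_add (x y : Var K) :
    ph Complex.I (x + y) = ph Complex.I x * ph Complex.I y * ch x y := by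
  have h : ∀ x : Var K, ph Complex.I x = ph (-1) x * ph (-Complex.I) x := by
    intro x; rw [ph_mul]; simp
  rw [h, h, h, ph_neg_I_add, ph_neg_one_add]
  grind

theorem ph_neg_one_mul_self (x : Var K) : ph (-1) x * ph (-1) x = 1 := by
  rw [ph_mul]; simp [ph_one]

theorem sm_fou (a : ℂ) : sm (fou a nw) = rho K * rho K := by
  unfold fou
  rw [sm_comm' _ (g := ch nw nw↟ * ph a nw↟) (by simp)]
  have h₁ : sm (sm (ch nw nw↟ * ph a nw↟)) = sm (ph 0 nw * (rho (K ⊗ wire) * rho _ * ph a nw)) := by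
    congr 1
    have h := sm_ch (nw : Var (K ⊗ wire))
    have := mul_sm (ph a nw) (ch (nw : Var (K ⊗ wire))↟ nw)
    rw [h] at this
    rw [ch_comm]
    simp at this
    grind
  rw [h₁, sm_ph_zero_mul]
  simp

theorem fou_mul (x y : Var K) :
    fou (-1) x * fou (-1) y = rho K * rho K * (fou (-1) x * eqv x y) := by
  have h : fou (-1) x * fou (-1) y = sm (ch (x + y)↟ nw) * fou (-1) y := by
    have e : fou (-1) x = sm (ch x↟ nw * ph (-1) nw) := rfl
    rw [e, sm_mul, sm_mul]
    refine congrArg sm ?_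
    simp only [pull_fou, sub_fst, add_wk]
    rw [fou, mul_sm, mul_sm]
    refine sm_shift nw _ ?_
    have := ph_neg_one_mul_self (nw↟ : Var ((K ⊗ wire) ⊗ wire))
    have := ch_add x↟↟ y↟↟ nw↟
    have := ch_add nw↟ nw y↟↟
    have := ch_comm nw↟ y↟↟
    have := ch_comm nw y↟↟
    simp [ph_neg_one_add, ch_comm _ (nw↟ + nw)]
    grind
  have h₂ := eqv_mul_congr x y (fou (-1) nw) (g := fou (-1) x) (h := fou (-1) y) (by simp) (by simp)
  rw [h, sm_ch, ph_zero_add]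
  grind

theorem one_functional : IsComonHom (dgw (Z 0 1 0 ⨟ X 1 1 (-1))) := by
  have e : ∀ (K : Obj) [ComonObj K] [IsCommComonObj K] (y : Var K),
      rho K * rho K * rel (Z 0 1 0 ⨟ X 1 1 (-1)) t0 (t1 y) = fou (-1) y := by
    intro K _ _ y
    rw [rel_comp1]
    have h : sm (rel (Z 0 1 0) (t0 : Tup K 0).wk (t1 nw) * rel (X 1 1 (-1)) (t1 nw) (t1 y).wk) =
        rph (-1) 0 y := by
      have := sm_ph_zero_mul (rph (-1) nw y↟)
      simp at this
      rw [← this]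
      simp [rel_rph, rel_state]
    rw [h, mul_assoc, rph_eq_fou, zero_add]
  refine isComonHom_of_graph _ (fun K _ _ x => ?_) (fun K _ _ x u v => ?_)
  · obtain ⟨⟩ := x
    refine rho_cancel (rho_cancel ?_)
    rw [mul_one, ← sm_fou (-1), mul_sm, mul_sm]
    refine congrArg sm ?_
    rw [← e, mul_assoc, pull_rho]; rfl
  · obtain ⟨⟩ := x
    have h := fou_mul u v
    rw [← e, ← e] at h
    refine rho_cancel (rho_cancel (rho_cancel (rho_cancel ?_)))
    change rho K * (rho K * (rho K * (rho K * (rel (Z 0 1 0 ⨟ X 1 1 (-1)) t0 (t1 u) *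
        rel (Z 0 1 0 ⨟ X 1 1 (-1)) t0 (t1 v))))) =
      rho K * (rho K * (rho K * (rho K * (rel (Z 0 1 0 ⨟ X 1 1 (-1)) t0 (t1 u) * eqv u v))))
    grind

/-- The constant `1`, the red phase `-1` of the constant `0`. -/
instance : One (Var K) := ⟨app (Z 0 1 0 ⨟ X 1 1 (-1)) one_functional t0⟩

@[simp] theorem one_sub' (s : L ⟶ K) [IsComonHom s] : (1 : Var K).sub s = 1 :=
  app_sub _ one_functional _ s

@[simp] theorem one_wk : (1 : Var K).wk' Y = 1 := one_sub' _

theorem eqv_one_add (x y : Var K) : eqv (1 + x) y = rph (-1) x y := by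
  have h : ∀ y : Var K, eqv 1 y = rph (-1) 0 y := by
    intro y
    have := sm_ph_zero_mul (rph (-1) nw y↟)
    simp at this
    rw [← this]
    refine (rel_app _ one_functional t0 y).symm.trans ((rel_comp1 _ _ _ _).trans ?_)
    simp [rel_rph, rel_state]
  rw [add_comm, eqv_add_left, h]
  refine rho_cancel (rho_cancel ?_)
  rw [rph_eq_fou, rph_eq_fou, zero_add]

/-- The character of `1` is the sign. -/
theorem ch_one (z : Var K) : ch 1 z = ph (-1) z := by
  have h := sm_assoc (ph (-1) nw) (ch nw z↟) (ch nw↟ nw)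
  have e := sm_eqv_left 1 (ch nw z↟)
  have h₁ : ∀ y : Var (K ⊗ wire), fou (-1) y = rho _ * rho _ * eqv 1 y := by
    intro y
    have h := eqv_one_add 0 y
    rw [add_zero] at h
    rw [h, mul_assoc, rph_eq_fou, zero_add]
  have h₂ : sm (ph (-1) nw * (rho (K ⊗ wire) * rho (K ⊗ wire) * eqv nw z↟)) =
      rho K * rho K * ph (-1) z := by
    have h := mul_sm (rho K * rho K) (ph (-1) nw * eqv nw z↟)
    rw [sm_eqv_right] at h
    simp at h
    rw [h]
    congr 1; grind
  have h₃ : fou (-1) (nw : Var (K ⊗ wire)) = sm (ph (-1) nw * ch nw nw↟) := by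
    rw [fou]; congr 1; rw [mul_comm, ch_comm]
  simp [sm_ch_ch] at h
  rw [h₂, ← h₃, h₁] at h
  simp at e
  refine rho_cancel (rho_cancel ?_)
  rw [← mul_assoc, ← mul_assoc, h, ← e, mul_sm]
  congr 1
  simp; grind

/-- The red phase `-1` is the negation. -/
theorem rph_neg_one (x y : Var K) : rph (-1) x y = eqv (1 + x) y := (eqv_one_add x y).symm

/-! ### Scalars -/

theorem rst_neg_one (x : Var K) : rst (-1) x = rho K * eqv 1 x := by
  have h : eqv (1 : Var K) x = rph (-1) 0 x := by
    have := eqv_one_add 0 x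
    rwa [add_zero] at this
  rw [h]
  refine rho_cancel ?_
  rw [rph_eq_fou, zero_add, fou, rst, mul_sm]
  congr 1
  simp [ch]; rw [hd_comm x↟]; grind

/-- Scalars are phases of the constant `1`. -/
theorem rho_eq_ph : rho K = ph ((Real.sqrt 2 : ℝ) : ℂ) 1 := by
  have h := rel_congr (.rule .Ept) (t0 : Tup K 0) t0
  have hs : ((Real.sqrt 2 : ℝ) : ℂ) ≠ 0 := by simp
  rw [rel_empty, rel_scalar] at h
  have e : sm (rst (-1) nw * ph (1 / ((Real.sqrt 2 : ℝ) : ℂ)) nw) =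
      rho K * ph (1 / ((Real.sqrt 2 : ℝ) : ℂ)) 1 := by
    have e := sm_eqv_left (1 : Var K) (rho _ * ph (1 / ((Real.sqrt 2 : ℝ) : ℂ)) nw)
    simp at e
    simp only [one_div]
    rw [← e]
    congr 1
    rw [rst_neg_one]; grind
  rw [e] at h
  have h₂ := ph_mul (1 / ((Real.sqrt 2 : ℝ) : ℂ)) ((Real.sqrt 2 : ℝ) : ℂ) (1 : Var K)
  rw [one_div, inv_mul_cancel₀ hs, ph_one, ← one_div] at h₂
  grind

theorem rho_mul_rho : rho K * rho K = ph 2 1 := by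
  rw [rho_eq_ph, ph_mul, ← Complex.ofReal_mul, Real.mul_self_sqrt (by norm_num)]
  norm_num

/-- Equal multiples by a non-zero scalar are multiples of equal effects. -/
theorem ph_cancel {c : ℂ} (hc : c ≠ 0) {x : Var K} {f g : Eff K} (h : ph c x * f = ph c x * g) :
    f = g := by
  have h₂ := ph_mul c⁻¹ c x
  rw [inv_mul_cancel₀ hc, ph_one] at h₂
  calc f = ph c⁻¹ x * (ph c x * f) := by rw [← mul_assoc, h₂, one_mul]
    _ = ph c⁻¹ x * (ph c x * g) := by rw [h]
    _ = g := by rw [← mul_assoc, h₂, one_mul]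

/-! ### The triangle as an order -/

@[simp] theorem tri_zero_left (y : Var K) : tri 0 y = ph 0 y := by
  have h := bas0_rule y
  have e := sm_ph_zero_mul (rho _ * tri nw y↟)
  simp at e
  refine rho_cancel ?_
  rw [mul_comm _ (ph 0 y), zero_rule, ← h, ← e]
  congr 1
  rw [← zero_rule]; grind

@[simp] theorem tri_one_left (y : Var K) : tri 1 y = 1 := by
  have h := bas1_rule y
  have e := sm_eqv_left 1 (rho _ * tri nw y↟)
  simp at e
  refine rho_cancel ?_
  rw [mul_one, ← e, ← h]
  congr 1
  rw [rst_neg_one]; grind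

@[simp] theorem tri_zero_right (x : Var K) : tri x 0 = 1 := by
  have h := suc_rule 0 x
  have e := sm_ph_zero_mul (tri x↟ nw)
  simp at e
  rw [zero_add, ph_one] at h
  rw [← h, ← e]
  congr 1; rw [mul_comm]

theorem wE_eq (x y z : Var K) : rho K * wE x y z = tri x y * eqv (x + y) z := by
  rw [add_comm, eqv_add, wE]; grind

/-- The symmetry of W: if `y ≤ x` then `x + y ≤ x`. -/
theorem tri_symm (x y : Var K) : tri x (x + y) = tri x y := by
  have h := sym_rule x y (x + y)
  have h₁ := wE_eq x y (x + y)
  have h₂ := wE_eq x (x + y) y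
  rw [add_add_self, eqv_self, mul_one] at h₂
  rw [eqv_self, mul_one] at h₁
  rw [← h₁, ← h₂, h]

/-- Phases are multiplicative on disjoint sums, here `x = y + (x + y)` with `y ≤ x`. -/
theorem tri_ph (a : ℂ) (x y : Var K) : tri x y * ph a x = tri x y * ph a y * ph a (x + y) := by
  have h := pcy_rule a x y (x + y)
  have h₁ := wE_eq x y (x + y)
  rw [eqv_self, mul_one] at h₁
  rw [← h₁]; grind

theorem eqv_mul_self (x y : Var K) : eqv x y * eqv x y = eqv x y := by
  rw [← ph_zero_add, ph_mul, zero_mul]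

/-- The associativity of W, after its inner variable is eliminated. -/
theorem tri_assoc (x a b : Var K) : tri x (a + b) * tri (a + b) a = tri x a * tri (x + a) b := by
  have h := aso_rule x a b (x + a + b)
  have e₁ := sm_eqv_left (a + b) (tri x↟ nw * tri nw a↟)
  have e₂ := sm_eqv_left (x + a) (tri x↟ a↟ * tri nw b↟)
  simp at e₁ e₂
  have h₁ : rho K * (rho K * sm (wE x↟ nw (x + a + b)↟ * wE nw a↟ b↟)) =
      tri x (a + b) * tri (a + b) a := by
    rw [← e₁, mul_sm, mul_sm]
    congr 1
    have q₁ := wE_eq x↟ nw (x + a + b)↟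
    have q₂ := wE_eq nw a↟ b↟
    have q₃ : eqv (x↟ + nw) (x + a + b)↟ = eqv (a↟ + b↟) nw := by
      simp only [← ph_zero_add, add_wk]
      simp only [add_assoc, add_comm, add_left_comm, add_add_self]
    have q₄ : eqv (nw + a↟) b↟ = eqv (a↟ + b↟) nw := by
      simp only [← ph_zero_add]
      simp only [add_comm, add_assoc]
    have := eqv_mul_self (a↟ + b↟) nw
    rw [pull_rho]
    grind
  have h₂ : rho K * (rho K * sm (wE x↟ a↟ nw * wE nw b↟ (x + a + b)↟)) =
      tri x a * tri (x + a) b := by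
    rw [← e₂, mul_sm, mul_sm]
    congr 1
    have q₁ := wE_eq x↟ a↟ nw
    have q₂ := wE_eq nw b↟ (x + a + b)↟
    have q₃ : eqv (nw + b↟) (x + a + b)↟ = eqv (x↟ + a↟) nw := by
      simp only [← ph_zero_add, add_wk]
      simp only [add_assoc, add_comm, add_left_comm, add_self, add_zero]
    have := eqv_mul_self (x↟ + a↟) nw
    rw [pull_rho]
    grind
  rw [← h₁, ← h₂, h]

theorem tri_add_left (a b : Var K) : tri (a + b) a = tri (1 + a) b := by
  have h := tri_assoc 1 a b
  simpa using h

/-- Disjointness `b ≤ 1 + a` is a symmetric relation. -/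
theorem tri_compl_comm (a b : Var K) : tri (1 + a) b = tri (1 + b) a := by
  rw [← tri_add_left, ← tri_add_left, ← tri_symm, add_comm b a]
  congr 1
  rw [add_assoc, add_comm b a, add_add_self]

/-- Contraposition. -/
theorem tri_contra (x y : Var K) : tri x y = tri (1 + y) (1 + x) := by
  have h := tri_compl_comm (1 + x) y
  rwa [add_add_self] at h

/-- A chain `y ≤ p ≤ x` is the same as `y ≤ x` and `y + p ≤ x + y`. -/
theorem tri_mul_tri (x p y : Var K) : tri x p * tri p y = tri x y * tri (x + y) (y + p) := by
  have h := tri_assoc x y (y + p)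
  rwa [add_add_self] at h

theorem tri_self (x : Var K) : tri x x = 1 := by
  rw [← tri_symm, add_self, tri_zero_right]

theorem tri_mul_tri_compl (x y : Var K) : tri x y * tri (1 + x) y = ph 0 y := by
  have h := tri_assoc x y y
  rw [add_self, tri_zero_right, tri_zero_left, one_mul] at h
  rw [tri_compl_comm, ← tri_add_left, add_comm y, h]

/-! ### Powers of the triangle -/

/-- The sum over all `n ≤ y` of `d ^ n * c ^ (y - n)` is `(c + d) ^ y`. -/
theorem sm_tri_ph_ph (c d : ℂ) (y : Var K) :
    sm (tri y↟ nw * ph d nw * ph c (y↟ + nw)) = ph (c + d) y := by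
  by_cases hc : c = 0
  · subst hc
    rw [zero_add]
    refine sm_elim y (tri y↟ nw * ph d nw) ?_ (by simp [tri_self])
    rw [ph_zero_add]; grind
  · have h := suc_rule (d / c) y
    have e : c * (d / c + 1) = c + d := by field_simp; ring
    rw [← e, ← ph_mul, ← h, mul_sm]
    congr 1
    have h₁ := tri_ph c y↟ nw
    have h₂ := ph_mul (c⁻¹ * d) c (nw : Var (K ⊗ wire))
    have e₂ : c⁻¹ * d * c = d := by field_simp
    have e₃ : c⁻¹ * d = d / c := by field_simp
    rw [e₂, e₃] at h₂
    rw [← h₂]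
    simp
    grind

/-- The triangle to the power `c`: its matrix has the rows `1, c` and `0, 1`. -/
def tripow (c : ℂ) (x y : Var K) : Eff K := tri x y * ph c (x + y)

@[simp] theorem pull_tripow (c : ℂ) (x y : Var K) (s : L ⟶ K) [IsComonHom s] :
    pull s (tripow c x y) = tripow c (x.sub s) (y.sub s) := by simp [tripow]

theorem tripow_zero (x y : Var K) : tripow 0 x y = eqv x y := by
  have h := eqv_mul_congr x y (tri nw y↟) (g := tri x y) (h := tri y y) (by simp) (by simp)
  rw [tripow, ph_zero_add, mul_comm, h, tri_self, mul_one]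

theorem tripow_one (x y : Var K) : tripow 1 x y = tri x y := by rw [tripow, ph_one, mul_one]

theorem tripow_comp (c d : ℂ) (x y : Var K) :
    sm (tripow c x↟ nw * tripow d nw y↟) = tripow (c + d) x y := by
  rw [show tripow (c + d) x y = tri x y * ph (c + d) (x + y) from rfl, ← sm_tri_ph_ph, mul_sm]
  refine sm_shift y _ ?_
  have h := tri_mul_tri x↟ (y↟ + nw) y↟
  rw [add_add_self] at h
  have e : y↟ + nw + y↟ = nw := by rw [add_comm, add_add_self]
  simp only [tripow, map_mul, pull_tri, pull_ph, add_sub', wk_shift, fresh_shift, e, sub_fst,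
    add_wk]
  rw [← add_assoc]
  grind

theorem trinv_eq (x y : Var K) : trinv x y = tripow (-1) x y := by
  have h := sm_assoc (trinv x↟ nw) (tripow (-1) nw y↟) (tri nw↟ nw)
  simp [inv_right_rule] at h
  have e : sm (tri (nw : Var (K ⊗ wire))↟ nw * tripow (-1) nw y↟↟) = eqv nw y↟ := by
    rw [← tripow_zero, ← neg_add_cancel (1 : ℂ), add_comm, ← tripow_comp]
    simp [tripow_one]
  rw [e, sm_eqv_right, sm_eqv_left] at h
  simpa using h

theorem sm_tri_tri (x y : Var K) : sm (tri x↟ nw * tri nw y↟) = tripow 2 x y := by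
  have h := tripow_comp 1 1 x y
  norm_num at h
  simpa [tripow_one] using h

theorem sm_trinv_ph (a : ℂ) (x : Var K) : sm (trinv x↟ nw * ph a nw) = ph (a - 1) x := by
  rw [sub_eq_add_neg, add_comm, ← sm_tri_ph_ph]
  congr 1
  rw [trinv_eq, tripow]; grind

/-! ### The conjunction -/

/-- Complementing one input of a conjunction adds the other input to its value. -/
theorem andE_brk (x y z : Var K) : andE x (1 + y) z = andE x y (x + z) := by
  have h := brk_rule x y z
  have e₁ := sm_eqv_left (1 + y) (andE x↟ nw z↟)
  have e₂ := sm_eqv_right (x + z) (andE x↟ y↟ nw)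
  simp at e₁ e₂
  rw [← e₁, ← e₂]
  simp only [rph_neg_one] at h
  rw [h, sm_mul]
  congr 1
  rw [mul_assoc, pull_rho, ← eqv_add, eqv_add_left, eqv_comm]

/-- The elements below a conjunction are those below both of its inputs. -/
theorem sm_andE_tri (x y w : Var K) : sm (andE x↟ y↟ nw * tri nw w↟) = tri x w * tri y w := by
  have h := sm_assoc (tri x↟ nw * tri y↟ nw) (tri nw w↟) (trinv nw↟ nw)
  simp [inv_right_rule, sm_eqv_right] at h
  exact h.symm

/-- The sum of the signs of all `z` below both `b` and `w` vanishes unless `b` and `w` are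
disjoint. -/
theorem sm_tri_sign_tri (b w : Var K) :
    sm (tri w↟ nw * ph (-1) nw * tri b↟ nw) = tri (1 + b) w := by
  -- The inverse triangle in the AND gate turns the phase `-1` into `-2`.
  have e : ∀ {K : Obj} [ComonObj K] [IsCommComonObj K] (x y : Var K),
      sm (andE x↟ y↟ nw * ph (-1) nw) = sm (tri x↟ nw * tri y↟ nw * ph (-2) nw) := by
    intro K _ _ x y
    have h := sm_assoc (tri x↟ nw * tri y↟ nw) (ph (-1) nw) (trinv nw↟ nw)
    have e : (-1 : ℂ) - 1 = -2 := by norm_num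
    simp [sm_trinv_ph, e] at h
    exact h.symm
  -- The sign of a conjunction is multiplied by the sign of `x` when `y` is complemented.
  have e₂ : ∀ {K : Obj} [ComonObj K] [IsCommComonObj K] (x y : Var K),
      sm (tri x↟ nw * tri (1 + y)↟ nw * ph (-2) nw) =
        ph (-1) x * sm (tri x↟ nw * tri y↟ nw * ph (-2) nw) := by
    intro K _ _ x y
    rw [← e, ← e, mul_sm]
    refine sm_shift x _ ?_
    simp [andE_brk, ph_neg_one_add]
    grind
  have e₃ : ∀ z : Var (K ⊗ wire), ph (-2) z = ph 2 z * ph (-1) z := by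
    intro z; rw [ph_mul]; norm_num
  have e₄ : ph (-2) w * ph (-1) w = ph 2 w := by rw [ph_mul]; norm_num
  -- Both sides of `e₂` at `y = 1 + b` are summed over all `x ≤ w`.
  have hA := sm_assoc (tri w↟ nw) (tri b↟ nw * ph (-2) nw) (tri nw↟ nw)
  have hB := sm_assoc (tri w↟ nw * ph (-1) nw) (tri (1 + b)↟ nw * ph (-2) nw) (tri nw↟ nw)
  -- With signs, the triangle is inverse to itself.
  have h₁ : sm (tri w↟↟ nw * ph (-1) nw * tri nw nw↟) = ph (-1) w↟ * eqv w↟ nw := by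
    rw [← tripow_zero, ← neg_add_cancel (1 : ℂ), ← tripow_comp, mul_sm]
    congr 1
    have := ph_neg_one_mul_self w↟↟
    simp [tripow, ph_neg_one_add, ph_one]
    grind
  have h₂ := e₂ (nw : Var (K ⊗ wire)) (1 + b↟)
  rw [add_add_self] at h₂
  have h₃ := sm_eqv_left w (ph (-1) w↟ * (tri (1 + b↟) nw * ph (-2) nw))
  simp [h₁, sm_tri_tri, ← mul_assoc] at hA hB h₂ h₃
  refine ph_cancel (c := 2) (by norm_num) (x := w) ?_
  have h₄ : ph 2 w * sm (tri w↟ nw * ph (-1) nw * tri b↟ nw) =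
      sm (tripow 2 w↟ nw * tri b↟ nw * ph (-2) nw) := by
    rw [mul_sm]
    congr 1
    have := tri_ph 2 w↟ nw
    rw [e₃]
    simp [tripow]
    grind
  have h₅ : tri w↟ nw * ph (-1) nw * sm (tri nw↟ nw * tri (1 + b↟↟) nw * ph (-2) nw) =
      tri w↟ nw * (ph (-1) nw * sm (tri nw↟ nw * tri (1 + b↟↟) nw * ph (-2) nw)) := by grind
  have h₆ : ph (-1) w↟ * eqv w↟ nw * tri (1 + b↟) nw * ph (-2) nw =
      eqv w↟ nw * ph (-1) w↟ * tri (1 + b↟) nw * ph (-2) nw := by grind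
  rw [h₄, ← hA, h₂, ← h₅, hB, h₆, h₃]
  grind

/-- A chain `e ≤ w ≤ a` as an alternating sum over the elements below `e`. It is the rule for
complements in a conjunction, seen from the elements `w` below the conjunction. -/
theorem tri_mul_tri_eq_sm (a w e : Var K) :
    tri a w * tri w e = tri a e * sm (tri e↟ nw * ph (-1) nw * tri (a↟ + nw) w↟) := by
  have h₁ : ∀ {K : Obj} [ComonObj K] [IsCommComonObj K] (a b w : Var K),
      tri a w * tri (1 + b) w =
        sm (tri b↟ nw * tri a↟ nw * sm (trinv nw↟ nw * tri (a↟↟ + nw) w↟↟)) := by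
    intro K _ _ a b w
    rw [mul_comm (tri b↟ nw)]
    have h := sm_assoc (tri a↟ nw * tri b↟ nw) (tri (a↟ + nw) w↟) (trinv nw↟ nw)
    simp at h
    rw [h, ← sm_andE_tri]
    refine sm_shift a _ ?_
    simp [andE_brk]
    rfl
  have h := sm_assoc (trinv e↟ nw) (tri a↟ nw * sm (trinv nw↟ nw * tri (a↟↟ + nw) w↟↟)) (tri nw↟ nw)
  have h₂ : sm (trinv e↟ nw * tri (1 + nw) w↟) = ph (-1) e * tri w e := by
    have h := sm_tri_sign_tri (1 + w) e
    rw [add_add_self] at h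
    rw [← h, mul_sm]
    congr 1
    have := tri_compl_comm nw w↟
    simp [trinv_eq, tripow, ph_neg_one_add]
    grind
  have h₃ : sm (trinv e↟ nw * tri (a↟ + nw) w↟) =
      ph (-1) e * sm (tri e↟ nw * ph (-1) nw * tri (a↟ + nw) w↟) := by
    rw [mul_sm]
    congr 1
    simp [trinv_eq, tripow, ph_neg_one_add]
    grind
  have h₄ := sm_eqv_left e (tri a↟ nw * sm (trinv nw↟ nw * tri (a↟↟ + nw) w↟↟))
  have h₅ := h₁ a↟ nw w↟
  simp [inv_right_rule, ← mul_assoc] at h h₄ h₅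
  have h₆ : sm (trinv e↟ nw * (tri a↟ w↟ * tri (1 + nw) w↟)) = tri a w * (ph (-1) e * tri w e) := by
    rw [← h₂, mul_sm]
    congr 1
    simp; grind
  rw [← h₅, h₆, h₄, h₃] at h
  have := ph_neg_one_mul_self e
  grind

/-- Möbius inversion: the sum of the signs of `x + z` over all `z ≤ x` above both `u` and `w`. -/
theorem sm_tri_sign_tri_tri (x u w : Var K) :
    sm (tri x↟ nw * ph (-1) (x↟ + nw) * tri nw u↟ * tri nw w↟) = tri x w * tri w (x + u) := by
  have h := tri_mul_tri_eq_sm x w (x + u)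
  rw [h, mul_sm]
  symm
  refine sm_shift x _ ?_
  have e := tri_mul_tri x↟ (x↟ + u↟) (x↟ + nw)
  have e₂ : x↟ + nw + (x↟ + u↟) = nw + u↟ := by
    rw [add_assoc, add_left_comm nw, add_add_self]
  simp only [add_add_self, e₂, tri_symm] at e
  simp [tri_symm]
  grind

/-- The conjunction of `a` and `b` is the `c` with `c ≤ a` and with `b + c` disjoint from `a`. The
right-hand side, unlike `andE`, involves no sum. -/
theorem andE_eq (a b c : Var K) : andE a b c = tri a c * tri (1 + a) (b + c) := by
  have h := sm_tri_sign_tri_tri (1 + c) (1 + b) (1 + a)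
  have e : 1 + c + (1 + b) = b + c := by
    rw [add_assoc, add_left_comm c, add_add_self, add_comm]
  rw [e, ← tri_contra] at h
  rw [← h, andE]
  refine sm_shift 1 _ ?_
  have h₁ := tri_contra a↟ (1 + nw)
  have h₂ := tri_contra b↟ (1 + nw)
  rw [add_add_self] at h₁ h₂
  have h₃ := tri_compl_comm nw c↟
  simp [trinv_eq, tripow]
  have e : (1 + nw + c↟) = (1 + c↟ + nw) := by rw [add_right_comm]
  rw [e]
  grind

/-- The triangle is idempotent under copying of its input and output. -/
theorem tri_mul_self (a w : Var K) : tri a w * tri a w = tri a w := by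
  rw [← sm_andE_tri]
  refine sm_elim a (tri nw w↟) ?_ (by simp)
  rw [andE_eq, ← tri_symm, tri_mul_tri_compl, ph_zero_add]

theorem tri_trans (x p y : Var K) : tri x p * tri p y * tri x y = tri x p * tri p y := by
  have := tri_mul_tri x p y
  have := tri_mul_self x y
  grind

/-- The elements below `a` are closed under addition. -/
theorem tri_add_right (a w z : Var K) : tri a w * tri a z * tri a (w + z) = tri a w * tri a z := by
  have e : ∀ {K : Obj} [ComonObj K] [IsCommComonObj K] (x w z : Var K),
      tri x z * tri z (x + w) * tri x (w + z) = tri x z * tri z (x + w) := by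
    intro K _ _ x w z
    have h₁ := tri_mul_tri x z (x + w)
    have h₂ := tri_trans x w (x + w + z)
    rw [add_assoc x w z] at h₂
    rw [tri_symm, add_add_self] at h₁
    rw [tri_symm, ← add_assoc] at h₂
    grind
  have h : tri a w * tri a z = sm (tri a↟ nw * (tri nw z↟ * tri z↟ (nw + w↟))) := by
    have h₁ := sm_assoc (tri a↟ nw) (tri nw w↟ * tri nw z↟) (tripow (-1) nw↟ nw)
    have h₂ := sm_tri_sign_tri_tri nw w↟ z↟
    have h₃ : sm (tri a↟↟ nw * tripow (-1) nw nw↟) = eqv a↟ nw := by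
      rw [← tripow_zero, ← add_neg_cancel (1 : ℂ), ← tripow_comp]
      simp [tripow_one]
    simp [h₃] at h₁
    rw [sm_eqv_left] at h₁
    simp at h₁
    rw [← h₁, ← h₂]
    congr 3
    simp [tripow]; grind
  rw [h, sm_mul]
  congr 1
  have h₁ := e nw w↟ z↟
  have h₂ := tri_trans a↟ nw (w↟ + z↟)
  simp
  grind

/-! ### The Boolean ring of terms -/

theorem and_functional : IsComonHom (dgw And) := by
  refine isComonHom_of_graph _ (fun K _ _ x => ?_) (fun K _ _ x u v => ?_)
  · obtain ⟨⟨⟨⟩, x⟩, y⟩ := x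
    refine Eq.trans (congrArg sm (rel_and x↟ y↟ nw)) ?_
    have h := sm_andE_tri x y 0
    simpa using h
  · obtain ⟨⟨⟨⟩, x⟩, y⟩ := x
    refine (congrArg₂ (· * ·) (rel_and x y u) (rel_and x y v)).trans (Eq.trans ?_
        (congrArg (· * eqv u v) (rel_and x y u)).symm)
    show andE x y u * andE x y v = andE x y u * eqv u v
    have h := eqv_mul_congr u v (andE x↟ y↟ nw) (g := andE x y u) (h := andE x y v)
      (by simp) (by simp)
    have h₁ := tri_add_right x u v
    have h₂ := tri_add_right (1 + x) (y + u) (y + v)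
    have e : y + u + (y + v) = u + v := by
      rw [add_assoc, add_left_comm u, add_add_self]
    have h₃ := tri_mul_tri_compl x (u + v)
    have h₄ := tri_mul_self x u
    have h₅ := tri_mul_self (1 + x) (y + u)
    rw [e] at h₂
    rw [ph_zero_add] at h₃
    rw [andE_eq, andE_eq] at *
    grind

/-- The conjunction of terms, computed by the AND gate. -/
instance : Mul (Var K) := ⟨fun x y => app And and_functional (t2 x y)⟩

@[simp] theorem mul_sub' (x y : Var K) (s : L ⟶ K) [IsComonHom s] :
    (x * y).sub s = x.sub s * y.sub s := app_sub _ and_functional _ s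

@[simp] theorem mul_wk (x y : Var K) : (x * y).wk' Y = x.wk' Y * y.wk' Y := mul_sub' x y _

theorem eqv_mul_left (x y z : Var K) : eqv (x * y) z = tri x z * tri (1 + x) (y + z) := by
  rw [← andE_eq, ← rel_and]; exact (rel_app _ and_functional (t2 x y) z).symm

theorem tri_mul_left (x y w : Var K) : tri (x * y) w = tri x w * tri y w := by
  rw [← sm_andE_tri]
  have h := sm_eqv_left (x * y) (tri nw w↟)
  simp at h
  rw [← h]
  congr 2
  rw [eqv_mul_left, andE_eq]

theorem tri_antisymm (x y : Var K) : tri x y * tri y x = eqv x y := by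
  rw [tri_mul_tri, tri_self, one_mul, add_self, tri_zero_left, ph_zero_add, eqv_comm]

/-- A term is determined by the elements below it. -/
theorem eq_of_tri {x y : Var K} (h : tri x↟ nw = tri y↟ nw) : x = y := by
  have h₁ := congrArg (pull (inst y)) h
  have h₂ := congrArg (pull (inst x)) h
  simp [tri_self] at h₁ h₂
  refine eq_of_eqv ?_
  rw [← tri_antisymm, h₁, ← h₂, one_mul]

theorem tri_mul_eq_one (x y : Var K) : tri x (x * y) = 1 := by
  have h := eqv_mul_left x y (x * y)
  have := tri_mul_self x (x * y)
  rw [eqv_self] at h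
  grind

theorem tri_compl_mul_eq_one (x y : Var K) : tri (1 + x) (y + x * y) = 1 := by
  have h := eqv_mul_left x y (x * y)
  have := tri_mul_self (1 + x) (y + x * y)
  rw [eqv_self] at h
  grind

theorem conj_add (x y z : Var K) : x * (y + z) = x * y + x * z := by
  refine eq_of_eqv ?_
  rw [eqv_mul_left]
  have h₁ := tri_add_right x (x * y) (x * z)
  have h₂ := tri_add_right (1 + x) (y + x * y) (z + x * z)
  rw [add_add_add_comm] at h₂
  simp only [tri_mul_eq_one, tri_compl_mul_eq_one, one_mul] at h₁ h₂
  rw [h₁, h₂, one_mul]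

theorem conj_comm (x y : Var K) : x * y = y * x := eq_of_tri (by
  simp only [mul_wk, tri_mul_left, mul_comm])

theorem zero_conj (x : Var K) : 0 * x = 0 := eq_of_eqv (by
  have h := tri_compl_mul_eq_one 0 x
  rw [eqv_mul_left]; simp)

theorem one_conj (x : Var K) : 1 * x = x := eq_of_eqv (by rw [eqv_mul_left]; simp)

/-- Addition is modulo two, so that every term is its own negative. -/
instance : Neg (Var K) := ⟨fun x => x⟩

/-- Terms form a Boolean ring. -/
instance : CommRing (Var K) where
  zsmul := zsmulRec
  neg_add_cancel := add_self
  add_comm := add_comm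
  nsmul := nsmulRec
  mul_assoc x y z := eq_of_tri (by simp only [mul_wk, tri_mul_left, mul_assoc])
  mul_comm := conj_comm
  one_mul := one_conj
  mul_one x := (conj_comm x 1).trans (one_conj x)
  zero_mul := zero_conj
  mul_zero x := (conj_comm x 0).trans (zero_conj x)
  left_distrib := conj_add
  right_distrib x y z := by
    rw [conj_comm, conj_add, conj_comm z, conj_comm z]

theorem mul_self' (x : Var K) : x * x = x := eq_of_tri (by simp [tri_mul_left, tri_mul_self])

/-! ### Signs of sums and products -/

/-- The phase of `x` splits along the disjoint sum `x = x y + x (1 + y)`. -/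
theorem ph_mul_left (a : ℂ) (x y : Var K) : ph a x = ph a (x * y) * ph a (x + x * y) := by
  have h := tri_ph a x (x * y)
  simpa [tri_mul_eq_one] using h

/-- The sign pairing is the sign of the product. -/
theorem ch_eq (x y : Var K) : ch x y = ph (-1) (x * y) := by
  have e : ∀ x y : Var K, tri x y * ch x y = tri x y * ph (-1) y := by
    intro x y
    have h := tri_ph Complex.I x y
    have h₁ := ph_I_add x y
    have h₂ := ph_neg_I_mul x
    have h₃ : ph Complex.I y * ph Complex.I y = ph (-1) y := by rw [ph_mul]; simp
    have h₄ := ch_mul_self x y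
    grind
  have h₁ := e x (x * y)
  have h₂ := e (1 + x) (y + x * y)
  rw [tri_mul_eq_one, one_mul, one_mul] at h₁
  rw [tri_compl_mul_eq_one, one_mul, one_mul, ch_add, ch_one, ch_comm, ch_add, ch_comm y,
    ch_comm _ x, h₁, ph_neg_one_add] at h₂
  have := ph_neg_one_mul_self (y + x * y)
  have := ph_neg_one_mul_self (x * y)
  have := ph_neg_one_mul_self y
  grind

/-! ### Translated generators -/

/-- The conjunction of the entries of a tuple. -/
def Tup.conj : {n : ℕ} → Tup K n → Var K
  | 0, _ => 1
  | _ + 1, x => conj x.1 * x.2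

/-- The sum modulo two of the entries of a tuple. -/
def Tup.parity : {n : ℕ} → Tup K n → Var K
  | 0, _ => 0
  | _ + 1, x => parity x.1 + x.2

@[simp] theorem conj_t0 : (t0 : Tup K 0).conj = 1 := rfl

@[simp] theorem conj_snoc {n : ℕ} (x : Tup K n) (a : Var K) : (x.snoc a).conj = x.conj * a := rfl

@[simp] theorem conj_sub {n : ℕ} (x : Tup K n) (s : L ⟶ K) [IsComonHom s] :
    (x.sub s).conj = x.conj.sub s := by
  induction n with
  | zero => exact (one_sub' s).symm
  | succ n ih => exact (congrArg (· * x.2.sub s) (ih x.1)).trans (mul_sub' _ _ s).symm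

@[simp] theorem parity_sub {n : ℕ} (x : Tup K n) (s : L ⟶ K) [IsComonHom s] :
    (x.sub s).parity = x.parity.sub s := by
  induction n with
  | zero => exact (zero_sub' s).symm
  | succ n ih => exact (congrArg (· + x.2.sub s) (ih x.1)).trans (add_sub' _ _ s).symm

theorem prod2_tri {n : ℕ} (x : Tup K n) (w : Var K) :
    prod2 tri x (const n w) = tri x.conj w := by
  induction n with
  | zero => exact (tri_one_left w).symm
  | succ n ih => exact (congrArg (· * tri x.2 w) (ih x.1)).trans (tri_mul_left _ _ w).symm

theorem prod2_ch {n : ℕ} (x : Tup K n) (w : Var K) :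
    prod2 ch x (const n w) = ch x.parity w := by
  induction n with
  | zero => exact (ch_zero_left w).symm
  | succ n ih => exact (congrArg (· * ch x.2 w) (ih x.1)).trans (ch_add _ _ w).symm

theorem prod2_flip (f : Var K → Var K → Eff K) {n : ℕ} (x y : Tup K n) :
    prod2 (fun a b => f b a) x y = prod2 f y x := by
  induction n with
  | zero => rfl
  | succ n ih => exact congrArg (· * f y.2 x.2) (ih x.1 y.1)

/-- A ZH-diagram as an effect on its inputs and outputs, through the translation. -/
def zrel {n m : ℕ} (D : ZHDiag n m) (x : Tup K n) (y : Tup K m) : Eff K := rel (ZH.toZX D) x y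

/-- The translated H-box is the phase `a` of the conjunction of all its legs. -/
theorem zrel_box (n m : ℕ) (a : ℂ) (x : Tup K n) (y : Tup K m) :
    zrel (ZH.H n m a) x y = ph a (x.conj * y.conj) := by
  refine (rel_spider (pow T n) (pow Tdown m ⊠ (Tinv ⨟ Z 1 0 a)) 1 x y).trans ?_
  have e : (1 : ℂ) = a - (a - 1) := by ring
  have h := suc_rule (a - 1) (x.conj * y.conj)
  rw [sub_add_cancel] at h
  rw [← h]
  congr 1
  have h₁ : rel (pow Tdown m ⊠ (Tinv ⨟ Z 1 0 a)) (const (m + 1) nw) y.wk =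
      rel (pow Tdown m) (const m nw) y.wk * rel (Tinv ⨟ Z 1 0 a) (t1 nw) t0 :=
    rel_tens (pow Tdown m) (Tinv ⨟ Z 1 0 a) (const m nw) y.wk (t1 nw) t0
  have h₂ : rel (Tinv ⨟ Z 1 0 a) (t1 (nw : Var (K ⊗ wire))) t0 = ph (a - 1) nw := by
    rw [rel_comp1, ← sm_trinv_ph]; rfl
  have h₃ : ∀ z : Tup (K ⊗ wire) m, rel (pow Tdown m) (const m nw) z = tri z.conj nw := by
    intro z
    rw [rel_pow, ← prod2_tri, ← prod2_flip tri]
    simp only [rel_Tdown, tri]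
  rw [h₁, h₂, h₃, rel_pow, ph_one, mul_one]
  have h₄ : prod2 (fun a b => rel T (t1 a) (t1 b)) x.wk (const n nw) = tri x.wk.conj nw :=
    prod2_tri _ _
  rw [h₄, ← mul_assoc, ← tri_mul_left, mul_wk]
  simp [Tup.wk, Tup.wk']

theorem zrel_had (x y : Var K) : zrel ZH.had (t1 x) (t1 y) = ph (-1) (x * y) := by
  rw [ZH.had, zrel_box]
  simp

theorem zrel_scalar (c : ℂ) : zrel (ZH.scalar c) (t0 : Tup K 0) t0 = ph c 1 := by
  rw [ZH.scalar, zrel_box]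
  simp

theorem zrel_tens {n m n' m' : ℕ} (D : ZHDiag n m) (E : ZHDiag n' m') (x : Tup K n) (y : Tup K m)
    (x' : Tup K n') (y' : Tup K m') :
    zrel (D ⊠ E) (x.append x') (y.append y') = zrel D x y * zrel E x' y' := rel_tens _ _ _ _ _ _

theorem zrel_tens_scalar {n m : ℕ} (D : ZHDiag n m) (c : ℂ) (x : Tup K n) (y : Tup K m) :
    zrel (D ⊠ ZH.scalar c) x y = zrel D x y * ph c 1 := by
  rw [← zrel_scalar]; exact zrel_tens D (ZH.scalar c) x y t0 t0

theorem zrel_comp1 {n k : ℕ} (D : ZHDiag n 1) (E : ZHDiag 1 k) (x : Tup K n) (z : Tup K k) :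
    zrel (D ⨟ E) x z = sm (zrel D x.wk (t1 nw) * zrel E (t1 nw) z.wk) := rel_comp1 _ _ _ _

theorem ph_compl (c : ℂ) (x : Var K) : ph c x * ph c (1 + x) = ph c 1 := by
  have h := tri_ph c 1 x
  simpa using h.symm

theorem ph_half_mul_two : ph (1 / 2) (1 : Var K) * ph 2 1 = 1 := by
  rw [ph_mul]; norm_num [ph_one]

/-- Orthogonality of characters. -/
theorem sm_sign_sign (x y : Var K) :
    sm (ph (-1) (x↟ * nw) * ph (-1) (nw * y↟)) = ph 2 1 * eqv x y := by
  rw [← rho_mul_rho, ← sm_ch_ch]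
  simp [ch_eq]

/-- The translated negation computes `1 + x`. -/
theorem zrel_neg (x y : Var K) : zrel ZH.neg (t1 x) (t1 y) = eqv (1 + x) y := by
  rw [ZH.neg, zrel_tens_scalar, zrel_comp1]
  have h : ∀ {K : Obj} [ComonObj K] [IsCommComonObj K] (x y : Var K),
      zrel (ZH.had ⨟ (wires 1 ⊠ ZH.H 0 1 (-1)) ⨟ ZH.Z 2 1) (t1 x) (t1 y) =
        ph (-1) ((1 + x) * y) := by
    intro K _ _ x y
    refine (rel_comp_codet (Codet.merge y) _ _).trans ((rel_comp1 _ _ _ _).trans ?_)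
    refine sm_elim y (zrel ZH.had (t1 x↟) (t1 nw) * zrel (ZH.H 0 1 (-1)) t0 (t1 y↟)) ?_ ?_
    · have e : rel (wires 1 ⊠ ZH.toZX (ZH.H 0 1 (-1))) (t1 nw) (t2 y↟ y↟) =
          eqv nw y↟ * zrel (ZH.H 0 1 (-1)) t0 (t1 y↟) := by
        rw [← rel_wires_one]
        exact rel_tens (wires 1) (ZH.toZX (ZH.H 0 1 (-1))) (t1 nw) (t1 y↟) t0 (t1 y↟)
      refine (congrArg (zrel ZH.had (t1 x↟) (t1 nw) * ·) e).trans ?_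
      rw [eqv_comm nw]; grind
    · rw [zrel_had, zrel_box, add_mul, ph_neg_one_add]
      simp; grind
  simp only [snoc_wk', t0_wk', h, zrel_had]
  have h₂ := sm_sign_sign (1 + x) y
  rw [add_wk, one_wk] at h₂
  rw [h₂]
  have := ph_half_mul_two (K := K)
  grind

/-- The translated grey spider computes the sum modulo two of its inputs. -/
theorem zrel_grey (n : ℕ) (x : Tup K n) (y : Var K) :
    zrel (ZH.X n 1) x (t1 y) = eqv x.parity y := by
  have e : ∀ {K : Obj} [ComonObj K] [IsCommComonObj K] {n : ℕ} (x y : Tup K n),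
      rel (ZH.toZX (pow ZH.had n)) x y = prod2 ch x y := by
    intro K _ _ n x y
    induction n with
    | zero => exact rel_wires (n := 0) x y
    | succ n ih =>
      refine (rel_tens _ _ x.1 y.1 (t1 x.2) (t1 y.2)).trans ?_
      rw [ih, prod2, ch_eq, ← zrel_had]
      rfl
  rw [ZH.X, zrel_tens_scalar]
  have h := rel_spider (ZH.toZX (pow ZH.had n)) (ZH.toZX (pow ZH.had 1)) 1 x (t1 y)
  have h₁ : zrel (pow ZH.had n ⨟ ZH.Z n 1 ⨟ pow ZH.had 1) x (t1 y) = ph 2 1 * eqv x.parity y := by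
    refine h.trans ?_
    rw [← sm_sign_sign, e, e, prod2_ch, ph_one]
    congr 1
    simp [Tup.wk, Tup.wk', ch_eq]
  have := ph_half_mul_two (K := K)
  grind

/-- The translated AND gate computes the conjunction of its inputs. -/
theorem zrel_and (n : ℕ) (x : Tup K n) (y : Var K) :
    zrel (ZH.And n) x (t1 y) = eqv x.conj y := by
  rw [ZH.And, zrel_tens_scalar, zrel_comp1]
  have h := sm_sign_sign x.conj y
  have e : sm (zrel (ZH.H n 1 (-1)) x.wk (t1 nw) * zrel ZH.had (t1 nw) (t1 y).wk) =
      ph 2 1 * eqv x.conj y := by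
    rw [← h]; congr 1
    simp [zrel_box, zrel_had, Tup.wk, Tup.wk']
  have := ph_half_mul_two (K := K)
  grind

/-! ### The rules without a bipartite graph -/

theorem provable_of_zrel {n m : ℕ} {D E : ZHDiag n m}
    (h : ∀ (K : Obj) [ComonObj K] [IsCommComonObj K] (x : Tup K n) (y : Tup K m),
      zrel D x y = zrel E x y) : Provable (ZH.toZX D) (ZH.toZX E) := provable_of_rel h

/-- The sum over the leg between the first box and the Hadamard box identifies the middle wire with
the conjunction of the inputs. -/
theorem box_fusion (n m : ℕ) (a : ℂ) : Provable (ZH.toZX (ZH.H n 1 (-1) ⨟ ZH.had ⨟ ZH.H 1 m a))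
    (ZH.toZX (ZH.H n m a ⊠ ZH.scalar 2)) := by
  refine provable_of_zrel fun K _ _ x y => ?_
  rw [zrel_tens_scalar, zrel_comp1]
  have e : ∀ {K : Obj} [ComonObj K] [IsCommComonObj K] (x : Tup K n) (y : Var K),
      zrel (ZH.H n 1 (-1) ⨟ ZH.had) x (t1 y) = ph 2 1 * eqv x.conj y := by
    intro K _ _ x y
    rw [zrel_comp1, ← sm_sign_sign]; congr 1
    simp [zrel_box, zrel_had, Tup.wk, Tup.wk']
  have h := sm_elim x.conj (ph 2 1 * ph a (nw * y.conj↟))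
    (f := zrel (ZH.H n 1 (-1) ⨟ ZH.had) x.wk (t1 nw) * zrel (ZH.H 1 m a) (t1 nw) y.wk)
    (h := ph 2 1 * ph a (x.conj * y.conj)) ?_ (by simp)
  · rw [h, zrel_box]; grind
  · rw [e, zrel_box]
    simp [Tup.wk, Tup.wk']; grind

theorem had_had : Provable (ZH.toZX (ZH.had ⨟ ZH.had)) (ZH.toZX (wires 1 ⊠ ZH.scalar 2)) := by
  refine provable_of_zrel fun K _ _ x y => ?_
  obtain ⟨⟨⟩, x⟩ := x
  obtain ⟨⟨⟩, y⟩ := y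
  change zrel (ZH.had ⨟ ZH.had) (t1 x) (t1 y) = zrel (wires 1 ⊠ ZH.scalar 2) (t1 x) (t1 y)
  rw [zrel_tens_scalar, zrel_comp1]
  refine Eq.trans ?_ ((sm_sign_sign x y).trans ?_)
  · congr 1
    rw [← zrel_had, ← zrel_had]; rfl
  · rw [mul_comm, ← rel_wires_one]; rfl

theorem multiply (a b : ℂ) : Provable (ZH.toZX ((ZH.H 0 1 a ⊠ ZH.H 0 1 b) ⨟ ZH.Z 2 1))
    (ZH.toZX (ZH.H 0 1 (a * b))) := by
  refine provable_of_zrel fun K _ _ x y => ?_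
  obtain ⟨⟨⟩, y⟩ := y
  change zrel _ t0 (t1 y) = zrel _ t0 (t1 y)
  refine (rel_comp_codet (Codet.merge y) _ _).trans ((zrel_tens (ZH.H 0 1 a) (ZH.H 0 1 b)
    t0 (t1 y) t0 (t1 y)).trans ?_)
  rw [zrel_box, zrel_box, zrel_box, ph_mul]

theorem unit : Provable (ZH.toZX (ZH.H 0 1 1)) (ZH.toZX (ZH.Z 0 1)) := by
  refine provable_of_zrel fun K _ _ x y => ?_
  obtain ⟨⟨⟩, y⟩ := y
  change zrel _ t0 (t1 y) = zrel _ t0 (t1 y)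
  rw [zrel_box, ph_one]
  exact ((rel_state 1 y).trans (ph_one y)).symm

/-! ### Sums created inside a composite diagram -/

theorem det_of_rel {n m : ℕ} {D : ZXDiag n m} {x : Tup K n} {y : Tup K m}
    (h : ∀ (L : Obj) [ComonObj L] [IsCommComonObj L] (s : L ⟶ K) [IsComonHom s] (z : Tup L m),
      rel D (x.sub s) z = prod2 eqv (y.sub s) z) : Det D x y := by
  unfold Det
  refine eq_of_graph (X := K) (Y := reg m) ?_
  have h₁ := h _ (fst K (reg m)) (Tup.ofTm ⟨snd K (reg m), inferInstance⟩)
  rw [← eqv_tm, tm_ofTm, tm_sub] at h₁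
  simp only [rel, tm_ofTm, tm_sub, graph, Tm.sub, Category.assoc] at h₁
  exact h₁

/-- A diagram that creates a sum over one new variable, composed with a diagram. -/
theorem rel_comp_sum {n m k : ℕ} {D : ZXDiag n m} {x : Tup K n} {y : Tup (K ⊗ wire) m}
    (h : ∀ (L : Obj) [ComonObj L] [IsCommComonObj L] (s : L ⟶ K) [IsComonHom s] (z : Tup L m),
      rel D (x.sub s) z = sm (prod2 eqv (y.sub (s ▷ wire)) z.wk))
    (E : ZXDiag m k) (z : Tup K k) : rel (D ⨟ E) x z = sm (rel E y z.wk) := by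
  let π : (K ⊗ wire) ⊗ reg m ⟶ (K ⊗ reg m) ⊗ wire :=
    pair (pair (fst _ _ ≫ fst _ _) (snd _ _)) (fst _ _ ≫ snd _ _)
  have h₁ : π ≫ fst K (reg m) ▷ wire = fst (K ⊗ wire) (reg m) := by
    have e : fst K (reg m) ▷ wire =
        pair (fst (K ⊗ reg m) wire ≫ fst K (reg m)) (snd (K ⊗ reg m) wire) := by
      rw [← pair_whiskerRight, pair_fst_snd, Category.id_comp]
    rw [e, comp_pair, ← Category.assoc, pair_fst, pair_fst, pair_snd, ← comp_pair, pair_fst_snd,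
      Category.comp_id]
  have h₂ : (π ≫ fst (K ⊗ reg m) wire) ≫ fst K (reg m) = fst (K ⊗ wire) (reg m) ≫ fst K wire := by
    rw [pair_fst, pair_fst]
  have h₃ : (fresh K (reg m)).sub (π ≫ fst (K ⊗ reg m) wire) = fresh (K ⊗ wire) (reg m) := by
    ext
    simp only [Tm.sub, fresh]
    rw [pair_fst, pair_snd]
  have h₄ : (Tup.ofTm (fresh K (reg m))).sub (π ≫ fst (K ⊗ reg m) wire) =
      Tup.ofTm (fresh (K ⊗ wire) (reg m)) := by rw [← ofTm_sub, h₃]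
  have h₅ : (z.sub (fst K (reg m))).sub (π ≫ fst (K ⊗ reg m) wire) = z.wk.wk' (reg m) := by
    rw [Tup.sub_sub, Tup.sub_congr h₂, ← Tup.sub_sub]; rfl
  have h₆ : pull π (prod2 eqv (y.sub (fst K (reg m) ▷ wire)) (Tup.ofTm (fresh K (reg m))).wk) =
      eqv (y.tm.wk' (reg m)) (fresh _ (reg m)) := by
    have h₇ : (Tup.ofTm (fresh K (reg m))).wk.sub π = Tup.ofTm (fresh (K ⊗ wire) (reg m)) := by
      rw [← h₄, ← Tup.sub_sub]; rfl
    rw [← eqv_tm, pull_eqv, ← tm_sub, ← tm_sub, Tup.sub_sub, Tup.sub_congr h₁, h₇, tm_ofTm, tm_sub]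
    rfl
  rw [rel_comp, h (K ⊗ reg m) (fst K (reg m)), sm_mul, sm_comm]
  congr 1
  have h₈ := sm_eqv_mul y.tm (rel E (.ofTm (fresh _ (reg m))) (z.wk.wk' (reg m)))
  rw [pull_rel, ← ofTm_sub, fresh_inst, ofTm_tm, Tup.wk'_inst] at h₈
  rw [← h₈]
  congr 1
  change pull π _ = _
  rw [map_mul, h₆, pull_pull, pull_rel, h₄, h₅]

theorem Det.neg (x : Var K) : Det (ZH.toZX ZH.neg) (t1 x) (t1 (1 + x)) :=
  det_of_rel fun L _ _ s _ z => by
    obtain ⟨⟨⟩, z⟩ := z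
    refine (zrel_neg (x.sub s) z).trans ?_
    have : (t1 (1 + x)).sub s = t1 (1 + x.sub s) := by simp
    rw [this]
    exact (one_mul _).symm

theorem spider_state (m : ℕ) : Provable (Z 0 1 1 ⨟ Z 1 m 1) (Z 0 m 1) := by
  have h := fuse_below 0 0 0 m 1 1
  rw [one_mul] at h
  exact ((Derives.comp_congr (.refl _) (Derives.id_tens _).symm).trans h).trans
    (spider_congr rfl (Nat.zero_add m) 1)

/-- A sum over two variables, created by spiders without inputs. -/
theorem rel_comp_states {m m' k : ℕ} (E : ZXDiag (m + m') k) (z : Tup K k) :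
    rel ((Z 0 m 1 ⊠ Z 0 m' 1) ⨟ E) t0 z =
      sm (sm (rel E ((const m nw↟).append (const m' nw)) z.wk.wk)) := by
  have h : Provable ((Z 0 m 1 ⊠ Z 0 m' 1) ⨟ E)
      ((Z 0 1 1 ⊠ Z 0 1 1) ⨟ ((Z 1 m 1 ⊠ Z 1 m' 1) ⨟ E)) :=
    (Derives.comp_congr ((Derives.tens_congr (spider_state m).symm (spider_state m').symm).trans
      (Derives.interchange _ _ _ _).symm) (.refl _)).trans (Derives.comp_assoc _ _ _)
  rw [rel_congr h, rel_comp2]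
  congr 2
  have hd : Det (Z 1 m 1 ⊠ Z 1 m' 1) (t2 (nw↟ : Var ((K ⊗ wire) ⊗ wire)) nw)
      ((const m nw↟).append (const m' nw)) := (Det.spider m nw↟).tens (Det.spider m' nw)
  rw [rel_comp_det hd]
  have e : rel (Z 0 1 1 ⊠ Z 0 1 1) t0 (t2 (nw↟ : Var ((K ⊗ wire) ⊗ wire)) nw) = 1 := by
    refine (rel_tens (Z 0 1 1) (Z 0 1 1) t0 (t1 nw↟) t0 (t1 nw)).trans ?_
    rw [rel_state, rel_state, ph_one, ph_one, mul_one]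
  simp only [t0_wk', e, one_mul]

/-! ### The average, intro and ortho rules -/

/-- The sum over `n` of `a ^ (n v) * b ^ ((1 - n) v)` is `2 * ((a + b) / 2) ^ v`. -/
theorem sm_ph_mul_ph_mul (a b : ℂ) (v : Var K) :
    sm (ph a (nw * v↟) * ph b ((1 + nw) * v↟)) = ph ((a + b) / 2) v * ph 2 1 := by
  -- The summation variable is replaced by `v n ≤ v`, of which every value is taken `2 ^ (1 - v)`
  -- times; what remains is the binomial sum over the elements below `v`.
  have h₁ : sm (ph a (nw * v↟) * ph b ((1 + nw) * v↟)) =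
      sm (sm (eqv (v↟↟ * nw↟) nw * (ph a nw * ph b (v↟↟ + nw)))) := by
    congr 1
    symm
    refine sm_elim (v↟ * nw) (ph a nw * ph b (v↟↟ + nw)) (by simp) ?_
    simp only [map_mul, pull_ph, fresh_inst, add_sub', Ctx.wk'_inst]
    rw [add_mul, one_mul, mul_comm nw]
  have h₂ : sm (tri (1 + v↟) nw) = ph 2 (1 + v) := by
    have h := suc_rule 1 (1 + v)
    norm_num [ph_one] at h
    exact h
  rw [h₁, sm_comm' _ rfl]
  have h₃ : sm (sm (pull (xch K) (eqv (v↟↟ * nw↟) nw * (ph a nw * ph b (v↟↟ + nw))))) =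
      sm (tri v↟ nw * ph a nw * ph b (v↟ + nw) * ph 2 (1 + v)↟) := by
    congr 1
    have h := suc_rule 1 (1 + v↟)
    norm_num [ph_one] at h
    rw [add_wk, one_wk, ← h, mul_sm]
    refine sm_shift nw _ ?_
    simp [eqv_mul_left]
    have e : nw↟ + nw + nw↟ = (nw : Var ((K ⊗ wire) ⊗ wire)) := by
      rw [add_comm, add_add_self]
    rw [e]
    grind
  rw [h₃]
  have h₄ := sm_mul (tri v↟ nw * ph a nw * ph b (v↟ + nw)) (ph 2 (1 + v))
  have h₅ := ph_compl 2 v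
  have h₆ := ph_mul ((a + b) / 2) 2 v
  rw [div_mul_cancel₀ _ (by norm_num), add_comm a] at h₆
  simp only [pull_ph, sub_fst] at h₄
  rw [← h₄, sm_tri_ph_ph, ← h₅, ← h₆, add_comm a]
  grind

/-- The translation of a ZH-diagram maps the terms `x` to the terms `y`. -/
def ZDet {n m : ℕ} (D : ZHDiag n m) (x : Tup K n) (y : Tup K m) : Prop := Det (ZH.toZX D) x y

theorem ZDet.tens {n m n' m' : ℕ} {D : ZHDiag n m} {E : ZHDiag n' m'} {x : Tup K n} {y : Tup K m}
    {x' : Tup K n'} {y' : Tup K m'} (h : ZDet D x y) (h' : ZDet E x' y') :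
    ZDet (Diag.tens D E) (x.append x') (y.append y') := Det.tens h h'

theorem ZDet.comp {n m k : ℕ} {D : ZHDiag n m} {E : ZHDiag m k} {x : Tup K n} {y : Tup K m}
    {z : Tup K k} (h : ZDet D x y) (h' : ZDet E y z) : ZDet (Diag.comp D E) x z := Det.comp h h'

theorem ZDet.wires {n : ℕ} (x : Tup K n) : ZDet (.wires n) x x := Det.wires x

theorem ZDet.swap {n m : ℕ} (x : Tup K n) (y : Tup K m) :
    ZDet (.swap n m) (x.append y) (y.append x) := Det.swap x y

theorem Det.of_eq {n m : ℕ} {D : ZXDiag n m} {x x' : Tup K n} {y y' : Tup K m}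
    (h : Det D x y) (hx : x = x') (hy : y = y') : Det D x' y' := by rwa [← hx, ← hy]

theorem ZDet.of_eq {n m : ℕ} {D : ZHDiag n m} {x x' : Tup K n} {y y' : Tup K m}
    (h : ZDet D x y) (hx : x = x') (hy : y = y') : ZDet D x' y' := by rwa [← hx, ← hy]

theorem ZDet.neg (a : Var K) : ZDet ZH.neg (t1 a) (t1 (1 + a)) := Det.neg a

theorem ZDet.spider (m : ℕ) (a : Var K) : ZDet (ZH.Z 1 m) (t1 a) (const m a) := Det.spider m a

theorem zrel_comp_det {n m k : ℕ} {D : ZHDiag n m} {E : ZHDiag m k} {x : Tup K n} {y : Tup K m}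
    (h : ZDet D x y) (z : Tup K k) : zrel (D ⨟ E) x z = zrel E y z := rel_comp_det h _ z

theorem zrel_wires_one (x y : Var K) : zrel (wires 1) (t1 x) (t1 y) = eqv x y := rel_wires_one x y

/-- A sum over two variables, created by white spiders without inputs. -/
theorem zrel_comp_states {m m' k l : ℕ} (D : ZHDiag (m + m') l) (E : ZHDiag l k) (z : Tup K k) :
    zrel ((ZH.Z 0 m ⊠ ZH.Z 0 m') ⨟ D ⨟ E) t0 z =
      sm (sm (zrel (D ⨟ E) ((const m nw↟).append (const m' nw)) z.wk.wk)) :=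
  (rel_congr (Derives.comp_assoc _ _ _) _ _).trans (rel_comp_states (m := m) (m' := m') _ _)

theorem average (a b : ℂ) : Provable (ZH.toZX ((ZH.Z 0 2 ⊠ ZH.Z 0 3) ⨟
      (wires 1 ⊠ swap 1 1 ⊠ wires 2) ⨟
        (ZH.H 2 0 a ⊠ ((ZH.neg ⊠ wires 1) ⨟ ZH.H 2 0 b) ⊠ wires 1)))
    (ZH.toZX (ZH.H 0 1 ((a + b) / 2) ⊠ ZH.scalar 2)) := by
  have e : ∀ {K : Obj} [ComonObj K] [IsCommComonObj K] (p q v : Var K),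
      zrel ((wires 1 ⊠ swap 1 1 ⊠ wires 2) ⨟
        (ZH.H 2 0 a ⊠ ((ZH.neg ⊠ wires 1) ⨟ ZH.H 2 0 b) ⊠ wires 1))
          ((const 2 p).append (const 3 q)) (t1 v) =
        ph a (p * q) * ph b ((1 + p) * q) * eqv q v := by
    intro K _ _ p q v
    have hd : ZDet (wires 1 ⊠ swap 1 1 ⊠ wires 2) ((const 2 p).append (const 3 q))
        (((t2 p q).append (t2 p q)).append (t1 q)) :=
      (((ZDet.wires (t1 p)).tens (ZDet.swap (t1 p) (t1 q))).tens (ZDet.wires (t2 q q))).of_eq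
        rfl rfl
    have hn : ZDet (ZH.neg ⊠ wires 1) (t2 p q) (t2 (1 + p) q) :=
      (ZDet.neg p).tens (ZDet.wires (t1 q))
    have hb : zrel ((ZH.neg ⊠ wires 1) ⨟ ZH.H 2 0 b) (t2 p q) t0 = ph b ((1 + p) * q) := by
      rw [zrel_comp_det hn, zrel_box]
      simp
    have ha : zrel (ZH.H 2 0 a) (t2 p q) t0 = ph a (p * q) := by
      rw [zrel_box]; simp
    rw [zrel_comp_det hd, ← hb, ← ha, ← zrel_wires_one, ← zrel_tens, ← zrel_tens]
    rfl
  refine provable_of_zrel fun K _ _ x v => ?_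
  obtain ⟨⟨⟩, v⟩ := v
  change zrel _ t0 (t1 v) = zrel _ t0 (t1 v)
  rw [zrel_tens_scalar, zrel_box, conj_t0, one_mul, conj_snoc, conj_t0, one_mul,
    ← sm_ph_mul_ph_mul, zrel_comp_states]
  congr 1
  refine sm_elim v↟ (ph a (nw↟ * nw) * ph b ((1 + nw↟) * nw)) ?_ (by simp)
  refine (e nw↟ nw v↟↟).trans ?_
  rw [eqv_comm nw]; grind

theorem intro (a : ℂ) : Provable (ZH.toZX (ZH.H 0 1 a ⊠ ZH.Z 0 1))
    (ZH.toZX ((ZH.Z 0 3 ⊠ ZH.Z 0 3) ⨟ (wires 2 ⊠ swap 1 1 ⊠ wires 2) ⨟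
      (wires 1 ⊠ ZH.H 2 0 a ⊠ ((wires 1 ⊠ ZH.neg) ⨟ ZH.H 2 0 a) ⊠ wires 1))) := by
  have e : ∀ {K : Obj} [ComonObj K] [IsCommComonObj K] (p q u v : Var K),
      zrel ((wires 2 ⊠ swap 1 1 ⊠ wires 2) ⨟
        (wires 1 ⊠ ZH.H 2 0 a ⊠ ((wires 1 ⊠ ZH.neg) ⨟ ZH.H 2 0 a) ⊠ wires 1))
          ((const 3 p).append (const 3 q)) (t2 u v) =
        eqv p u * ph a p * eqv q v := by
    intro K _ _ p q u v
    have hd : ZDet (wires 2 ⊠ swap 1 1 ⊠ wires 2) ((const 3 p).append (const 3 q))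
        ((((t1 p).append (t2 p q)).append (t2 p q)).append (t1 q)) :=
      (((ZDet.wires (t2 p p)).tens (ZDet.swap (t1 p) (t1 q))).tens (ZDet.wires (t2 q q))).of_eq
        rfl rfl
    have hn : ZDet (wires 1 ⊠ ZH.neg) (t2 p q) (t2 p (1 + q)) :=
      (ZDet.wires (t1 p)).tens (ZDet.neg q)
    have hb : zrel ((wires 1 ⊠ ZH.neg) ⨟ ZH.H 2 0 a) (t2 p q) t0 = ph a (p + p * q) := by
      rw [zrel_comp_det hn, zrel_box]
      simp [mul_add]
    have ha : zrel (ZH.H 2 0 a) (t2 p q) t0 = ph a (p * q) := by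
      rw [zrel_box]; simp
    rw [zrel_comp_det hd, ph_mul_left a p q, ← hb, ← ha, ← zrel_wires_one, ← zrel_wires_one,
      ← mul_assoc, ← zrel_tens, ← zrel_tens, ← zrel_tens]
    rfl
  refine provable_of_zrel fun K _ _ x y => ?_
  obtain ⟨⟨⟨⟩, u⟩, v⟩ := y
  change zrel _ t0 (t2 u v) = zrel _ t0 (t2 u v)
  refine (zrel_tens (ZH.H 0 1 a) (ZH.Z 0 1) t0 (t1 u) t0 (t1 v)).trans ?_
  have h₁ : zrel (ZH.Z 0 1) t0 (t1 v) = 1 := (rel_state 1 v).trans (ph_one v)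
  rw [zrel_box, h₁, zrel_comp_states]
  symm
  refine sm_elim u (ph a nw) ?_ (by simp)
  refine sm_elim v↟ (eqv u↟↟ nw↟ * ph a nw↟) ?_ (by simp)
  refine (e nw↟ nw u↟↟ v↟↟).trans ?_
  rw [eqv_comm nw, eqv_comm nw↟]; grind

theorem pull_prod2_eqv {n : ℕ} (x y : Tup K n) (s : L ⟶ K) [IsComonHom s] :
    pull s (prod2 eqv x y) = prod2 eqv (x.sub s) (y.sub s) := by
  rw [← eqv_tm, ← eqv_tm, pull_eqv, tm_sub, tm_sub]

/-- The insertion of a white spider with one leg is a sum. -/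
theorem rel_insert {n m k : ℕ} (x : Tup K n) (x' : Tup K m) (E : ZXDiag (n + 1 + m) k)
    (z : Tup K k) : rel ((wires n ⊠ Z 0 1 1 ⊠ wires m) ⨟ E) (x.append x') z =
      sm (rel E ((x.wk.append (t1 nw)).append x'.wk) z.wk) := by
  refine rel_comp_sum (fun L _ _ s _ p => ?_) E z
  rw [← append_take_drop p, ← append_take_drop p.take]
  obtain ⟨⟨⟩, c⟩ := p.take.drop
  have e : (((p.take.take).append (t1 c)).append p.drop).wk =
      (((p.take.take).wk).append (t1 c↟)).append p.drop.wk := by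
    simp only [Tup.wk, Tup.wk']
    rw [append_sub, append_sub]; rfl
  have e' : ((x.wk.append (t1 nw)).append x'.wk).sub (s ▷ wire) =
      ((x.sub s).wk.append (t1 nw)).append (x'.sub s).wk := by
    rw [append_sub, append_sub]; simp
  have h₁ := rel_tens (wires n ⊠ Z 0 1 1) (wires m) (x.sub s)
    ((p.take.take).append (t1 c)) (x'.sub s) p.drop
  have h₂ := rel_tens (wires n) (Z 0 1 1) (x.sub s) p.take.take t0 (t1 c)
  have h₃ := rel_wires (x.sub s) p.take.take
  have h₄ := rel_wires (x'.sub s) p.drop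
  have h₅ : rel (Z 0 1 1) t0 (t1 c) = 1 := (rel_state 1 c).trans (ph_one _)
  rw [append_sub, e']
  refine (h₁.trans (congrArg (· * _) h₂)).trans ?_
  rw [h₃, h₄, h₅, mul_one]
  symm
  refine sm_elim c (pull (fst L wire) (prod2 eqv (x.sub s) p.take.take *
    prod2 eqv (x'.sub s) p.drop)) ?_ ?_
  · refine (congrArg (prod2 eqv _) e).trans ?_
    rw [prod2_append, prod2_append, map_mul, pull_prod2_eqv, pull_prod2_eqv, prod2_snoc, prod2_t0,
      one_mul, eqv_comm c↟, mul_right_comm, mul_comm]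
    rfl
  · rw [pull_pull]
    exact (pull_congr (pair_fst _ _) _).trans (pull_id _)

/-- Both sides of the ortho rule, up to the diagram `S` in the middle. -/
noncomputable def orthoFrame (S : ZHDiag 0 2) : ZHDiag 3 0 :=
  (wires 1 ⊠ ZH.Z 1 2 ⊠ wires 1) ⨟ (wires 2 ⊠ S ⊠ wires 2) ⨟ (wires 4 ⊠ ZH.neg ⊠ wires 1) ⨟
    (ZH.H 3 0 (-1) ⊠ ZH.H 3 0 (-1))

/-- The two H-boxes at the bottom of the ortho rule, with a negation on one leg. -/
theorem zrel_ortho_boxes (a b c d e f : Var K) :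
    zrel ((wires 4 ⊠ ZH.neg ⊠ wires 1) ⨟ (ZH.H 3 0 (-1) ⊠ ZH.H 3 0 (-1)))
      ((t3 a b c).append (t3 d e f)) t0 =
      ph (-1) (a * b * c) * ph (-1) (d * (1 + e) * f) := by
  have hd : ZDet (wires 4 ⊠ ZH.neg ⊠ wires 1) ((t3 a b c).append (t3 d e f))
      ((t3 a b c).append (t3 d (1 + e) f)) :=
    (((ZDet.wires ((t3 a b c).append (t1 d))).tens (ZDet.neg e)).tens (ZDet.wires (t1 f))).of_eq
      rfl rfl
  rw [zrel_comp_det hd]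
  refine (zrel_tens (ZH.H 3 0 (-1)) (ZH.H 3 0 (-1)) (t3 a b c) t0 (t3 d (1 + e) f) t0).trans ?_
  rw [zrel_box, zrel_box]
  simp

/-- A spider without inputs and with two outputs, as a sum and a copy. -/
theorem insert_copy : Derives Rule (wires 2 ⊠ Z 0 2 1 ⊠ wires 2)
    ((wires 2 ⊠ Z 0 1 1 ⊠ wires 2) ⨟ (wires 2 ⊠ Z 1 2 1 ⊠ wires 2)) := by
  refine Derives.symm ((Derives.interchange _ _ _ _).trans (.tens_congr
    ((Derives.interchange _ _ _ _).trans (.tens_congr (.id_comp _) ?_)) (.id_comp _)))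
  exact spider_state 2

/-- Two spiders without inputs and with one output, as two successive sums. -/
theorem insert_two : Provable (wires 2 ⊠ (Z 0 1 1 ⊠ Z 0 1 1) ⊠ wires 2)
    ((wires 2 ⊠ Z 0 1 1 ⊠ wires 2) ⨟ (wires 3 ⊠ Z 0 1 1 ⊠ wires 2)) := by
  have h : Derives Rule (wires 3 ⊠ Z 0 1 1) (wires 2 ⊠ (wires 1 ⊠ Z 0 1 1)) :=
    (Derives.tens_congr (Derives.tens_id 2 1).symm (.refl _)).trans (.tens_assoc _ _ _)
  refine Derives.symm ((Derives.comp_congr (.refl _) (.tens_congr h (.refl _))).trans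
    ((Derives.interchange _ _ _ _).trans (.tens_congr
    ((Derives.interchange _ _ _ _).trans (.tens_congr (.id_comp _) ?_)) (.id_comp _))))
  exact (Derives.comp_congr (Derives.tens_id_zero _).symm (.refl _)).trans
    ((Derives.interchange _ _ _ _).trans (.tens_congr (.comp_id _) (.id_comp _)))

theorem zrel_orthoFrame {S : ZHDiag 0 2} {F : ZXDiag 4 6}
    (h : Derives Rule (wires 2 ⊠ ZH.toZX S ⊠ wires 2) F) (x y z : Var K) :
    zrel (orthoFrame S) (t3 x y z) t0 = rel (F ⨟ ZH.toZX ((wires 4 ⊠ ZH.neg ⊠ wires 1) ⨟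
      (ZH.H 3 0 (-1) ⊠ ZH.H 3 0 (-1)))) ((t2 x y).append (t2 y z)) t0 := by
  have hd : ZDet (wires 1 ⊠ ZH.Z 1 2 ⊠ wires 1) (t3 x y z) ((t2 x y).append (t2 y z)) :=
    (((ZDet.wires (t1 x)).tens (ZDet.spider 2 y)).tens (ZDet.wires (t1 z))).of_eq rfl rfl
  rw [← rel_comp_det hd]
  refine rel_congr ?_ _ _
  exact (Derives.comp_assoc _ _ _).trans ((Derives.comp_assoc _ _ _).trans
    (.comp_congr (.refl _) (.comp_congr h (.refl _))))

/-- With one shared variable the sum compares `z₁ x` with `(1 + x) z₂`; with two variables it says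
that both vanish. The products are orthogonal, so that they are equal only if both vanish. -/
theorem ortho : Provable (ZH.toZX (orthoFrame (ZH.Z 0 2) ⊠ ZH.scalar 2))
    (ZH.toZX (orthoFrame (ZH.Z 0 1 ⊠ ZH.Z 0 1))) := by
  refine provable_of_zrel fun K _ _ x y => ?_
  obtain ⟨⟨⟨⟨⟩, z₁⟩, x⟩, z₂⟩ := x
  obtain ⟨⟩ := y
  change zrel _ (t3 z₁ x z₂) t0 = zrel _ (t3 z₁ x z₂) t0
  have e₁ : zrel (orthoFrame (ZH.Z 0 2)) (t3 z₁ x z₂) t0 =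
      ph 2 1 * eqv (z₁ * x) ((1 + x) * z₂) := by
    rw [zrel_orthoFrame (S := ZH.Z 0 2) insert_copy, rel_congr (Derives.comp_assoc _ _ _),
      ← sm_sign_sign]
    refine (rel_insert (t2 z₁ x) (t2 x z₂) _ _).trans ?_
    congr 1
    have hd : Det (wires 2 ⊠ Z 1 2 1 ⊠ wires 2)
        (((t2 z₁ x).wk.append (t1 nw)).append (t2 x z₂).wk)
        ((t3 z₁↟ x↟ nw).append (t3 nw x↟ z₂↟)) :=
      (((Det.wires (t2 z₁ x).wk).tens (Det.copy nw)).tens (Det.wires (t2 x z₂).wk)).of_eq rfl rfl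
    rw [rel_comp_det hd]
    refine (zrel_ortho_boxes _ _ _ _ _ _).trans ?_
    simp; ring_nf
  have e₂ : zrel (orthoFrame (ZH.Z 0 1 ⊠ ZH.Z 0 1)) (t3 z₁ x z₂) t0 =
      (ph 2 1 * ph 0 (z₁ * x)) * (ph 2 1 * ph 0 ((1 + x) * z₂)) := by
    rw [zrel_orthoFrame (S := ZH.Z 0 1 ⊠ ZH.Z 0 1) insert_two, rel_congr (Derives.comp_assoc _ _ _)]
    refine (rel_insert (t2 z₁ x) (t2 x z₂) _ _).trans ?_
    have h₁ := sm_ch (z₁ * x)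
    have h₂ := sm_ch ((1 + x) * z₂)
    rw [rho_mul_rho] at h₁ h₂
    rw [← h₁, ← h₂, sm_mul]
    congr 1
    refine (rel_insert (t3 z₁↟ x↟ nw) (t2 x↟ z₂↟) _ _).trans ?_
    rw [pull_sm, mul_sm]
    congr 1
    have ht : ((t3 z₁↟ x↟ (nw : Var (K ⊗ wire))).wk.append (t1 nw)).append (t2 x↟ z₂↟).wk =
        (t3 z₁↟↟ x↟↟ nw↟).append (t3 nw x↟↟ z₂↟↟) := rfl
    refine (congrArg (zrel _ · _) ht).trans ((zrel_ortho_boxes _ _ _ _ _ _).trans ?_)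
    simp [ch_eq]; ring_nf
  rw [zrel_tens_scalar, e₁, e₂]
  have h₀ : z₁ * x * ((1 + x) * z₂) = 0 := by
    have h : z₁ * x * ((1 + x) * z₂) = z₁ * z₂ * (x + x * x) := by ring
    rw [h, mul_self', add_self, mul_zero]
  have h₁ := eqv_mul_congr (z₁ * x) ((1 + x) * z₂) (eqv (z₁ * x)↟ ((z₁ * x)↟ * nw)) (g := 1)
    (h := ph 0 (z₁ * x)) (by simp [mul_self', eqv_self]) (by simp [h₀, eqv_zero])
  have h₂ := ph_zero_mul_congr (z₁ * x) (eqv nw ((1 + x) * z₂)↟) rfl rfl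
  have h₃ : eqv 0 ((1 + x) * z₂) = ph 0 ((1 + x) * z₂) := by rw [eqv_comm, eqv_zero]
  simp only [pull_eqv, fresh_inst, Ctx.wk'_inst, h₃] at h₂
  grind

/-! ### The bialgebra rules -/

namespace Tup

/-- Transport of a tuple along an equality of lengths. -/
def cast {n m : ℕ} (h : n = m) (x : Tup K n) : Tup K m := h ▸ x

theorem cast_snoc {n m : ℕ} (h : n = m) (x : Tup K n) (a : Var K) :
    (x.snoc a).cast (congrArg (· + 1) h) = (x.cast h).snoc a := by subst h; rfl

theorem append_assoc {n m k : ℕ} (x : Tup K n) (y : Tup K m) (z : Tup K k) :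
    (x.append y).append z = (x.append (y.append z)).cast (Nat.add_assoc n m k).symm := by
  induction k with
  | zero => rfl
  | succ k ih =>
    exact (congrArg (Tup.snoc · z.2) (ih z.1)).trans (cast_snoc _ _ _).symm

theorem eq_of_length_zero {n : ℕ} (h : n = 0) (x y : Tup K n) : x = y := by
  subst h; exact Subsingleton.elim (α := PUnit) x y

/-- Every entry repeated `m` times in a row. -/
def stretch (m : ℕ) : {n : ℕ} → Tup K n → Tup K (m * n)
  | 0, _ => t0
  | _ + 1, x => (stretch m x.1).append (const m x.2)

/-- `m` copies of a tuple in a row; the permutation `shuffle` produces it from `stretch`. -/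
def copies {n : ℕ} (x : Tup K n) : (m : ℕ) → Tup K (n * m)
  | 0 => t0
  | m + 1 => (copies x m).append x

end Tup

theorem ZDet.cast {n m n' m' : ℕ} (hn : n = n') (hm : m = m') {D : ZHDiag n m} {x : Tup K n}
    {y : Tup K m} (h : ZDet D x y) : ZDet (Diag.cast hn hm D) (x.cast hn) (y.cast hm) := by
  subst hn hm; exact h

theorem ZDet.fanOut (m : ℕ) {n : ℕ} (x : Tup K n) :
    ZDet (Diag.fanOut (ZH.Z 1 m) n) x (x.stretch m) := by
  induction n with
  | zero => exact ZDet.wires x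
  | succ n ih => exact (ih x.1).tens (ZDet.spider m x.2)

theorem ZDet.interleave {n : ℕ} (x : Tup K n) (a : Var K) (m : ℕ) :
    ZDet (Diag.interleave n m) ((x.copies m).append (const m a)) ((x.snoc a).copies m) := by
  induction m with
  | zero => exact ZDet.wires t0
  | succ m ih =>
    have h₁ := ((ZDet.wires (x.copies m)).tens (ZDet.swap x (const m a))).tens (ZDet.wires (t1 a))
    have h₂ := h₁.cast (show n * m + (n + m) + 1 = n * m + n + (m + 1) by omega)
      (show n * m + (m + n) + 1 = n * m + m + (n + 1) by omega)
    have h₃ : ZDet _ ((x.copies (m + 1)).append (const (m + 1) a))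
        (((x.copies m).append (const m a)).append (x.snoc a)) := h₂.of_eq
      ((Tup.cast_snoc _ _ a).trans (congrArg (Tup.snoc · a) (Tup.append_assoc _ _ _).symm))
      ((Tup.cast_snoc _ _ a).trans (congrArg (Tup.snoc · a) (Tup.append_assoc _ _ _).symm))
    exact h₃.comp (ih.tens (ZDet.wires (x.snoc a)))

theorem ZDet.shuffle (m : ℕ) {n : ℕ} (x : Tup K n) :
    ZDet (Diag.shuffle m n) (x.stretch m) (x.copies m) := by
  induction n with
  | zero =>
    exact ((ZDet.wires (t0 : Tup K 0)).cast rfl (Nat.zero_mul m).symm).of_eq rfl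
      (Tup.eq_of_length_zero (Nat.zero_mul m) _ _)
  | succ n ih =>
    exact ((ih x.1).tens (ZDet.wires (const m x.2))).comp (ZDet.interleave x.1 x.2 m)

theorem zrel_fanIn {n : ℕ} (D : ZHDiag n 1) (x : Tup K n) {m : ℕ} (y : Tup K m) :
    zrel (fanIn D m) (x.copies m) y = y.prod fun a => zrel D x (t1 a) := by
  induction m with
  | zero => exact rel_wires (n := 0) _ _
  | succ m ih =>
    refine (zrel_tens (fanIn D m) D (x.copies m) y.1 x (t1 y.2)).trans ?_
    rw [ih]; rfl

theorem prod2_const_left (f : Var K → Var K → Eff K) (a : Var K) {n : ℕ} (y : Tup K n) :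
    prod2 f (const n a) y = y.prod fun b => f a b := by
  induction n with
  | zero => rfl
  | succ n ih => exact congrArg (· * f a y.2) (ih y.1)

/-- A diagram that computes a function of its inputs satisfies the bialgebra rule. -/
theorem bialgebra {n : ℕ} (m : ℕ) {D : ZHDiag n 1}
    (f : ∀ {K : Obj} [ComonObj K] [IsCommComonObj K], Tup K n → Var K)
    (hf : ∀ {K : Obj} [ComonObj K] [IsCommComonObj K] (x : Tup K n), f x.wk = (f x)↟)
    (hD : ∀ {K : Obj} [ComonObj K] [IsCommComonObj K] (x : Tup K n) (y : Var K),
      zrel D x (t1 y) = eqv (f x) y) :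
    Provable (ZH.toZX (D ⨟ ZH.Z 1 m))
      (ZH.toZX (fanOut (ZH.Z 1 m) n ⨟ shuffle m n ⨟ fanIn D m)) := by
  refine provable_of_zrel fun K _ _ x y => ?_
  rw [zrel_comp_det ((ZDet.fanOut m x).comp (ZDet.shuffle m x)), zrel_fanIn, zrel_comp1]
  simp only [hD, hf]
  have h := sm_eqv_mul (f x) (prod2 eqv (const m nw) y.wk)
  rw [pull_prod2_eqv, const_wk, fresh_inst, Tup.wk'_inst] at h
  rw [← prod2_const_left, ← h]
  congr 2
  exact rel_det (Det.spider m nw) y.wk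

/-! ### Derivability of the translated rules -/

theorem toZX_cast {n m n' m' : ℕ} (hn : n = n') (hm : m = m') (D : ZHDiag n m) :
    ZH.toZX (Diag.cast hn hm D) = Diag.cast hn hm (ZH.toZX D) := by subst hn hm; rfl

theorem white_fusion (n₁ m₁ k n₂ m₂ : ℕ) : Provable
    (ZH.toZX (Diag.cast rfl (Nat.add_assoc m₁ (k + 1) n₂) (ZH.Z n₁ (m₁ + (k + 1)) ⊠ wires n₂) ⨟
      (wires m₁ ⊠ ZH.Z (k + 1 + n₂) m₂))) (ZH.toZX (ZH.Z (n₁ + n₂) (m₁ + m₂))) := by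
  have h := Derives.rule (Rule.S1 n₁ m₁ k n₂ m₂ 1 1)
  rw [one_mul] at h
  rw [ZH.toZX, toZX_cast]
  exact h

theorem provable_of_rule {n m : ℕ} {D E : ZHDiag n m} (h : ZH.Rule D E) :
    Provable (ZH.toZX D) (ZH.toZX E) := by
  cases h with
  | ZS1 n₁ m₁ k n₂ m₂ => exact white_fusion n₁ m₁ k n₂ m₂
  | ZS2 => exact .rule .S2_green
  | HS1 n m a => exact box_fusion n m a
  | HS2 => exact had_had
  | BA1 n m => exact bialgebra m Tup.parity (fun x => parity_sub x _) (zrel_grey n)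
  | BA2 n m => exact bialgebra m Tup.conj (fun x => conj_sub x _) (zrel_and n)
  | M a b => exact multiply a b
  | U => exact unit
  | A a b => exact average a b
  | I a => exact intro a
  | O => exact ortho

end

/-! ### The translation preserves the interpretation -/

theorem sem_pow (f : ZXDiag 1 1) (n : ℕ) (y x : Bits n) :
    sem (pow f n) y x = ∏ i, sem f (fun _ => y i) (fun _ => x i) := by
  induction n with
  | zero =>
    have h : y = x := Subsingleton.elim _ _
    simp [h, pow, sem, Diag.sem]
  | succ n ih =>
    rw [Fin.prod_univ_castSucc]
    have h := ih (fun i => y (Fin.castAdd 1 i)) (fun i => x (Fin.castAdd 1 i))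
    have e : ∀ z : Bits (n + 1),
        (fun i : Fin 1 => z (Fin.natAdd n i)) = fun _ => z (Fin.last n) := by
      intro z; funext i; rw [Subsingleton.elim i 0]; rfl
    change sem (pow f n) _ _ * sem f _ _ = _
    rw [h, e, e]
    rfl

/-- A spider between two diagrams is a sum over one bit. -/
theorem sem_spider {n m n' m' : ℕ} (D : ZXDiag n' n) (E : ZXDiag m m') (a : ℂ) (y : Bits m')
    (x : Bits n') : sem (D ⨟ Z n m a ⨟ E) y x =
      sem E y (fun _ => 0) * sem D (fun _ => 0) x +
        a * (sem E y (fun _ => 1) * sem D (fun _ => 1) x) := by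
  change (sem E * (sem (Z n m a) * sem D)) y x = _
  have h : ∀ p q, sem (Z n m a) p q = (if p = (fun _ => 0) then 1 else 0) *
      (if q = (fun _ => 0) then 1 else 0) +
        a * ((if p = (fun _ => 1) then 1 else 0) * (if q = (fun _ => 1) then 1 else 0)) := by
    intro p q
    have h : ∀ {n : ℕ} (p : Bits n) (b : Fin 2), p = (fun _ => b) ↔ ∀ i, p i = b :=
      fun p b => funext_iff
    simp only [h, sem, Diag.sem, Z, genSem, ← ite_and, mul_ite, mul_one, mul_zero,
      and_comm]
  simp only [Matrix.mul_apply, h, add_mul, mul_add, Finset.sum_add_distrib]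
  congr 1
  · simp
  · simp [mul_left_comm _ a]

theorem sum_bits_succ {n : ℕ} (f : Bits (n + 1) → ℂ) :
    ∑ p, f p = ∑ p : Bits n, f (Fin.cons 0 p) + ∑ p : Bits n, f (Fin.cons 1 p) := by
  rw [← (Fin.consEquiv fun _ => Fin 2).sum_comp, Fintype.sum_prod_type, Fin.sum_univ_two]
  rfl

theorem sum_bits_three (f : Bits 3 → ℂ) : ∑ p, f p = ∑ a, ∑ b, ∑ c, f ![a, b, c] := by
  have h : (Unique.instInhabited.default : Bits 0) = ![] := Subsingleton.elim _ _
  simp only [sum_bits_succ, Fin.sum_univ_two, Fintype.sum_unique, Matrix.vecCons]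
  rw [← h]

theorem sem_comp {n m k : ℕ} (D : ZXDiag n m) (E : ZXDiag m k) (y : Bits k) (x : Bits n) :
    sem (D ⨟ E) y x = ∑ p, sem E y p * sem D p x := Matrix.mul_apply

theorem sem_tens {n m n' m' : ℕ} (D : ZXDiag n m) (E : ZXDiag n' m') (y : Bits (m + m'))
    (x : Bits (n + n')) : sem (D ⊠ E) y x =
      sem D (fun i => y (Fin.castAdd m' i)) (fun i => x (Fin.castAdd n' i)) *
        sem E (fun i => y (Fin.natAdd m i)) (fun i => x (Fin.natAdd n i)) := rfl

theorem sem_wires (n : ℕ) : sem (wires n) = 1 := rfl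

/-- Bending the wires of the triangle transposes its matrix. -/
theorem sem_Tdown (y x : Bits 1) : sem Tdown y x = sem T x y := by
  obtain ⟨b, rfl⟩ : ∃ b, y = fun _ => b := ⟨y 0, by funext i; rw [Subsingleton.elim i 0]⟩
  obtain ⟨c, rfl⟩ : ∃ c, x = fun _ => c := ⟨x 0, by funext i; rw [Subsingleton.elim i 0]⟩
  have h₁ : ∀ q r : Bits 3, sem (wires 1 ⊠ T ⊠ wires 1) q r =
      (if q 0 = r 0 then 1 else 0) * sem T (fun _ => q 1) (fun _ => r 1) *
        (if q 2 = r 2 then 1 else 0) := by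
    intro q r
    simp only [sem_tens, sem_wires, Matrix.one_apply, funext_iff, Fin.forall_fin_one]
    congr 3
    all_goals funext i; rw [Subsingleton.elim i 0]; rfl
  have h₂ : ∀ q : Bits 3, sem (wires 1 ⊠ cup) (fun _ => b) q =
      (if b = q 0 then 1 else 0) * (if q 1 = q 2 then 1 else 0) := by
    intro q
    simp only [sem_tens, sem_wires, Matrix.one_apply, funext_iff, Fin.forall_fin_one]
    rfl
  have h₃ : ∀ q : Bits 3, sem (cap ⊠ wires 1) q (fun _ => c) =
      (if q 0 = q 1 then 1 else 0) * (if q 2 = c then 1 else 0) := by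
    intro q
    simp only [sem_tens, sem_wires, Matrix.one_apply, funext_iff, Fin.forall_fin_one]
    rfl
  have e : sem Tdown (fun _ => b) (fun _ => c) = ∑ p : Bits 3, sem (wires 1 ⊠ cup) (fun _ => b) p *
      ∑ q : Bits 3, sem (wires 1 ⊠ T ⊠ wires 1) p q * sem (cap ⊠ wires 1) q (fun _ => c) := by
    rw [Tdown, sem_comp]
    simp only [sem_comp]
  simp only [e, h₁, h₂, h₃, sum_bits_three, Matrix.cons_val, Fin.sum_univ_two]
  fin_cases b <;> fin_cases c <;> simp

theorem prod_val {n : ℕ} (x : Bits n) : (∏ i, ((x i).val : ℂ)) = if ∀ i, x i = 1 then 1 else 0 := by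
  split_ifs with h
  · simp [h]
  · push Not at h
    obtain ⟨i, hi⟩ := h
    refine Finset.prod_eq_zero (Finset.mem_univ i) ?_
    have : (x i).val = 0 := by omega
    simp [this]

/-- Both values of the spider in the translated H-box contribute: `1`, and `a - 1` if all legs are
`1`. -/
theorem sem_box (n m : ℕ) (a : ℂ) (y : Bits m) (x : Bits n) :
    sem (ZH.toZX (ZH.H n m a)) y x = ZH.sem (ZH.H n m a) y x := by
  have e : sem (ZH.toZX (ZH.H n m a)) y x = _ :=
    sem_spider (pow T n) (pow Tdown m ⊠ (Tinv ⨟ Z 1 0 a)) 1 y x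
  have h₁ : ∀ c : Fin 2, sem (pow Tdown m ⊠ (Tinv ⨟ Z 1 0 a)) y (fun _ => c) =
      (∏ i, sem T (fun _ => c) (fun _ => y i)) * sem (Tinv ⨟ Z 1 0 a) default (fun _ => c) := by
    intro c
    have h := sem_pow Tdown m y (fun _ => c)
    simp only [sem_Tdown] at h
    rw [← h, Subsingleton.elim (default : Bits 0) fun i => y (Fin.natAdd m i)]
    rfl
  have h₂ : ∀ c : Fin 2, sem (Tinv ⨟ Z 1 0 a) default (fun _ => c) =
      1 + c.val * (a - 2) := by
    intro c
    simp only [sem_comp, sum_bits_succ]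
    fin_cases c <;> simp [sem, Diag.sem, Tinv, Z, genSem]
    ring
  have hT₀ : ∀ c : Fin 2, sem T (fun _ => 0) (fun _ => c) = 1 := by
    intro c
    fin_cases c <;> simp [sem, Diag.sem, T, genSem]
  have hT₁ : ∀ c : Fin 2, sem T (fun _ => 1) (fun _ => c) = (c.val : ℂ) := by
    intro c
    fin_cases c <;> simp [sem, Diag.sem, T, genSem]
  rw [e, h₁, h₁, h₂, h₂, sem_pow, sem_pow]
  simp only [hT₀, hT₁, prod_val]
  change _ = a ^ ((∏ i, (y i).val) * ∏ j, (x j).val)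
  have hv : ∀ {n : ℕ} (x : Bits n), (∏ i, (x i).val) = if ∀ i, x i = 1 then 1 else 0 := by
    intro n x
    exact_mod_cast prod_val x
  rw [hv, hv]
  split_ifs <;> simp <;> ring

theorem sem_toZX {n m : ℕ} (D : ZHDiag n m) : sem (ZH.toZX D) = ZH.sem D := by
  induction D with
  | gen g =>
    cases g with
    | Z =>
      ext y x
      change genSem (.Z _ _ 1) y x = ZH.genSem (.Z _ _) y x
      simp [genSem, ZH.genSem]
    | H a => ext y x; exact sem_box _ _ a y x
  | wires n => rfl
  | swap n m => rfl
  | cap => rfl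
  | cup => rfl
  | comp f g hf hg =>
    change sem (ZH.toZX g) * sem (ZH.toZX f) = ZH.sem g * ZH.sem f
    rw [hf, hg]
  | tens f g hf hg =>
    ext y x
    change sem (ZH.toZX f) _ _ * sem (ZH.toZX g) _ _ = ZH.sem f _ _ * ZH.sem g _ _
    rw [hf, hg]

end ZX

theorem theorem2 :
    (∀ (n m : ℕ) (D : ZHDiag n m), ZX.sem (ZH.toZX D) = ZH.sem D) ∧
      ∀ (n m : ℕ) (D E : ZHDiag n m), ZH.Rule D E → ZX.Provable (ZH.toZX D) (ZH.toZX E) :=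
  ⟨fun _ _ D => ZX.sem_toZX D, fun _ _ _ _ h => ZX.provable_of_rule h⟩
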